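/- Let $n,m\ge 1$, and let $\mathbb{R}^{2n+1}$ carry the contact form $\alpha=dz-\sum_{i=1}^n y_i\,dx_i$, with $\xi=\ker\alpha$, and the orientation given by the coordinates $(x_1,y_1,\dots,x_n,y_n,z)$. Let $\Lambda\subset\mathbb{R}^{2n+1}$ be a closed, connected, orientable Legendrian submanifold with finitely many Reeb chords (segments in the direction of $\partial_z$ with both ends on $\Lambda$), parametrized by an embedding $f$ with coordinates $x_i,y_i,z$. After a translation in the direction of $x_1$ assume that $x_1>0$ on $\Lambda$. The front $S^m$-spinning $\Sigma_{S^m}\Lambda\subset\mathbb{R}^{2(n+m)+1}$ is parametrized by $\Lambda\times S^m$, where $S^m\subset\mathbb{R}^{m+1}$ is the unit sphere: $$(p,\sigma)\mapsto\bigl(x_1(p)\sigma_0,\,y_1(p)\sigma_0,\dots,x_1(p)\sigma_m,\,y_1(p)\sigma_m,\,x_2(p),y_2(p),\dots,x_n(p),y_n(p),\,z(p)\bigr).$$ Suppose that $\Lambda$ has an exact Lagrangian filling, that is, there is an embedded connected orientable $(n+1)$-dimensional submanifold $L$ of $\mathbb{R}\times\mathbb{R}^{2n+1}$ (with first coordinate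 $t$) such that $e^t\alpha|_L$ is exact and such that, for some $T>0$, $L$ lies in $\{t>-T\}$, agrees with $\mathbb{R}\times\Lambda$ where $t\ge T$, and has compact intersection with $\{|t|\le T+1\}$. Then $\Sigma_{S^m}\Lambda$ is an embedded Legendrian submanifold, and: 1. $\Sigma_{S^m}\Lambda$ is homeomorphic to $\Lambda\times S^m$ (the parametrization above is a smooth embedding). 2. The rotation class of $\Sigma_{S^m}\Lambda$ is determined by the rotation class of $\Lambda$. Here the rotation class of a Legendrian embedding $f$ of a manifold $M$ is the homotopy class of $(f,df_{\mathbb{C}})$ in the space of complex fibrewise isomorphisms $TM\otimes\mathbb{C}\to\xi$ (covering arbitrary continuous maps from $M$ to the contact space). That is, if $g$ is another Legendrian embedding of the same manifold with the same rotation class as $f$, then the front $S^m$-spinnings of $g$ and $f$ have the same rotation class, whatever translations in the direction of $x_1$ are used to make $x_1$ positive. 3. Let $tb$ of a closed oriented Legendrian submanifold be its linking number with a small translate of it in the direction of $\partial_z$ (this does not depend on the orientation when the submanifold is connected). Then $tb(\Lambda)$ and $tb(\Sigma_{S^m}\Lambda)$ are well defined and $$tb(\Sigma_{S^m}\Lambda)=\begin{cases}2(-1)^{m/2}\,tb(\Lambda),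 & m \text{ even},\\ 0, & m\text{ odd}.\end{cases}$$ -/

import Mathlib

open Set Filter Topology Manifold
open scoped ContDiff

noncomputable section

/-- Euclidean space `ℝ^{2n+1}`; a point is `(x, y, z)` with `x = (x₁, …, xₙ)`, `y = (y₁, …, yₙ)`. -/
abbrev ContactSpace (n : ℕ) : Type := (Fin n → ℝ) × (Fin n → ℝ) × ℝ

namespace ContactSpace

/-- The coordinates in the order `(x₁, y₁, …, xₙ, yₙ, z)`, which orients `ℝ^{2n+1}`. -/
def coord {n : ℕ} (w : ContactSpace n) (r : Fin (n + n + 1)) : ℝ :=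
  if h : r.1 / 2 < n then
    (if r.1 % 2 = 0 then w.1 ⟨r.1 / 2, h⟩ else w.2.1 ⟨r.1 / 2, h⟩)
  else w.2.2

/-- The contact form `α = dz - ∑ yᵢ dxᵢ` at the point `q`. -/
def contactForm {n : ℕ} (q : ContactSpace n) : ContactSpace n →ₗ[ℝ] ℝ where
  toFun w := w.2.2 - ∑ i, q.2.1 i * w.1 i
  map_add' u v := by
    simp only [Prod.snd_add, Prod.fst_add, Pi.add_apply, mul_add, Finset.sum_add_distrib]
    ring
  map_smul' c v := by
    simp only [Prod.smul_snd, Prod.smul_fst, Pi.smul_apply, smul_eq_mul, RingHom.id_apply,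
      mul_sub, Finset.mul_sum]
    congr 1
    exact Finset.sum_congr rfl fun i _ => by ring

/-- The contact hyperplane `ξ_q = ker α_q`. -/
def contactPlane {n : ℕ} (q : ContactSpace n) : Submodule ℝ (ContactSpace n) :=
  LinearMap.ker (contactForm q)

/-- The complex structure of `ξ_q`, compatible with `dα`: it sends `∂_{xᵢ} + yᵢ ∂_z` to `∂_{yᵢ}`
and `∂_{yᵢ}` to `-(∂_{xᵢ} + yᵢ ∂_z)`. (Only its values on `ξ_q` are used.) -/
def complexStructure {n : ℕ} (q w : ContactSpace n) : ContactSpace n :=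
  (-w.2.1, w.1, -∑ i, q.2.1 i * w.2.1 i)

/-- Translation by `ε` along the Reeb field `∂_z`. -/
def reebShift {n : ℕ} (ε : ℝ) (w : ContactSpace n) : ContactSpace n :=
  (w.1, w.2.1, w.2.2 + ε)

end ContactSpace

open ContactSpace

/-- The Reeb chords of `f(M)`, recorded by their start and end points. -/
def reebChords {M : Type*} {n : ℕ} (f : M → ContactSpace n) : Set (M × M) :=
  {pq | ∃ ℓ : ℝ, 0 < ℓ ∧ f pq.2 = reebShift ℓ (f pq.1)}

/-- The preimage of the direction `v` under the Gauss map `(p, q) ↦ (g q - f p) / ‖g q - f p‖`. -/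
def gaussPreimage {M : Type*} {n : ℕ} (f g : M → ContactSpace n) (v : ContactSpace n) : Set (M × M) :=
  {pq | ∃ c : ℝ, 0 < c ∧ g pq.2 - f pq.1 = c • v}

section Manifolds

variable {E H : Type*} [NormedAddCommGroup E] [NormedSpace ℝ E] [TopologicalSpace H]
  (I : ModelWithCorners ℝ E H) {M : Type*} [TopologicalSpace M] [ChartedSpace H M]

variable (M) in
/-- An orientation of a `d`-dimensional manifold, given by a positively oriented frame of each
tangent space (the frames need not depend continuously on the point): near `p`, the frame at `q`,
transported to `T_p M` by the chart at `p`, is positive with respect to the frame at `p`. -/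
structure ManifoldOrientation [IsManifold I 1 M] (d : ℕ) where
  frame : ∀ p : M, Module.Basis (Fin d) ℝ (TangentSpace I p)
  coherent : ∀ p : M, ∀ᶠ q in 𝓝 p,
    0 < (frame p).det (fun i => tangentCoordChange I q p q (frame q i))

/-- A smooth embedding `f : M → ℝ^{2n+1}` of an `n`-manifold that is everywhere tangent to `ξ`. -/
structure IsLegendrianEmbedding {n : ℕ} (f : M → ContactSpace n) : Prop where
  dim : Module.finrank ℝ E = n
  smooth : ContMDiff I 𝓘(ℝ, ContactSpace n) ∞ f
  embedding : IsEmbedding f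
  immersion : ∀ p, Function.Injective (mfderiv I 𝓘(ℝ, ContactSpace n) f p)
  tangent : ∀ (p : M) (u : TangentSpace I p),
    (mfderiv I 𝓘(ℝ, ContactSpace n) f p u : ContactSpace n) ∈ contactPlane (f p)

/-! ### Exact Lagrangian fillings -/

/-- `F : L → ℝ × ℝ^{2n+1}` parametrizes an embedded connected orientable exact Lagrangian
submanifold of the symplectization `(ℝ × ℝ^{2n+1}, d(e^t α))` that fills the subset `Λ`:
it is contained in `t > -T`, it agrees with `ℝ × Λ` where `t ≥ T`, and its part
with `|t| ≤ T + 1` is compact. Being exact means that `e^t α` pulls back to `dh`. -/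
structure IsExactLagrangianFilling {n : ℕ} [IsManifold I 1 M] (F : M → ℝ × ContactSpace n)
    (Λ : Set (ContactSpace n)) : Prop where
  dim : Module.finrank ℝ E = n + 1
  smooth : ContMDiff I 𝓘(ℝ, ℝ × ContactSpace n) ∞ F
  embedding : IsEmbedding F
  immersion : ∀ p, Function.Injective (mfderiv I 𝓘(ℝ, ℝ × ContactSpace n) F p)
  connected : ConnectedSpace M
  orientable : Nonempty (ManifoldOrientation I M (n + 1))
  exact_form : ∃ h : M → ℝ, ContMDiff I 𝓘(ℝ, ℝ) ∞ h ∧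
    ∀ (p : M) (u : TangentSpace I p),
      (mfderiv I 𝓘(ℝ, ℝ) h p u : ℝ) = Real.exp (F p).1 *
        contactForm (F p).2 (mfderiv I 𝓘(ℝ, ℝ × ContactSpace n) F p u : ℝ × ContactSpace n).2
  ends : ∃ T : ℝ, 0 < T ∧ (∀ p, -T < (F p).1) ∧
    range F ∩ {w | T ≤ w.1} = {w | T ≤ w.1 ∧ w.2 ∈ Λ} ∧
    IsCompact (range F ∩ {w | -T - 1 ≤ w.1 ∧ w.1 ≤ T + 1})

/-! ### The Thurston–Bennequin number -/

/-- The determinant of `(v, df(e₁), …, df(eₙ), dg(e'₁), …, dg(e'ₙ))` in the oriented coordinates of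
`ℝ^{2n+1}`, where `e` and `e'` are the positive frames of `M` at the two points of `pq`. -/
def linkingDet {n : ℕ} [IsManifold I 1 M] (o : ManifoldOrientation I M n)
    (f g : M → ContactSpace n) (v : ContactSpace n) (pq : M × M) : ℝ :=
  Matrix.det (Matrix.of fun r c : Fin (n + n + 1) =>
    coord ((Fin.cons v (Fin.append
        (fun i => (mfderiv I 𝓘(ℝ, ContactSpace n) f pq.1 (o.frame pq.1 i) : ContactSpace n))
        (fun i => (mfderiv I 𝓘(ℝ, ContactSpace n) g pq.2 (o.frame pq.2 i) : ContactSpace n))) :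
      Fin (n + n + 1) → ContactSpace n) c) r)

/-- `k` is the linking number of the disjoint oriented closed submanifolds `f(M)`, `g(M)` of
`ℝ^{2n+1}`: the degree, computed at any regular value, of the Gauss map
`(p, q) ↦ (g q - f p) / ‖g q - f p‖`. The degree is normalized by `(-1)^{n+1}`, so that the linking
number is the intersection number with `g(M)` of an oriented chain bounded by `f(M)`.
The direction `v` is a regular value iff `linkingDet` vanishes nowhere on its preimage;
the local degree there is `(-1)^n` times the sign of `linkingDet`. -/
def IsLinkingNumber {n : ℕ} [IsManifold I 1 M] (o : ManifoldOrientation I M n)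
    (f g : M → ContactSpace n) (k : ℤ) : Prop :=
  Disjoint (range f) (range g) ∧
  ∀ v : ContactSpace n, v ≠ 0 →
    (∀ pq ∈ gaussPreimage f g v, linkingDet I o f g v pq ≠ 0) →
    (gaussPreimage f g v).Finite ∧
    k = -∑ᶠ pq ∈ gaussPreimage f g v, (SignType.sign (linkingDet I o f g v pq) : ℤ)

/-- `k` is the Thurston–Bennequin number of the closed orientable Legendrian submanifold `f(M)`:
its linking number with its translate by `ε` along the Reeb field, for all small `ε > 0`
(and for either choice of orientation). -/
def IsThurstonBennequinNumber {n : ℕ} [IsManifold I 1 M] (f : M → ContactSpace n) (k : ℤ) : Prop :=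
  Nonempty (ManifoldOrientation I M n) ∧
  ∀ o : ManifoldOrientation I M n, ∀ᶠ ε in 𝓝[>] (0 : ℝ),
    IsLinkingNumber I o f (fun p => reebShift ε (f p)) k

/-! ### The rotation class -/

/-- `(b, φ)` is a complex fibrewise isomorphism `TM ⊗ ℂ → ξ` covering `b : M → ℝ^{2n+1}`. It is given
by its restriction `φ` to `TM`; the complexified map sends `u ⊗ 1 + w ⊗ i` to `φ u + J (φ w)`. -/
structure IsComplexFibreIso {n : ℕ} [IsManifold I 1 M]
    (b : M → ContactSpace n) (φ : TangentBundle I M → ContactSpace n) : Prop where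
  continuous_base : Continuous b
  continuous_map : Continuous φ
  linear : ∀ p : M, IsLinearMap ℝ (fun u : TangentSpace I p => φ ⟨p, u⟩)
  bijective : ∀ p : M, BijOn
    (fun u : TangentSpace I p × TangentSpace I p =>
      φ ⟨p, u.1⟩ + complexStructure (b p) (φ ⟨p, u.2⟩))
    univ (contactPlane (b p))

/-- Homotopy in the space of complex fibrewise isomorphisms `TM ⊗ ℂ → ξ`. -/
def FibreIsoHomotopic {n : ℕ} [IsManifold I 1 M]
    (a a' : (M → ContactSpace n) × (TangentBundle I M → ContactSpace n)) : Prop :=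
  ∃ (B : unitInterval × M → ContactSpace n)
    (Φ : unitInterval × TangentBundle I M → ContactSpace n),
    Continuous B ∧ Continuous Φ ∧
    (∀ s, IsComplexFibreIso I (fun p => B (s, p)) (fun u => Φ (s, u))) ∧
    ((fun p => B (0, p)), (fun u => Φ (0, u))) = a ∧
    ((fun p => B (1, p)), (fun u => Φ (1, u))) = a'

/-- The rotation class of `f`: the homotopy class of `(f, df_ℂ)` in the space of complex fibrewise
isomorphisms `TM ⊗ ℂ → ξ`. -/
def rotationClass {n : ℕ} [IsManifold I 1 M] (f : M → ContactSpace n) :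
    Set ((M → ContactSpace n) × (TangentBundle I M → ContactSpace n)) :=
  {a | FibreIsoHomotopic I
    (f, fun u => (mfderiv I 𝓘(ℝ, ContactSpace n) f u.proj u.snd : ContactSpace n)) a}

end Manifolds

/-! ### Front spinning -/

/-- The unit sphere `S^m` in `ℝ^{m+1}`. -/
abbrev UnitSphere (m : ℕ) : Type := Metric.sphere (0 : EuclideanSpace ℝ (Fin (m + 1))) 1

/-- The front `S^m`-spinning of `f : M → ℝ^{2(n+1)+1}` translated by `c` in the direction of `x₁`:
`(p, σ) ↦ (x₁σ₀, y₁σ₀, …, x₁σₘ, y₁σₘ, x₂, y₂, …, z)`, where `x₁` stands for `x₁(p) + c`.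
The point `σ ∈ S^m` has the spherical coordinates
`(sin θ sin φ₁ ⋯ sin φₘ₋₁, cos θ sin φ₁ ⋯ sin φₘ₋₁, cos φ₁ sin φ₂ ⋯ sin φₘ₋₁, …, cos φₘ₋₁)`. -/
def frontSpin {M : Type*} {n : ℕ} (m : ℕ) (c : ℝ) (f : M → ContactSpace (n + 1)) :
    M × UnitSphere m → ContactSpace (m + 1 + n) := fun pσ =>
  (Fin.append (fun i => ((f pσ.1).1 0 + c) * pσ.2.1 i) (fun j => (f pσ.1).1 j.succ),
   Fin.append (fun i => (f pσ.1).2.1 0 * pσ.2.1 i) (fun j => (f pσ.1).2.1 j.succ),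
   (f pσ.1).2.2)

end

/-!
The front spinning is the composition of `f` and the inclusion of the sphere with the polynomial map
`spinPoint`, whose differential at `(w, σ)` is `spinDeriv`. Vectors tangent to the sphere at `σ` are
orthogonal to `σ`, so the components along and orthogonal to `σ` separate the contributions of `M`
and of `S^m`. The first give back the differential of `f`, and the second are multiplication by the
complex number `x₁ + c + i y₁`, which is nonzero. Hence the spinning is a Legendrian embedding
(`IsLegendrianEmbedding.frontSpin`), and its image is homeomorphic to the product
(`nonempty_homeomorph_range_frontSpin`).

For the rotation class, `(f, df_ℂ)` is a complex fibrewise isomorphism since Legendrian tangent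
spaces are isotropic for `dα` (`IsLegendrianEmbedding.isComplexFibreIso`). A homotopy from
`(g, dg_ℂ)` to `(f, df_ℂ)` spins to one between the differentials of the spinnings
(`FibreIsoHomotopic.frontSpin`): along `σ` use the given homotopy, and orthogonally to `σ`
multiplication by a function with values in the right half-plane, which is convex, so that the
functions `x₁ + c' + i y₁` of `g` and `x₁ + c + i y₁` of `f` are joined by segments.

The Thurston–Bennequin number needs the degree of proper maps from an oriented manifold to a vector
space. The integral of the Jacobian determinant of a compactly supported map vanishes
(`integral_det_fderiv_eq_zero`), so the integral of `ρ(G - y) det DG`, where `ρ` is the Jacobian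
determinant of some map, depends only on `G` near the boundary of a ball. For `ρ` concentrated at
`0` it is a positive multiple of the signed number of preimages of `y` in the ball. On a manifold
this shows that changing a map in a coordinate ball preserves the signed number of preimages of
almost every value. Translating a map by one bump function after the other then shows that the
count is the same at regular values close to each other, hence at all regular values in a
connected set over which the map is proper (`signedCount_eq_of_isPreconnected`). Regular values exist by
Sard's theorem (`exists_regular_value`).

The degree of the Gauss map `(p, q) ↦ (g q - f p) / ‖g q - f p‖` becomes a degree of this kind after
adding a real variable. Preimages of the direction `v` are preimages of `v` under
`(p, q, s) ↦ e⁻ˢ (g q - f p)`, which is proper over the connected complement of the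
origin, so all regular directions give the same count (`gaussCount_eq`). For a translate `g + w`
they are the preimages of `-w` under
`(p, q, s) ↦ g q - f p - eˢ v`, so the count does not change while `g` is translated without meeting
`f` (`gaussCount_add_const_eq`). Since the Reeb chords are finite in number, their lengths are
bounded below, and the Thurston–Bennequin number of `f` is computed by one short translation and one
regular direction (`isThurstonBennequinNumber_iff`). The Reeb chords of the spinning are those of
`f`, one for each point of the sphere, so the same applies to it, with the same translation.

For the spinning choose a direction `w` close to `∂_{y₁}`, embedded in the plane of the first
coordinates. The points `(x₁ + c, y₁)` lie on one side of the line through the origin in such a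
direction, which forces the preimages to lie over the two poles `±(1, 0, …, 0)` of the sphere. They
are the preimages for `f` of the direction `w` and of its reflection (`gaussPreimage_frontSpin`). At
these points the linking determinant splits into that of `f`, and, for each direction tangent to the
sphere, a determinant of size two whose sign is that of the pole (`sign_linkingDet_frontSpin`). So
the poles contribute `1` and `(-1)^m` times the count of `f` (`gaussCount_frontSpin`): they cancel
for odd `m` and add up for even `m`. In the latter case the passage from the coordinate order
`(x₁, y₁, …, z)` to the order `(x, y, z)`, in which the determinant splits, contributes the sign
`(-1)^(m/2)` (`shuffleSign_mul_shuffleSign`).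
-/

noncomputable section

open MeasureTheory ContactSpace

/-! ### The integral of a compactly supported Jacobian determinant -/

section NullLagrangian

variable {E : Type*} [NormedAddCommGroup E] [NormedSpace ℝ E] [FiniteDimensional ℝ E]

/-- A real polynomial of degree at most `D` is determined linearly by its values at `D + 1` nodes,
which may be taken as large as desired. -/
theorem Polynomial.exists_eval_zero_eq_sum (D : ℕ) (s₀ : ℝ) :
    ∃ w : ℕ → ℝ, ∀ p : Polynomial ℝ, p.natDegree ≤ D →
      p.eval 0 = ∑ j ∈ Finset.range (D + 1), w j * p.eval (s₀ + j) := by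
  classical
  refine ⟨fun j => (Lagrange.basis (Finset.range (D + 1)) (fun j : ℕ => s₀ + j) j).eval 0,
    fun p hp => ?_⟩
  have hinj : Set.InjOn (fun j : ℕ => s₀ + (j : ℝ)) (Finset.range (D + 1) : Set ℕ) := by
    intro i _ j _ h
    simpa using h
  have hdeg : p.degree < (Finset.range (D + 1)).card := by
    rw [Finset.card_range]
    exact lt_of_le_of_lt Polynomial.degree_le_natDegree (by exact_mod_cast Nat.lt_succ_of_le hp)
  conv_lhs => rw [Lagrange.eq_interpolate hinj hdeg, Lagrange.interpolate_apply]
  rw [Polynomial.eval_finsetSum]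
  refine Finset.sum_congr rfl fun j _ => ?_
  rw [Polynomial.eval_mul, Polynomial.eval_C, mul_comm]

/-- The polynomial is the characteristic polynomial of `-A`. -/
theorem ContinuousLinearMap.exists_polynomial_eval_eq_det_smul_add (A : E →L[ℝ] E) :
    ∃ p : Polynomial ℝ, p.natDegree ≤ Module.finrank ℝ E ∧
      ∀ s : ℝ, p.eval s = (s • ContinuousLinearMap.id ℝ E + A).det := by
  refine ⟨(-(A : E →ₗ[ℝ] E)).charpoly, (LinearMap.charpoly_natDegree _).le, fun s => ?_⟩
  rw [LinearMap.eval_charpoly]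
  unfold ContinuousLinearMap.det
  congr 1
  ext x
  simp [Algebra.algebraMap_eq_smul_one]

variable [MeasurableSpace E] [BorelSpace E] (μ : Measure E) [μ.IsAddHaarMeasure]

/-- A small compactly supported perturbation of the identity is a bijection that preserves a large
ball, so the integral of its Jacobian determinant over this ball is the volume of the ball. -/
theorem integral_det_id_add_smul_fderiv {h : E → E} (hh : ContDiff ℝ 1 h) {R : ℝ}
    (hR : tsupport h ⊆ Metric.closedBall 0 R) :
    ∀ᶠ t in 𝓝 (0 : ℝ), ∫ x in Metric.closedBall (0 : E) R,
      (ContinuousLinearMap.id ℝ E + t • fderiv ℝ h x).det ∂μ = μ.real (Metric.closedBall 0 R) := by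
  have hc : HasCompactSupport h :=
    HasCompactSupport.of_support_subset_isCompact (isCompact_closedBall 0 R)
      ((subset_tsupport h).trans hR)
  obtain ⟨C, hC⟩ := (hh.continuous_fderiv one_ne_zero).bounded_above_of_compact_support
    (hc.fderiv ℝ)
  have hC0 : 0 ≤ C := (norm_nonneg _).trans (hC 0)
  have hdet : ∀ᶠ A in 𝓝 (0 : E →L[ℝ] E), 0 < (ContinuousLinearMap.id ℝ E + A).det := by
    have hcont : Continuous fun A : E →L[ℝ] E => (ContinuousLinearMap.id ℝ E + A).det :=
      ContinuousLinearMap.continuous_det.comp (continuous_const.add continuous_id)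
    refine hcont.continuousAt.eventually_mem (lt_mem_nhds ?_)
    simp [ContinuousLinearMap.det]
  obtain ⟨δ, hδ, hdet⟩ := Metric.eventually_nhds_iff.1 hdet
  have hev : ∀ᶠ t in 𝓝 (0 : ℝ), |t| * C < min δ 1 := by
    have : Continuous fun t : ℝ => |t| * C := continuous_abs.mul continuous_const
    refine this.continuousAt.eventually_mem (gt_mem_nhds ?_)
    simpa using hδ
  filter_upwards [hev] with t ht
  have hdiff : Differentiable ℝ h := hh.differentiable one_ne_zero
  set f : E → E := fun x => x + t • h x with hf
  have hf' : ∀ x, HasFDerivAt f (ContinuousLinearMap.id ℝ E + t • fderiv ℝ h x) x := fun x =>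
    (hasFDerivAt_id x).add ((hdiff x).hasFDerivAt.const_smul t)
  have hnorm : ∀ x, ‖t • fderiv ℝ h x‖ ≤ |t| * C := fun x => by
    rw [norm_smul, Real.norm_eq_abs]
    exact mul_le_mul_of_nonneg_left (hC x) (abs_nonneg t)
  have hpos : ∀ x, 0 < (ContinuousLinearMap.id ℝ E + t • fderiv ℝ h x).det := fun x =>
    hdet (by rw [dist_zero_right]; exact (hnorm x).trans_lt (ht.trans_le (min_le_left _ _)))
  have hlip : LipschitzWith (Real.toNNReal (|t| * C)) (fun x => t • h x) := by
    refine lipschitzWith_of_nnnorm_fderiv_le (𝕜 := ℝ) (hdiff.const_smul t) fun x => ?_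
    rw [fderiv_fun_const_smul (hdiff x), ← NNReal.coe_le_coe, coe_nnnorm,
      Real.coe_toNNReal _ (by positivity)]
    exact hnorm x
  have happ : ApproximatesLinearOn f ((ContinuousLinearEquiv.refl ℝ E : E ≃L[ℝ] E) : E →L[ℝ] E)
      univ (Real.toNNReal (|t| * C)) := by
    refine LipschitzOnWith.approximatesLinearOn (f := f) ?_
    refine LipschitzWith.lipschitzOnWith ?_
    convert hlip using 1
    ext x
    simp [hf]
  have hsmall : Subsingleton E ∨ Real.toNNReal (|t| * C) <
      ‖((ContinuousLinearEquiv.refl ℝ E : E ≃L[ℝ] E).symm : E →L[ℝ] E)‖₊⁻¹ := by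
    rcases subsingleton_or_nontrivial E with hE | hE
    · exact Or.inl hE
    · right
      have : ‖((ContinuousLinearEquiv.refl ℝ E : E ≃L[ℝ] E).symm : E →L[ℝ] E)‖₊ = 1 :=
        ContinuousLinearMap.nnnorm_id
      rw [this, inv_one, ← NNReal.coe_lt_coe, Real.coe_toNNReal _ (by positivity)]
      exact ht.trans_le (min_le_right _ _)
  have hinj : Function.Injective f := by
    have := happ.injective hsmall
    intro x y hxy
    have := @this ⟨x, mem_univ x⟩ ⟨y, mem_univ y⟩ hxy
    simpa using this
  have hsurj : Function.Surjective f := happ.surjective hsmall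
  have hfix : ∀ x ∉ Metric.closedBall (0 : E) R, f x = x := fun x hx => by
    have : h x = 0 := image_eq_zero_of_notMem_tsupport fun h' => hx (hR h')
    simp [hf, this]
  have himage : f '' Metric.closedBall 0 R = Metric.closedBall 0 R := by
    apply Subset.antisymm
    · rintro _ ⟨x, hx, rfl⟩
      by_contra hy
      have := hinj (hfix _ hy)
      exact hy (by rw [this]; exact hx)
    · intro y hy
      obtain ⟨x, rfl⟩ := hsurj y
      by_cases hx : x ∈ Metric.closedBall (0 : E) R
      · exact ⟨x, hx, rfl⟩
      · rw [hfix x hx] at hy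
        exact absurd hy hx
  have key := integral_image_eq_integral_abs_det_fderiv_smul μ
    (s := Metric.closedBall (0 : E) R) (f := f)
    (f' := fun x => ContinuousLinearMap.id ℝ E + t • fderiv ℝ h x)
    Metric.isClosed_closedBall.measurableSet (fun x _ => (hf' x).hasFDerivWithinAt)
    hinj.injOn (fun _ => (1 : ℝ))
  rw [himage] at key
  simp only [smul_eq_mul, mul_one, integral_const, MeasurableSet.univ, measureReal_restrict_apply,
    univ_inter] at key
  rw [key]
  exact integral_congr_ae (ae_of_all _ fun x => (abs_of_pos (hpos x)).symm)

/-- The Jacobian determinant is a null Lagrangian. Milnor's argument: the integral of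
`det (s + Dh)` over a large ball of volume `V` equals `s ^ d * V` for all large `s`, and it is
a polynomial in `s`; the claim is the comparison of the values at `s = 0`. -/
theorem integral_det_fderiv_eq_zero [Nontrivial E] {h : E → E} (hh : ContDiff ℝ 1 h)
    (hc : HasCompactSupport h) : ∫ x, (fderiv ℝ h x).det ∂μ = 0 := by
  obtain ⟨R, hR⟩ := hc.isCompact.isBounded.subset_closedBall (0 : E)
  obtain ⟨ε, hε, hball⟩ := Metric.eventually_nhds_iff.1 (integral_det_id_add_smul_fderiv μ hh hR)
  set D := Module.finrank ℝ E with hD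
  have hD0 : D ≠ 0 := Module.finrank_pos.ne'
  obtain ⟨w, hw⟩ := Polynomial.exists_eval_zero_eq_sum D (ε⁻¹ + 1)
  have hs : ∀ j : ℕ, ε⁻¹ < ε⁻¹ + 1 + j := fun j => by
    have : (0 : ℝ) ≤ j := Nat.cast_nonneg j
    linarith
  have hs0 : ∀ j : ℕ, 0 < ε⁻¹ + 1 + (j : ℝ) := fun j => (inv_pos.2 hε).trans (hs j)
  have hcontd : Continuous (fderiv ℝ h) := hh.continuous_fderiv one_ne_zero
  have hnode : ∀ j : ℕ, ∫ x in Metric.closedBall (0 : E) R,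
      ((ε⁻¹ + 1 + (j : ℝ)) • ContinuousLinearMap.id ℝ E + fderiv ℝ h x).det ∂μ =
      (ε⁻¹ + 1 + (j : ℝ)) ^ D * μ.real (Metric.closedBall 0 R) := fun j => by
    set s : ℝ := ε⁻¹ + 1 + j with hsdef
    have h1 := @hball s⁻¹ (by
      rw [dist_zero_right, Real.norm_eq_abs, abs_of_pos (inv_pos.2 (hs0 j))]
      exact inv_lt_of_inv_lt₀ hε (hs j))
    rw [← h1, ← integral_const_mul]
    refine integral_congr_ae (ae_of_all _ fun x => ?_)
    have : s • ContinuousLinearMap.id ℝ E + fderiv ℝ h x =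
        s • (ContinuousLinearMap.id ℝ E + s⁻¹ • fderiv ℝ h x) := by
      rw [smul_add, smul_smul, mul_inv_cancel₀ (hs0 j).ne', one_smul]
    simp only [this]
    exact LinearMap.det_smul s _
  have hint : ∀ s : ℝ, IntegrableOn
      (fun x => (s • ContinuousLinearMap.id ℝ E + fderiv ℝ h x).det) (Metric.closedBall 0 R) μ :=
    fun s => (ContinuousLinearMap.continuous_det.comp
      (continuous_const.add hcontd)).continuousOn.integrableOn_compact (isCompact_closedBall 0 R)
  have hsupp : ∫ x, (fderiv ℝ h x).det ∂μ =
      ∫ x in Metric.closedBall (0 : E) R, (fderiv ℝ h x).det ∂μ := by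
    refine (setIntegral_eq_integral_of_forall_compl_eq_zero fun x hx => ?_).symm
    have : fderiv ℝ h x = 0 := by
      by_contra hne
      exact hx (hR (support_fderiv_subset ℝ hne))
    rw [this]
    exact (LinearMap.det_zero (M := E)).trans (zero_pow hD0)
  rw [hsupp]
  -- `det (s + Dh)` is a polynomial in `s` at each point, so its value at `s = 0` is a combination
  -- of the values at the large nodes, with coefficients independent of the point
  have hexp : ∀ x, (fderiv ℝ h x).det = ∑ j ∈ Finset.range (D + 1),
      w j * ((ε⁻¹ + 1 + (j : ℝ)) • ContinuousLinearMap.id ℝ E + fderiv ℝ h x).det := fun x => by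
    obtain ⟨p, hp, hpe⟩ := (fderiv ℝ h x).exists_polynomial_eval_eq_det_smul_add
    have := hw p hp
    rw [hpe 0, zero_smul, zero_add] at this
    rw [this]
    exact Finset.sum_congr rfl fun j _ => by rw [hpe]
  simp_rw [hexp]
  rw [integral_finsetSum _ fun j _ => (hint _).const_mul _]
  simp_rw [integral_const_mul, hnode]
  have h0 := hw (Polynomial.C (μ.real (Metric.closedBall (0 : E) R)) * Polynomial.X ^ D)
    (Polynomial.natDegree_C_mul_X_pow_le _ _)
  simp only [Polynomial.eval_mul, Polynomial.eval_C, Polynomial.eval_pow, Polynomial.eval_X,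
    zero_pow hD0, mul_zero] at h0
  rw [h0]
  exact Finset.sum_congr rfl fun j _ => by ring

end NullLagrangian

/-! ### Sheets over a regular value -/

/-- An open neighbourhood `U` of `x` that `G` maps injectively onto a neighbourhood of `G x`, and on
which the index `s` is constant. -/
structure IsSheet {X Y Z : Type*} [TopologicalSpace X] [TopologicalSpace Y] (G : X → Y) (s : X → Z)
    (x : X) (U : Set X) : Prop where
  isOpen : IsOpen U
  mem : x ∈ U
  injOn : InjOn G U
  image_mem : G '' U ∈ 𝓝 (G x)
  index_eq : ∀ x' ∈ U, s x' = s x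

/-- The stack of records: if every preimage of `y` in the compact set `S` has arbitrarily small
sheets, there are finitely many preimages, with disjoint sheets, and the part of `S` over
a neighbourhood of `y` is contained in these sheets. -/
theorem exists_stack_of_sheets {X Y Z : Type*} [TopologicalSpace X] [T2Space X]
    [TopologicalSpace Y] [T2Space Y] {G : X → Y} {s : X → Z} {S : Set X} (hS : IsCompact S)
    (hG : ContinuousOn G S) {y : Y} {N : Set X} (hN : ∀ x ∈ S, G x = y → N ∈ 𝓝 x)
    (hloc : ∀ x ∈ S, G x = y → ∀ N' ∈ 𝓝 x, ∃ U ⊆ N', IsSheet G s x U) :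
    ∃ (P : Finset X) (U : X → Set X), (P : Set X) = S ∩ G ⁻¹' {y} ∧
      (∀ x ∈ P, U x ⊆ N ∧ IsSheet G s x (U x)) ∧ (P : Set X).PairwiseDisjoint U ∧
      ∃ V ∈ 𝓝 y, (∀ x ∈ S, G x ∈ V → ∃ p ∈ P, x ∈ U p) ∧ ∀ p ∈ P, V ⊆ G '' U p := by
  classical
  have hclosed : IsClosed (S ∩ G ⁻¹' {y}) := hG.preimage_isClosed_of_isClosed hS.isClosed
    isClosed_singleton
  have hZ : IsCompact (S ∩ G ⁻¹' {y}) := hS.of_isClosed_subset hclosed inter_subset_left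
  have hfin : (S ∩ G ⁻¹' {y}).Finite := by
    choose! W hW hWs using fun x (hx : x ∈ S ∩ G ⁻¹' {y}) => hloc x hx.1 hx.2 univ univ_mem
    obtain ⟨t, ht, hcov⟩ := hZ.elim_nhds_subcover W fun x hx =>
      (hWs x hx).isOpen.mem_nhds (hWs x hx).mem
    refine t.finite_toSet.subset fun x hx => ?_
    obtain ⟨p, hp, hxp⟩ := mem_iUnion₂.1 (hcov hx)
    have := (hWs p (ht p hp)).injOn hxp (hWs p (ht p hp)).mem
      ((show G x = y from hx.2).trans (show G p = y from (ht p hp).2).symm)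
    rw [this]
    exact hp
  obtain ⟨W, hW, hdisj⟩ := hfin.t2_separation
  choose! U hUN hU using fun x (hx : x ∈ S ∩ G ⁻¹' {y}) => hloc x hx.1 hx.2 (N ∩ W x)
    (inter_mem (hN x hx.1 hx.2) ((hW x).2.mem_nhds (hW x).1))
  refine ⟨hfin.toFinset, U, hfin.coe_toFinset, ?_, ?_, ?_⟩
  · intro x hx
    rw [Finite.mem_toFinset] at hx
    exact ⟨(hUN x hx).trans inter_subset_left, hU x hx⟩
  · rw [hfin.coe_toFinset]
    intro a ha b hb hab
    exact (hdisj ha hb hab).mono ((hUN a ha).trans inter_subset_right)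
      ((hUN b hb).trans inter_subset_right)
  · have hOpen : IsOpen (⋃ p ∈ hfin.toFinset, U p) := isOpen_biUnion fun p hp =>
      (hU p (hfin.mem_toFinset.1 hp)).isOpen
    have hcomp : IsCompact (S \ ⋃ p ∈ hfin.toFinset, U p) := hS.diff hOpen
    have himg : IsCompact (G '' (S \ ⋃ p ∈ hfin.toFinset, U p)) :=
      hcomp.image_of_continuousOn (hG.mono sdiff_subset)
    have hy : y ∉ G '' (S \ ⋃ p ∈ hfin.toFinset, U p) := by
      rintro ⟨x, hx, rfl⟩
      exact hx.2 (mem_biUnion (hfin.mem_toFinset.2 ⟨hx.1, rfl⟩) (hU x ⟨hx.1, rfl⟩).mem)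
    refine ⟨(G '' (S \ ⋃ p ∈ hfin.toFinset, U p))ᶜ ∩ ⋂ p ∈ hfin.toFinset, G '' U p,
      inter_mem (himg.isClosed.isOpen_compl.mem_nhds hy) ?_, ?_, ?_⟩
    · rw [biInter_finset_mem]
      intro p hp
      have hp' := hfin.mem_toFinset.1 hp
      have := (hU p hp').image_mem
      rwa [show G p = y from hp'.2] at this
    · intro x hx hxV
      by_contra hcon
      push Not at hcon
      refine hxV.1 ⟨x, ⟨hx, ?_⟩, rfl⟩
      simpa using hcon
    · intro p hp
      exact inter_subset_right.trans (biInter_subset_of_mem hp)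

section Euclidean

variable {E : Type*} [NormedAddCommGroup E] [NormedSpace ℝ E] [FiniteDimensional ℝ E]

theorem ContinuousAt.eventually_sign_eq {X : Type*} [TopologicalSpace X] {d : X → ℝ} {x : X}
    (hd : ContinuousAt d x) (hx : d x ≠ 0) :
    ∀ᶠ x' in 𝓝 x, SignType.sign (d x') = SignType.sign (d x) := by
  rcases lt_or_gt_of_ne hx with h | h
  · filter_upwards [hd.eventually_mem (gt_mem_nhds h)] with x' hx'
    rw [sign_neg h, sign_neg hx']
  · filter_upwards [hd.eventually_mem (lt_mem_nhds h)] with x' hx'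
    rw [sign_pos h, sign_pos hx']

/-- The inverse function theorem, stated as the existence of small sheets. -/
theorem ContDiffOn.exists_isSheet {G : E → E} {T : Set E} (hT : IsOpen T)
    (hG : ContDiffOn ℝ 1 G T) {x : E} (hx : x ∈ T) (hdet : (fderiv ℝ G x).det ≠ 0)
    {N : Set E} (hN : N ∈ 𝓝 x) :
    ∃ U ⊆ N, IsSheet G (fun x => (SignType.sign (fderiv ℝ G x).det : ℤ)) x U := by
  have hGx : ContDiffAt ℝ 1 G x := hG.contDiffAt (hT.mem_nhds hx)
  have hstrict := hGx.hasStrictFDerivAt one_ne_zero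
  set A : E ≃L[ℝ] E := (fderiv ℝ G x).toContinuousLinearEquivOfDetNeZero hdet with hA
  have hstrict' : HasStrictFDerivAt G (A : E →L[ℝ] E) x := by
    convert hstrict using 1
    ext v
    simp [hA]
  have hcont : ContinuousAt (fun x' => (fderiv ℝ G x').det) x :=
    ContinuousLinearMap.continuous_det.continuousAt.comp
      ((hG.continuousOn_fderiv_of_isOpen hT le_rfl).continuousAt (hT.mem_nhds hx))
  have hsign := hcont.eventually_sign_eq hdet
  set e := hstrict'.toOpenPartialHomeomorph G with he
  have hxe : x ∈ e.source := hstrict'.mem_toOpenPartialHomeomorph_source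
  obtain ⟨W, hW, hWo, hxW⟩ := mem_nhds_iff.1 (inter_mem hN hsign)
  refine ⟨e.source ∩ W, inter_subset_right.trans (hW.trans inter_subset_left),
    e.open_source.inter hWo, ⟨hxe, hxW⟩, e.injOn.mono inter_subset_left, ?_, ?_⟩
  · exact (e.isOpen_image_of_subset_source (e.open_source.inter hWo) inter_subset_left).mem_nhds
      ⟨x, ⟨hxe, hxW⟩, rfl⟩
  · intro x' hx'
    have := (hW hx'.2).2
    simp only [mem_ofPred_eq] at this
    simp only [this]

variable [MeasurableSpace E] [BorelSpace E] (μ : Measure E) [μ.IsAddHaarMeasure]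

/-! ### The degree of maps between Euclidean spaces -/

/-- There are functions `ρ`, supported close to the origin and of positive integral, that are the
Jacobian determinants of a map `R : E → E`. So `∫ ρ(G) det DG` is the integral of the Jacobian
determinant of `R ∘ G`. -/
theorem exists_weight_eq_det_fderiv [Nontrivial E] {δ : ℝ} (hδ : 0 < δ) :
    ∃ (ρ : E → ℝ) (R : E → E), Continuous ρ ∧ (∀ y, ρ y ≠ 0 → ‖y‖ < δ) ∧ 0 < ∫ y, ρ y ∂μ ∧
      ContDiff ℝ 1 R ∧ ∀ y, (fderiv ℝ R y).det = ρ y := by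
  obtain ⟨u, hu⟩ := exists_ne (0 : E)
  obtain ⟨ℓ, hℓ⟩ := SeparatingDual.exists_eq_one (R := ℝ) hu
  set κ : ℝ := δ / (1 + ‖u‖) with hκ
  have hu0 : 0 < 1 + ‖u‖ := by positivity
  have hκ0 : 0 < κ := div_pos hδ hu0
  let η : ContDiffBump (0 : ℝ) := ⟨κ / 2, κ, half_pos hκ0, half_lt_self hκ0⟩
  let θ : ContDiffBump (0 : E) := ⟨κ / 2, κ, half_pos hκ0, half_lt_self hκ0⟩
  have hηc : Continuous η := η.continuous
  let Θ : ℝ → ℝ := fun t => ∫ x in (0 : ℝ)..t, η x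
  have hΘ : ∀ t, HasDerivAt Θ (η t) t := fun t =>
    intervalIntegral.integral_hasDerivAt_right (hηc.intervalIntegrable _ _)
      (hηc.stronglyMeasurableAtFilter _ _) hηc.continuousAt
  have hΘc : ContDiff ℝ 1 Θ := by
    rw [contDiff_one_iff_deriv]
    refine ⟨fun t => (hΘ t).differentiableAt, ?_⟩
    rw [show deriv Θ = η from funext fun t => (hΘ t).deriv]
    exact hηc
  let p : E →L[ℝ] E := ContinuousLinearMap.id ℝ E - ℓ.smulRight u
  have hp : ∀ y, p y = y - ℓ y • u := fun y => rfl
  have hpu : p u = 0 := by rw [hp, hℓ, one_smul, sub_self]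
  have hθc : ContDiff ℝ 1 θ := θ.contDiff
  have hbound : ∀ y, η (ℓ y) * θ (p y) ≠ 0 → ‖y‖ < δ := by
    intro y hy
    have h1 : ℓ y ∈ Function.support η := left_ne_zero_of_mul hy
    have h2 : p y ∈ Function.support θ := right_ne_zero_of_mul hy
    rw [η.support_eq, mem_ball_zero_iff] at h1
    rw [θ.support_eq, mem_ball_zero_iff] at h2
    have : y = p y + ℓ y • u := by rw [hp]; abel
    calc ‖y‖ ≤ ‖p y‖ + ‖ℓ y • u‖ := by
            conv_lhs => rw [this]
            exact norm_add_le _ _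
      _ = ‖p y‖ + ‖ℓ y‖ * ‖u‖ := by rw [norm_smul]
      _ < κ + κ * ‖u‖ :=
          add_lt_add_of_lt_of_le h2 (mul_le_mul_of_nonneg_right h1.le (norm_nonneg u))
      _ = δ := by rw [hκ]; field_simp
  -- `R` keeps the component `p y` in the kernel of `ℓ` and replaces the coordinate `ℓ y` by
  -- `Θ (ℓ y) * θ (p y)`, so its Jacobian determinant is the derivative of the latter along `u`
  refine ⟨fun y => η (ℓ y) * θ (p y), fun y => y + (Θ (ℓ y) * θ (p y) - ℓ y) • u,
    ?_, ?_, ?_, ?_, ?_⟩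
  · exact (hηc.comp ℓ.continuous).mul (θ.continuous.comp p.continuous)
  · exact hbound
  · refine Continuous.integral_pos_of_hasCompactSupport_nonneg_nonzero (x := 0)
      ((hηc.comp ℓ.continuous).mul (θ.continuous.comp p.continuous)) ?_ ?_ ?_
    · refine HasCompactSupport.of_support_subset_isCompact (isCompact_closedBall (0 : E) δ) ?_
      exact fun y hy => mem_closedBall_zero_iff.2 (hbound y hy).le
    · exact fun y => mul_nonneg η.nonneg θ.nonneg
    · simp only [map_zero]
      rw [η.one_of_mem_closedBall (Metric.mem_closedBall_self η.rIn_pos.le),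
        θ.one_of_mem_closedBall (Metric.mem_closedBall_self θ.rIn_pos.le)]
      norm_num
  · exact contDiff_id.add ((((hΘc.comp ℓ.contDiff).mul (hθc.comp p.contDiff)).sub
      ℓ.contDiff).smul contDiff_const)
  · intro y
    have hθd : HasFDerivAt θ (fderiv ℝ θ (p y)) (p y) :=
      ((hθc.differentiable one_ne_zero) _).hasFDerivAt
    have h1 : HasFDerivAt (fun y => Θ (ℓ y)) (η (ℓ y) • ℓ) y :=
      (hΘ (ℓ y)).comp_hasFDerivAt y ℓ.hasFDerivAt
    have h2 : HasFDerivAt (fun y => θ (p y)) ((fderiv ℝ θ (p y)).comp p) y :=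
      hθd.comp y p.hasFDerivAt
    have h3 := (hasFDerivAt_id (𝕜 := ℝ) y).add (((h1.mul h2).sub ℓ.hasFDerivAt).smul_const u)
    rw [show (fun y => y + (Θ (ℓ y) * θ (p y) - ℓ y) • u) = (id + fun y =>
      (Θ (ℓ y) * θ (p y) - ℓ y) • u) from rfl]
    erw [h3.fderiv]
    set g : E →L[ℝ] ℝ := Θ (ℓ y) • (fderiv ℝ θ (p y)).comp p + θ (p y) • η (ℓ y) • ℓ - ℓ with hg
    have : (ContinuousLinearMap.det (ContinuousLinearMap.id ℝ E + g.smulRight u)) =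
        LinearMap.det (LinearMap.transvection (g : E →ₗ[ℝ] ℝ) u) := rfl
    erw [this, LinearMap.transvection.det]
    simp only [hg, ContinuousLinearMap.coe_coe, sub_apply,
      add_apply, smul_apply,
      ContinuousLinearMap.comp_apply, hpu, map_zero, hℓ, smul_eq_mul]
    ring

end Euclidean

section EuclideanDegree

theorem exists_contDiff_eq_one_nhds_closedBall {E : Type*} [NormedAddCommGroup E]
    [NormedSpace ℝ E] [FiniteDimensional ℝ E] {T : Set E} (hT : IsOpen T) {z : E} {r : ℝ}
    (hr : 0 < r) (hball : Metric.closedBall z r ⊆ T) :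
    ∃ ψ : E → ℝ, tsupport ψ ⊆ T ∧ HasCompactSupport ψ ∧ ContDiff ℝ 1 ψ ∧
      ∀ x ∈ Metric.closedBall z r, ∀ᶠ x' in 𝓝 x, ψ x' = 1 := by
  obtain ⟨δ, hδ, hδT⟩ := (isCompact_closedBall z r).exists_cthickening_subset_open hT hball
  rw [cthickening_closedBall hδ.le hr.le] at hδT
  let ψ : ContDiffBump z := ⟨r + δ / 2, r + δ, by positivity, by linarith⟩
  refine ⟨ψ, ?_, ψ.hasCompactSupport, ψ.contDiff, fun x hx => ?_⟩
  · rw [ψ.tsupport_eq]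
    exact (Metric.closedBall_subset_closedBall (by change r + δ ≤ δ + r; linarith)).trans hδT
  · have hx' : x ∈ Metric.ball z (r + δ / 2) :=
      Metric.closedBall_subset_ball (by linarith) hx
    filter_upwards [Metric.isOpen_ball.mem_nhds hx'] with x' hx'
    exact ψ.one_of_mem_closedBall (Metric.ball_subset_closedBall hx')

variable {E : Type*} [NormedAddCommGroup E] [NormedSpace ℝ E] [FiniteDimensional ℝ E]
  [MeasurableSpace E] [BorelSpace E] (μ : Measure E) [μ.IsAddHaarMeasure]

/-- The signed number of preimages of a regular value `y` in a ball, as an integral: the weight `ρ`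
is any continuous function supported close to the origin. -/
theorem integral_weight_mul_det_fderiv {G : E → E} {T : Set E} (hT : IsOpen T)
    (hG : ContDiffOn ℝ 1 G T) {z : E} {r : ℝ} (hball : Metric.closedBall z r ⊆ T) {y : E}
    (hsphere : y ∉ G '' Metric.sphere z r)
    (hreg : ∀ x ∈ Metric.ball z r, G x = y → (fderiv ℝ G x).det ≠ 0) :
    (Metric.ball z r ∩ G ⁻¹' {y}).Finite ∧
    ∃ δ > 0, ∀ ρ : E → ℝ, Continuous ρ → (∀ w, ρ w ≠ 0 → ‖w‖ < δ) →
      ∫ x in Metric.closedBall z r, ρ (G x - y) * (fderiv ℝ G x).det ∂μ =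
        ((∑ᶠ x ∈ Metric.ball z r ∩ G ⁻¹' {y}, (SignType.sign (fderiv ℝ G x).det : ℤ) : ℤ) : ℝ) *
          ∫ w, ρ w ∂μ := by
  have hGc : ContinuousOn G (Metric.closedBall z r) := hG.continuousOn.mono hball
  have hmem : ∀ x ∈ Metric.closedBall z r, G x = y → x ∈ Metric.ball z r := fun x hx hxy => by
    rw [← Metric.ball_union_sphere] at hx
    exact hx.resolve_right fun h => hsphere ⟨x, h, hxy⟩
  obtain ⟨P, U, hP, hU, hdisj, V, hV, hcov, hVU⟩ := exists_stack_of_sheets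
    (s := fun x => (SignType.sign (fderiv ℝ G x).det : ℤ)) (N := Metric.ball z r)
    (isCompact_closedBall z r) hGc (y := y)
    (fun x hx hxy => Metric.isOpen_ball.mem_nhds (hmem x hx hxy))
    (fun x hx hxy N hN => hG.exists_isSheet hT (hball hx) (hreg x (hmem x hx hxy) hxy) hN)
  have hPball : (P : Set E) = Metric.ball z r ∩ G ⁻¹' {y} := by
    rw [hP]
    ext x
    exact ⟨fun hx => ⟨hmem x hx.1 hx.2, hx.2⟩,
      fun hx => ⟨Metric.ball_subset_closedBall hx.1, hx.2⟩⟩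
  refine ⟨hPball ▸ P.finite_toSet, ?_⟩
  obtain ⟨δ, hδ, hδV⟩ := Metric.mem_nhds_iff.1 hV
  refine ⟨δ, hδ, fun ρ hρ hsupp => ?_⟩
  have hVmem : ∀ w, ρ (w - y) ≠ 0 → w ∈ V := fun w hw => hδV (by
    rw [Metric.mem_ball, dist_eq_norm]
    exact hsupp _ hw)
  have hUball : ∀ p ∈ P, U p ⊆ Metric.closedBall z r := fun p hp =>
    (hU p hp).1.trans Metric.ball_subset_closedBall
  have hcontdet : ContinuousOn (fun x => (fderiv ℝ G x).det) (Metric.closedBall z r) :=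
    ContinuousLinearMap.continuous_det.comp_continuousOn
      ((hG.continuousOn_fderiv_of_isOpen hT le_rfl).mono hball)
  have hint : IntegrableOn (fun x => ρ (G x - y) * (fderiv ℝ G x).det) (Metric.closedBall z r) μ :=
    ((hρ.comp_continuousOn (hGc.sub continuousOn_const)).mul hcontdet).integrableOn_compact
      (isCompact_closedBall z r)
  rw [setIntegral_eq_of_subset_of_forall_sdiff_eq_zero (s := ⋃ p ∈ P, U p)
    Metric.isClosed_closedBall.measurableSet (iUnion₂_subset hUball),
    integral_biUnion_finset P (fun p hp => (hU p hp).2.isOpen.measurableSet) hdisj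
      (fun p hp => hint.mono_set (hUball p hp)), ← hPball, finsum_mem_coe_finset]
  · rw [Int.cast_sum, Finset.sum_mul]
    refine Finset.sum_congr rfl fun p hp => ?_
    have hsheet := (hU p hp).2
    have hpos : ∀ x ∈ U p, ρ (G x - y) * (fderiv ℝ G x).det =
        ((SignType.sign (fderiv ℝ G p).det : ℤ) : ℝ) *
          (|(fderiv ℝ G x).det| • ρ (G x - y)) := fun x hx => by
      rw [← hsheet.index_eq x hx, smul_eq_mul]
      conv_lhs => rw [← sign_mul_abs (fderiv ℝ G x).det]
      push_cast
      ring
    rw [setIntegral_congr_fun hsheet.isOpen.measurableSet hpos, integral_const_mul,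
      ← integral_image_eq_integral_abs_det_fderiv_smul μ hsheet.isOpen.measurableSet
        (fun x hx => ((hG.differentiableOn one_ne_zero).differentiableAt
          (hT.mem_nhds (hball (hUball p hp hx)))).hasFDerivAt.hasFDerivWithinAt) hsheet.injOn
        (fun w => ρ (w - y)),
      setIntegral_eq_integral_of_forall_compl_eq_zero, integral_sub_right_eq_self]
    intro w hw
    by_contra hne
    exact hw (hVU p hp (hVmem w hne))
  · rintro x ⟨hx, hxU⟩
    have : ρ (G x - y) = 0 := by
      by_contra hne
      obtain ⟨p, hp, hxp⟩ := hcov x hx (hVmem _ hne)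
      exact hxU (mem_biUnion hp hxp)
    rw [this, zero_mul]

/-- Two maps that agree outside a ball have Jacobian determinants of equal integral over it. -/
theorem integral_det_fderiv_congr_of_eqOn_compl [Nontrivial E] {F₁ F₂ : E → E} {T : Set E}
    (hT : IsOpen T) (h₁ : ContDiffOn ℝ 1 F₁ T) (h₂ : ContDiffOn ℝ 1 F₂ T) {z : E} {r : ℝ}
    (hr : 0 < r) (hball : Metric.closedBall z r ⊆ T)
    (heq : ∀ x ∈ T, x ∉ Metric.closedBall z r → F₁ x = F₂ x) :
    ∫ x in Metric.closedBall z r, (fderiv ℝ F₁ x).det ∂μ =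
      ∫ x in Metric.closedBall z r, (fderiv ℝ F₂ x).det ∂μ := by
  obtain ⟨ψ, hψT, hψc, hψs, hψ1⟩ := exists_contDiff_eq_one_nhds_closedBall hT hr hball
  have hsmooth : ∀ F : E → E, ContDiffOn ℝ 1 F T → ContDiff ℝ 1 fun x => ψ x • F x := by
    intro F hF
    rw [contDiff_iff_contDiffAt]
    intro x
    by_cases hx : x ∈ tsupport ψ
    · exact hψs.contDiffAt.smul (hF.contDiffAt (hT.mem_nhds (hψT hx)))
    · have : (fun x => ψ x • F x) =ᶠ[𝓝 x] fun _ => 0 := by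
        filter_upwards [(isClosed_tsupport ψ).isOpen_compl.mem_nhds hx] with x' hx'
        rw [image_eq_zero_of_notMem_tsupport hx', zero_smul]
      exact contDiffAt_const.congr_of_eventuallyEq this
  have hzero : ∀ F : E → E, ContDiffOn ℝ 1 F T →
      ∫ x, (fderiv ℝ (fun x => ψ x • F x) x).det ∂μ = 0 := fun F hF =>
    integral_det_fderiv_eq_zero μ (hsmooth F hF) hψc.smul_right
  have hintg : ∀ F : E → E, ContDiffOn ℝ 1 F T →
      Integrable (fun x => (fderiv ℝ (fun x => ψ x • F x) x).det) μ := fun F hF => by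
    refine Continuous.integrable_of_hasCompactSupport
      (ContinuousLinearMap.continuous_det.comp ((hsmooth F hF).continuous_fderiv one_ne_zero)) ?_
    have hc : HasCompactSupport (fun x => ψ x • F x) := hψc.smul_right
    refine (hc.fderiv ℝ).comp_left (g := ContinuousLinearMap.det) ?_
    exact (LinearMap.det_zero (M := E)).trans (zero_pow Module.finrank_pos.ne')
  have hon : ∀ F : E → E, ∫ x in Metric.closedBall z r, (fderiv ℝ F x).det ∂μ =
      ∫ x in Metric.closedBall z r, (fderiv ℝ (fun x => ψ x • F x) x).det ∂μ := fun F => by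
    refine setIntegral_congr_fun Metric.isClosed_closedBall.measurableSet fun x hx => ?_
    have : (fun x => ψ x • F x) =ᶠ[𝓝 x] F := by
      filter_upwards [hψ1 x hx] with x' hx'
      rw [hx', one_smul]
    simp only [this.fderiv_eq]
  have hoff : ∀ x ∈ (Metric.closedBall z r)ᶜ, (fderiv ℝ (fun x => ψ x • F₁ x) x).det =
      (fderiv ℝ (fun x => ψ x • F₂ x) x).det := fun x hx => by
    have : (fun x => ψ x • F₁ x) =ᶠ[𝓝 x] fun x => ψ x • F₂ x := by
      filter_upwards [Metric.isClosed_closedBall.isOpen_compl.mem_nhds hx] with x' hx'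
      by_cases hx'T : x' ∈ T
      · rw [heq x' hx'T hx']
      · rw [image_eq_zero_of_notMem_tsupport fun h => hx'T (hψT h), zero_smul, zero_smul]
    simp only [this.fderiv_eq]
  have hmeas : MeasurableSet (Metric.closedBall z r) := Metric.isClosed_closedBall.measurableSet
  have e₁ := integral_add_compl hmeas (hintg F₁ h₁)
  have e₂ := integral_add_compl hmeas (hintg F₂ h₂)
  rw [hzero F₁ h₁] at e₁
  rw [hzero F₂ h₂, ← setIntegral_congr_fun hmeas.compl hoff] at e₂
  rw [hon F₁, hon F₂]
  linarith

/-- The local form of the invariance of the degree: two maps that agree outside a ball have the same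
signed number of preimages in this ball. -/
theorem finsum_sign_det_fderiv_congr_of_eqOn_compl [Nontrivial E] {G₁ G₂ : E → E} {T : Set E}
    (hT : IsOpen T) (h₁ : ContDiffOn ℝ 1 G₁ T) (h₂ : ContDiffOn ℝ 1 G₂ T) {z : E} {r : ℝ}
    (hr : 0 < r) (hball : Metric.closedBall z r ⊆ T)
    (heq : ∀ x ∈ T, x ∉ Metric.closedBall z r → G₁ x = G₂ x) {y : E}
    (hs₁ : y ∉ G₁ '' Metric.sphere z r) (hs₂ : y ∉ G₂ '' Metric.sphere z r)
    (hr₁ : ∀ x ∈ Metric.ball z r, G₁ x = y → (fderiv ℝ G₁ x).det ≠ 0)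
    (hr₂ : ∀ x ∈ Metric.ball z r, G₂ x = y → (fderiv ℝ G₂ x).det ≠ 0) :
    ∑ᶠ x ∈ Metric.ball z r ∩ G₁ ⁻¹' {y}, (SignType.sign (fderiv ℝ G₁ x).det : ℤ) =
      ∑ᶠ x ∈ Metric.ball z r ∩ G₂ ⁻¹' {y}, (SignType.sign (fderiv ℝ G₂ x).det : ℤ) := by
  borelize E
  let μ : Measure E := Measure.addHaar
  obtain ⟨-, δ₁, hδ₁, hi₁⟩ := integral_weight_mul_det_fderiv μ hT h₁ hball hs₁ hr₁
  obtain ⟨-, δ₂, hδ₂, hi₂⟩ := integral_weight_mul_det_fderiv μ hT h₂ hball hs₂ hr₂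
  obtain ⟨ρ, R, hρ, hsupp, hpos, hR, hdet⟩ := exists_weight_eq_det_fderiv μ (lt_min hδ₁ hδ₂)
  have e₁ := hi₁ ρ hρ fun w hw => (hsupp w hw).trans_le (min_le_left _ _)
  have e₂ := hi₂ ρ hρ fun w hw => (hsupp w hw).trans_le (min_le_right _ _)
  have hcomp : ∀ G : E → E, ContDiffOn ℝ 1 G T →
      ContDiffOn ℝ 1 (fun x => R (G x - y)) T := fun G hG =>
    hR.comp_contDiffOn (hG.sub contDiffOn_const)
  have hd : ∀ G : E → E, ContDiffOn ℝ 1 G T → ∀ x ∈ Metric.closedBall z r,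
      ρ (G x - y) * (fderiv ℝ G x).det = (fderiv ℝ (fun x => R (G x - y)) x).det := by
    intro G hG x hx
    have hGx : HasFDerivAt (fun x => G x - y) (fderiv ℝ G x) x :=
      ((hG.differentiableOn one_ne_zero).differentiableAt
        (hT.mem_nhds (hball hx))).hasFDerivAt.sub_const y
    have hRx : HasFDerivAt R (fderiv ℝ R (G x - y)) (G x - y) :=
      (hR.differentiable one_ne_zero _).hasFDerivAt
    have := (hRx.comp x hGx).fderiv
    rw [show (fun x => R (G x - y)) = R ∘ fun x => G x - y from rfl, this, ← hdet (G x - y)]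
    exact (LinearMap.det_comp _ _).symm
  have key := integral_det_fderiv_congr_of_eqOn_compl μ hT (hcomp G₁ h₁) (hcomp G₂ h₂) hr hball
    fun x hx hx' => by rw [heq x hx hx']
  have hmeas : MeasurableSet (Metric.closedBall z r) := Metric.isClosed_closedBall.measurableSet
  rw [← setIntegral_congr_fun hmeas (hd G₁ h₁), ← setIntegral_congr_fun hmeas (hd G₂ h₂), e₁, e₂]
    at key
  exact_mod_cast mul_right_cancel₀ hpos.ne' key

end EuclideanDegree

/-! ### Jacobians on oriented manifolds -/

/-- The determinant, in the basis `b` of `W`, of the image under `dG` of the positive frame of `X`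
at `x`. For `dim W = dim X` its sign is the local degree of `G` at `x`. -/
def frameJacobian {E H : Type*} [NormedAddCommGroup E] [NormedSpace ℝ E] [TopologicalSpace H]
    {I : ModelWithCorners ℝ E H} {X : Type*} [TopologicalSpace X] [ChartedSpace H X]
    [IsManifold I 1 X] {d : ℕ} (o : ManifoldOrientation I X d)
    {W : Type*} [NormedAddCommGroup W] [NormedSpace ℝ W] (b : Module.Basis (Fin d) ℝ W)
    (G : X → W) (x : X) : ℝ :=
  b.det fun i => (mfderiv I 𝓘(ℝ, W) G x (o.frame x i) : W)

/-- The signed number of preimages of `y` under `G`. -/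
def signedCount {E H : Type*} [NormedAddCommGroup E] [NormedSpace ℝ E] [TopologicalSpace H]
    {I : ModelWithCorners ℝ E H} {X : Type*} [TopologicalSpace X] [ChartedSpace H X]
    [IsManifold I 1 X] {d : ℕ} (o : ManifoldOrientation I X d)
    {W : Type*} [NormedAddCommGroup W] [NormedSpace ℝ W] (b : Module.Basis (Fin d) ℝ W)
    (G : X → W) (y : W) : ℤ :=
  ∑ᶠ x ∈ G ⁻¹' {y}, (SignType.sign (frameJacobian o b G x) : ℤ)

theorem Module.Basis.det_eq_det_mul_det {ι R E : Type*} [Fintype ι] [DecidableEq ι] [CommRing R]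
    [AddCommGroup E] [Module R E] (b e : Module.Basis ι R E) (w : ι → E) :
    b.det w = b.det e * e.det w := by
  conv_lhs => rw [AlternatingMap.eq_smul_basis_det e b.det]
  rfl

section Charts

variable {E H : Type*} [NormedAddCommGroup E] [NormedSpace ℝ E]
  [TopologicalSpace H] {I : ModelWithCorners ℝ E H} {X : Type*} [TopologicalSpace X]
  [ChartedSpace H X] [IsManifold I 1 X] {d : ℕ} (o : ManifoldOrientation I X d)
  (b : Module.Basis (Fin d) ℝ E)

/-- The determinant of the positive frame at `x`, read in the chart at `x₀`. -/
def chartFrameDet (x₀ x : X) : ℝ :=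
  b.det fun i => tangentCoordChange I x x₀ x (o.frame x i)

theorem ContMDiff.contDiffOn_comp_extChartAt_symm {G : X → E} (hG : ContMDiff I 𝓘(ℝ, E) 1 G)
    (x₀ : X) : ContDiffOn ℝ 1 (G ∘ (extChartAt I x₀).symm) (extChartAt I x₀).target :=
  contMDiffOn_iff_contDiffOn.1 (hG.comp_contMDiffOn (contMDiffOn_extChartAt_symm x₀))

/-- By the coherence of the frames, their sign in a chart is locally constant. -/
theorem eventually_sign_chartFrameDet_eq {x₀ x : X} (hx : x ∈ (extChartAt I x₀).source) :
    chartFrameDet o b x₀ x ≠ 0 ∧ ∀ᶠ x' in 𝓝 x,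
      SignType.sign (chartFrameDet o b x₀ x') = SignType.sign (chartFrameDet o b x₀ x) := by
  have hxx := mem_extChartAt_source (I := I) x
  have hunit : IsUnit (b.det (o.frame x)) := b.isUnit_det (o.frame x)
  set D : X → ℝ := fun x' => (tangentCoordChange I x x₀ x').det * b.det (o.frame x) with hD
  have hDc : ContinuousAt D x := by
    have : FiniteDimensional ℝ E := Module.Basis.finiteDimensional_of_finite b
    refine ContinuousAt.mul (ContinuousLinearMap.continuous_det.continuousAt.comp ?_)
      continuousAt_const
    exact (continuousOn_tangentCoordChange x x₀).continuousAt
      (((isOpen_extChartAt_source x).inter (isOpen_extChartAt_source x₀)).mem_nhds ⟨hxx, hx⟩)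
  have hDx : D x ≠ 0 := by
    refine mul_ne_zero ?_ hunit.ne_zero
    have hcomp : (tangentCoordChange I x₀ x x).comp (tangentCoordChange I x x₀ x) =
        ContinuousLinearMap.id ℝ E := by
      ext v
      exact (tangentCoordChange_comp ⟨⟨hxx, hx⟩, hxx⟩).trans (tangentCoordChange_self hxx)
    have hdet := congrArg ContinuousLinearMap.det hcomp
    have h1 : (ContinuousLinearMap.id ℝ E).det = 1 := LinearMap.det_id
    rw [h1] at hdet
    intro h0
    have : ((tangentCoordChange I x₀ x x).comp (tangentCoordChange I x x₀ x)).det =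
      (tangentCoordChange I x₀ x x).det * (tangentCoordChange I x x₀ x).det :=
        LinearMap.det_comp _ _
    rw [this, h0, mul_zero] at hdet
    exact zero_ne_one hdet
  have hev : ∀ᶠ x' in 𝓝 x,
      SignType.sign (chartFrameDet o b x₀ x') = SignType.sign (D x') := by
    filter_upwards [o.coherent x, (isOpen_extChartAt_source x₀).mem_nhds hx,
      (isOpen_extChartAt_source (I := I) x).mem_nhds hxx] with x' hpos hx₀ hx'
    have hxx' := mem_extChartAt_source (I := I) x'
    have : chartFrameDet o b x₀ x' = D x' *
        (o.frame x).det (fun i => tangentCoordChange I x' x x' (o.frame x' i)) := by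
      unfold chartFrameDet
      have h1 : (fun i => tangentCoordChange I x' x₀ x' (o.frame x' i)) =
          ((tangentCoordChange I x x₀ x' : E →L[ℝ] E) : E →ₗ[ℝ] E) ∘
            fun i => tangentCoordChange I x' x x' (o.frame x' i) := by
        funext i
        exact (tangentCoordChange_comp ⟨⟨hxx', hx'⟩, hx₀⟩).symm
      rw [h1, Module.Basis.det_comp]
      exact (congrArg ((tangentCoordChange I x x₀ x').det * ·)
        (Module.Basis.det_eq_det_mul_det b (o.frame x)
          (fun i => tangentCoordChange I x' x x' (o.frame x' i)))).trans (mul_assoc _ _ _).symm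
    rw [this, sign_mul, sign_pos hpos, mul_one]
  have hx_eq := hev.self_of_nhds
  refine ⟨fun h0 => ?_, ?_⟩
  · rw [h0, sign_zero] at hx_eq
    exact hDx (sign_eq_zero_iff.1 hx_eq.symm)
  · filter_upwards [hev, hDc.eventually_sign_eq hDx] with x' h1 h2
    rw [h1, h2, hx_eq]

/-- The sign of the frame in a chart is constant on connected subsets of the chart. This turns
signed counts on a coordinate ball into signed counts on a ball of the model space. -/
theorem sign_chartFrameDet_eq_of_isPreconnected {x₀ : X} {s : Set X} (hs : IsPreconnected s)
    (hsub : s ⊆ (extChartAt I x₀).source) {x x' : X} (hx : x ∈ s) (hx' : x' ∈ s) :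
    (SignType.sign (chartFrameDet o b x₀ x) : ℤ) = SignType.sign (chartFrameDet o b x₀ x') := by
  refine hs.constant (f := fun x => (SignType.sign (chartFrameDet o b x₀ x) : ℤ)) ?_ hx hx'
  intro z hz
  refine ContinuousAt.continuousWithinAt ?_
  refine (continuousAt_const (y := (SignType.sign (chartFrameDet o b x₀ z) : ℤ))).congr ?_
  filter_upwards [(eventually_sign_chartFrameDet_eq o b (hsub hz)).2] with z' hz'
  rw [hz']

variable [I.Boundaryless]

theorem mfderiv_eq_fderiv_comp_tangentCoordChange {W : Type*} [NormedAddCommGroup W]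
    [NormedSpace ℝ W] {G : X → W} (hG : ContMDiff I 𝓘(ℝ, W) 1 G) (x₀ : X)
    {x : X} (hx : x ∈ (extChartAt I x₀).source) :
    (mfderiv I 𝓘(ℝ, W) G x : E →L[ℝ] W) =
      (fderiv ℝ (G ∘ (extChartAt I x₀).symm) (extChartAt I x₀ x)).comp
        (tangentCoordChange I x x₀ x) := by
  have hGx : MDifferentiableAt I 𝓘(ℝ, W) G x := (hG.mdifferentiable one_ne_zero) x
  have hcoord := hasFDerivWithinAt_tangentCoordChange (I := I) (x := x) (y := x₀) (z := x)
    ⟨mem_extChartAt_source x, hx⟩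
  have htarget : extChartAt I x₀ x ∈ (extChartAt I x₀).target := (extChartAt I x₀).map_source hx
  have hCD : ContDiffOn ℝ 1 (G ∘ (extChartAt I x₀).symm) (extChartAt I x₀).target :=
    contMDiffOn_iff_contDiffOn.1 (hG.comp_contMDiffOn (contMDiffOn_extChartAt_symm x₀))
  have hD : HasFDerivAt (G ∘ (extChartAt I x₀).symm)
      (fderiv ℝ (G ∘ (extChartAt I x₀).symm) (extChartAt I x₀ x))
      ((extChartAt I x₀ ∘ (extChartAt I x).symm) (extChartAt I x x)) := by
    have := (hCD.differentiableOn one_ne_zero).differentiableAt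
      ((isOpen_extChartAt_target x₀).mem_nhds htarget)
    simpa [Function.comp_apply, extChartAt_to_inv] using this.hasFDerivAt
  rw [I.range_eq_univ, hasFDerivWithinAt_univ] at hcoord
  have hcomp := hD.comp _ hcoord
  refine HasMFDerivAt.mfderiv ⟨hGx.continuousAt, ?_⟩
  refine HasFDerivAt.hasFDerivWithinAt (hcomp.congr_of_eventuallyEq ?_)
  have hnear : ∀ᶠ v in 𝓝 (extChartAt I x x), 
      (extChartAt I x).symm v ∈ (extChartAt I x₀).source := by
    refine (continuousAt_extChartAt_symm x).eventually_mem ?_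
    rw [extChartAt_to_inv]
    exact (isOpen_extChartAt_source x₀).mem_nhds hx
  filter_upwards [hnear] with v hv
  simp only [writtenInExtChartAt, extChartAt_model_space_eq_id, PartialEquiv.refl_coe,
    Function.comp_apply, id_eq]
  rw [(extChartAt I x₀).left_inv hv]

theorem frameJacobian_eq_det_mul_chartFrameDet {G : X → E} (hG : ContMDiff I 𝓘(ℝ, E) 1 G) (x₀ : X)
    {x : X} (hx : x ∈ (extChartAt I x₀).source) :
    frameJacobian o b G x =
      (fderiv ℝ (G ∘ (extChartAt I x₀).symm) (extChartAt I x₀ x)).det * chartFrameDet o b x₀ x := by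
  unfold frameJacobian chartFrameDet ContinuousLinearMap.det
  rw [← Module.Basis.det_comp]
  congr 1
  funext i
  exact congrArg (fun A : E →L[ℝ] E => A (o.frame x i))
    (mfderiv_eq_fderiv_comp_tangentCoordChange hG x₀ hx)

theorem sign_frameJacobian_eq {G : X → E} (hG : ContMDiff I 𝓘(ℝ, E) 1 G) (x₀ : X)
    {x : X} (hx : x ∈ (extChartAt I x₀).source) :
    (SignType.sign (frameJacobian o b G x) : ℤ) =
      SignType.sign (fderiv ℝ (G ∘ (extChartAt I x₀).symm) (extChartAt I x₀ x)).det *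
        SignType.sign (chartFrameDet o b x₀ x) := by
  rw [frameJacobian_eq_det_mul_chartFrameDet o b hG x₀ hx, sign_mul, SignType.coe_mul]

theorem frameJacobian_ne_zero_iff {G : X → E} (hG : ContMDiff I 𝓘(ℝ, E) 1 G) (x₀ : X)
    {x : X} (hx : x ∈ (extChartAt I x₀).source) :
    frameJacobian o b G x ≠ 0 ↔
      (fderiv ℝ (G ∘ (extChartAt I x₀).symm) (extChartAt I x₀ x)).det ≠ 0 := by
  rw [frameJacobian_eq_det_mul_chartFrameDet o b hG x₀ hx]
  exact mul_ne_zero_iff_right (eventually_sign_chartFrameDet_eq o b hx).1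

variable [FiniteDimensional ℝ E]

/-- The sheets of the chart expression, carried to the manifold; shrinking them keeps the sign of
the frame in the chart constant. -/
theorem ContMDiff.exists_isSheet {G : X → E} (hG : ContMDiff I 𝓘(ℝ, E) 1 G) {x : X}
    (hx : frameJacobian o b G x ≠ 0) {N : Set X} (hN : N ∈ 𝓝 x) :
    ∃ U ⊆ N, IsSheet G (fun x => (SignType.sign (frameJacobian o b G x) : ℤ)) x U := by
  have hxx := mem_extChartAt_source (I := I) x
  have htarget := (extChartAt I x).map_source hxx
  obtain ⟨N', hN'sub, hN'o, hxN'⟩ := mem_nhds_iff.1 (inter_mem (inter_mem hN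
    (eventually_sign_chartFrameDet_eq o b hxx).2)
    ((isOpen_extChartAt_source (I := I) x).mem_nhds hxx))
  have hpre : (extChartAt I x).symm ⁻¹' N' ∩ (extChartAt I x).target ∈ 𝓝 (extChartAt I x x) := by
    refine inter_mem ((continuousAt_extChartAt_symm x).preimage_mem_nhds ?_)
      ((isOpen_extChartAt_target x).mem_nhds htarget)
    rw [extChartAt_to_inv]
    exact hN'o.mem_nhds hxN'
  obtain ⟨V, hVsub, hV⟩ := (hG.contDiffOn_comp_extChartAt_symm x).exists_isSheet
    (isOpen_extChartAt_target x) htarget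
    ((frameJacobian_ne_zero_iff o b hG x hxx).1 hx) hpre
  have hGeq : ∀ x' ∈ (extChartAt I x).source,
      (G ∘ (extChartAt I x).symm) (extChartAt I x x') = G x' := fun x' hx' => by
    rw [Function.comp_apply, (extChartAt I x).left_inv hx']
  have hsubN' : (extChartAt I x).source ∩ extChartAt I x ⁻¹' V ⊆ N' := by
    rintro x' ⟨hx', hV'⟩
    have := (hVsub hV').1
    rwa [mem_preimage, (extChartAt I x).left_inv hx'] at this
  refine ⟨(extChartAt I x).source ∩ extChartAt I x ⁻¹' V, fun x' hx' => (hN'sub (hsubN' hx')).1.1,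
    ?_, ⟨hxx, hV.mem⟩, ?_, ?_, ?_⟩
  · exact (continuousOn_extChartAt x).isOpen_inter_preimage (isOpen_extChartAt_source x) hV.isOpen
  · intro x₁ h₁ x₂ h₂ h
    refine (extChartAt I x).injOn h₁.1 h₂.1 (hV.injOn h₁.2 h₂.2 ?_)
    rw [hGeq _ h₁.1, hGeq _ h₂.1, h]
  · have := hV.image_mem
    rw [hGeq x hxx] at this
    filter_upwards [this]
    rintro _ ⟨v, hv, rfl⟩
    have hvt := (hVsub hv).2
    refine ⟨(extChartAt I x).symm v, ⟨(extChartAt I x).map_target hvt, ?_⟩, rfl⟩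
    rwa [mem_preimage, (extChartAt I x).right_inv hvt]
  · intro x' hx'
    have h1 := hV.index_eq _ hx'.2
    have h2 := (hN'sub (hsubN' hx')).1.2
    simp only [mem_ofPred_eq] at h2
    rw [sign_frameJacobian_eq o b hG x hx'.1, sign_frameJacobian_eq o b hG x hxx, h2]
    congr 1

/-- Sard's theorem for a compact set of the source. -/
theorem measure_criticalValues_eq_zero [MeasurableSpace E] [BorelSpace E] (μ : Measure E)
    [μ.IsAddHaarMeasure] {G : X → E} (hG : ContMDiff I 𝓘(ℝ, E) 1 G) {C : Set X}
    (hC : IsCompact C) : μ (G '' (C ∩ {x | frameJacobian o b G x = 0})) = 0 := by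
  obtain ⟨t, -, ht⟩ := hC.elim_nhds_subcover (fun x => (extChartAt I x).source)
    fun x _ => (isOpen_extChartAt_source (I := I) x).mem_nhds (mem_extChartAt_source x)
  have hsub : G '' (C ∩ {x | frameJacobian o b G x = 0}) ⊆ ⋃ x₀ ∈ t,
      (G ∘ (extChartAt I x₀).symm) '' ((extChartAt I x₀).target ∩
        {v | (fderiv ℝ (G ∘ (extChartAt I x₀).symm) v).det = 0}) := by
    rintro _ ⟨x, ⟨hxC, hx⟩, rfl⟩
    obtain ⟨x₀, hx₀, hxs⟩ := mem_iUnion₂.1 (ht hxC)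
    refine mem_biUnion hx₀ ⟨extChartAt I x₀ x, ⟨(extChartAt I x₀).map_source hxs, ?_⟩, ?_⟩
    · by_contra hne
      exact (frameJacobian_ne_zero_iff o b hG x₀ hxs).2 hne hx
    · rw [Function.comp_apply, (extChartAt I x₀).left_inv hxs]
  refine measure_mono_null hsub ((measure_biUnion_null_iff t.countable_toSet).2 fun x₀ _ => ?_)
  refine addHaar_image_eq_zero_of_det_fderivWithin_eq_zero μ
    (f' := fderiv ℝ (G ∘ (extChartAt I x₀).symm)) (fun v hv => ?_) fun v hv => hv.2
  exact (((hG.contDiffOn_comp_extChartAt_symm x₀).differentiableOn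
    one_ne_zero).differentiableAt ((isOpen_extChartAt_target x₀).mem_nhds
      hv.1)).hasFDerivAt.hasFDerivWithinAt

variable [T2Space X]

theorem finite_preimage_of_isCompact {G : X → E} (hG : ContMDiff I 𝓘(ℝ, E) 1 G) {C : Set X}
    (hC : IsCompact C) {y : E} (hy : G ⁻¹' {y} ⊆ C)
    (hreg : ∀ x, G x = y → frameJacobian o b G x ≠ 0) : (G ⁻¹' {y}).Finite := by
  obtain ⟨P, -, hP, -⟩ := exists_stack_of_sheets (N := univ) hC hG.continuous.continuousOn
    (s := fun x => (SignType.sign (frameJacobian o b G x) : ℤ)) (y := y)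
    (fun _ _ _ => univ_mem) (fun x _ hxy N hN => hG.exists_isSheet o b (hreg x hxy) hN)
  rw [inter_eq_right.2 hy] at hP
  exact hP ▸ P.finite_toSet

/-- The signed number of preimages is constant near a regular value over which `G` is proper. -/
theorem eventually_signedCount_eq {G : X → E} (hG : ContMDiff I 𝓘(ℝ, E) 1 G) {K : Set E} {y : E}
    (hK : K ∈ 𝓝 y) (hGK : IsCompact (G ⁻¹' K))
    (hreg : ∀ x, G x = y → frameJacobian o b G x ≠ 0) :
    ∀ᶠ y' in 𝓝 y, signedCount o b G y' = signedCount o b G y := by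
  obtain ⟨P, U, hP, hU, hdisj, V, hV, hcov, hVU⟩ := exists_stack_of_sheets (N := univ) hGK
    hG.continuous.continuousOn (s := fun x => (SignType.sign (frameJacobian o b G x) : ℤ)) (y := y)
    (fun _ _ _ => univ_mem) (fun x _ hxy N hN => hG.exists_isSheet o b (hreg x hxy) hN)
  rw [inter_eq_right.2 (preimage_mono (singleton_subset_iff.2 (mem_of_mem_nhds hK)))] at hP
  filter_upwards [inter_mem hK hV] with y' hy'
  unfold signedCount
  rw [← hP]
  choose! e heU heG using fun p (hp : p ∈ P) => hVU p hp hy'.2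
  refine (finsum_mem_eq_of_bijOn e ⟨fun p hp => heG p hp, ?_, ?_⟩ fun p hp => ?_).symm
  · intro p hp q hq hpq
    by_contra hne
    exact (disjoint_left.1 (hdisj hp hq hne)) (heU p hp) (hpq ▸ heU q hq)
  · intro x hx
    have hx' : G x = y' := hx
    obtain ⟨p, hp, hxp⟩ :=
      hcov x (by rw [mem_preimage, hx']; exact hy'.1) (by rw [hx']; exact hy'.2)
    exact ⟨p, hp, (hU p hp).2.injOn (heU p hp) hxp ((heG p hp).trans hx'.symm)⟩
  · exact ((hU p hp).2.index_eq _ (heU p hp)).symm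

end Charts

/-! ### Invariance of the signed number of preimages -/

section Invariance

variable {E H : Type*} [NormedAddCommGroup E] [NormedSpace ℝ E] [TopologicalSpace H]
  {I : ModelWithCorners ℝ E H} [I.Boundaryless] {X : Type*} [TopologicalSpace X] [ChartedSpace H X]

section

variable [IsManifold I 1 X] {d : ℕ} (o : ManifoldOrientation I X d)
  (b : Module.Basis (Fin d) ℝ E)

/-- In a coordinate ball the signed number of preimages is that of the chart expression, up to the
sign of the chart with respect to the orientation. -/
theorem finsum_sign_frameJacobian_inter_ball {G : X → E} (hG : ContMDiff I 𝓘(ℝ, E) 1 G) {c : X}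
    {r : ℝ} (hball : Metric.ball (extChartAt I c c) r ⊆ (extChartAt I c).target) (y : E) :
    ∑ᶠ x ∈ G ⁻¹' {y} ∩ (extChartAt I c).symm '' Metric.ball (extChartAt I c c) r,
        (SignType.sign (frameJacobian o b G x) : ℤ) =
      (∑ᶠ v ∈ Metric.ball (extChartAt I c c) r ∩ (G ∘ (extChartAt I c).symm) ⁻¹' {y},
        (SignType.sign (fderiv ℝ (G ∘ (extChartAt I c).symm) v).det : ℤ)) *
        SignType.sign (chartFrameDet o b c c) := by
  rw [finsum_mem_mul]
  symm
  refine finsum_mem_eq_of_bijOn (extChartAt I c).symm ⟨?_, ?_, ?_⟩ ?_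
  · rintro v ⟨hv, hvy⟩
    exact ⟨hvy, v, hv, rfl⟩
  · exact (extChartAt I c).symm.injOn.mono fun v hv => hball hv.1
  · rintro _ ⟨hxy, v, hv, rfl⟩
    exact ⟨v, ⟨hv, hxy⟩, rfl⟩
  · rintro v ⟨hv, -⟩
    have hpre : IsPreconnected ((extChartAt I c).symm '' Metric.ball (extChartAt I c c) r) :=
      (convex_ball _ _).isPreconnected.image _ ((continuousOn_extChartAt_symm c).mono hball)
    have hsub : (extChartAt I c).symm '' Metric.ball (extChartAt I c c) r ⊆
        (extChartAt I c).source := by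
      rintro _ ⟨w, hw, rfl⟩
      exact (extChartAt I c).map_target (hball hw)
    have hr : 0 < r := (dist_nonneg).trans_lt (Metric.mem_ball.1 hv)
    have hc : c ∈ (extChartAt I c).symm '' Metric.ball (extChartAt I c c) r :=
      ⟨extChartAt I c c, Metric.mem_ball_self hr, extChartAt_to_inv c⟩
    have hx : (extChartAt I c).symm v ∈ (extChartAt I c).symm '' Metric.ball (extChartAt I c c) r :=
      ⟨v, hv, rfl⟩
    rw [sign_frameJacobian_eq o b hG c (hsub hx),
      sign_chartFrameDet_eq_of_isPreconnected o b hpre hsub hc hx,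
      (extChartAt I c).right_inv (hball hv)]

variable [FiniteDimensional ℝ E]

/-- Regular values are dense in the part of the target over which `G` is proper. This holds for
countably many maps simultaneously. -/
theorem exists_regular_value {ι : Type*} [Countable ι] {G : ι → X → E}
    (hG : ∀ i, ContMDiff I 𝓘(ℝ, E) 1 (G i)) {K N : Set E} {y : E} (hK : K ∈ 𝓝 y)
    (hGK : ∀ i, IsCompact (G i ⁻¹' K)) (hN : N ∈ 𝓝 y) :
    ∃ y' ∈ N, ∀ i x, G i x = y' → frameJacobian o b (G i) x ≠ 0 := by
  borelize E
  let μ : Measure E := Measure.addHaar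
  have hae : ∀ᵐ y' ∂μ, ∀ i, y' ∉ G i '' (G i ⁻¹' K ∩ {x | frameJacobian o b (G i) x = 0}) :=
    ae_all_iff.2 fun i =>
      measure_eq_zero_iff_ae_notMem.1 (measure_criticalValues_eq_zero o b μ (hG i) (hGK i))
  obtain ⟨y', hy', hyK⟩ := (Measure.dense_of_ae hae).inter_nhds_nonempty (inter_mem hN hK)
  exact ⟨y', hyK.1, fun i x hx h0 => hy' i ⟨x, ⟨by rw [mem_preimage, hx]; exact hyK.2, h0⟩, hx⟩⟩

variable [T2Space X]

/-- Changing a map inside a coordinate ball does not change the signed number of preimages of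
almost all points. -/
theorem ae_signedCount_eq_of_eqOn_compl [Nontrivial E] [MeasurableSpace E] [BorelSpace E]
    (μ : Measure E) [μ.IsAddHaarMeasure] {G₁ G₂ : X → E} (h₁ : ContMDiff I 𝓘(ℝ, E) 1 G₁)
    (h₂ : ContMDiff I 𝓘(ℝ, E) 1 G₂) {c : X} {r : ℝ} (hr : 0 < r)
    (hball : Metric.closedBall (extChartAt I c c) r ⊆ (extChartAt I c).target)
    (heq : ∀ x ∉ (extChartAt I c).symm '' Metric.closedBall (extChartAt I c c) r, G₁ x = G₂ x)
    {C : Set X} (hC : IsCompact C) {B : Set E} (hB₁ : ∀ y ∈ B, G₁ ⁻¹' {y} ⊆ C)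
    (hB₂ : ∀ y ∈ B, G₂ ⁻¹' {y} ⊆ C) :
    ∀ᵐ y ∂μ, y ∈ B → signedCount o b G₁ y = signedCount o b G₂ y := by
  set φ := extChartAt I c with hφ
  set S : Set X := φ.symm '' Metric.closedBall (φ c) r with hS
  set D : Set X := φ.symm '' Metric.ball (φ c) r with hD
  have hTo : IsOpen φ.target := isOpen_extChartAt_target c
  have hball' : Metric.ball (φ c) r ⊆ φ.target := Metric.ball_subset_closedBall.trans hball
  have hSclosed : IsClosed S :=
    ((isCompact_closedBall _ _).image_of_continuousOn
      ((continuousOn_extChartAt_symm c).mono hball)).isClosed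
  have hsph : ∀ G : X → E, ContMDiff I 𝓘(ℝ, E) 1 G →
      ∀ᵐ y ∂μ, y ∉ (G ∘ φ.symm) '' Metric.sphere (φ c) r := fun G hG => by
    refine (measure_eq_zero_iff_ae_notMem).1 ?_
    refine addHaar_image_eq_zero_of_differentiableOn_of_addHaar_eq_zero μ ?_
      (Measure.addHaar_sphere μ _ _)
    exact ((hG.contDiffOn_comp_extChartAt_symm c).differentiableOn one_ne_zero).mono
      (Metric.sphere_subset_closedBall.trans hball)
  have hcrit : ∀ G : X → E, ContMDiff I 𝓘(ℝ, E) 1 G →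
      ∀ᵐ y ∂μ, y ∉ G '' (C ∩ {x | frameJacobian o b G x = 0}) := fun G hG =>
    measure_eq_zero_iff_ae_notMem.1 (measure_criticalValues_eq_zero o b μ hG hC)
  filter_upwards [hsph G₁ h₁, hsph G₂ h₂, hcrit G₁ h₁, hcrit G₂ h₂] with y s₁ s₂ c₁ c₂ hy
  have r₁ : ∀ x, G₁ x = y → frameJacobian o b G₁ x ≠ 0 := fun x hx h0 =>
    c₁ ⟨x, ⟨hB₁ y hy hx, h0⟩, hx⟩
  have r₂ : ∀ x, G₂ x = y → frameJacobian o b G₂ x ≠ 0 := fun x hx h0 =>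
    c₂ ⟨x, ⟨hB₂ y hy hx, h0⟩, hx⟩
  have hDmem : ∀ G : X → E, y ∉ (G ∘ φ.symm) '' Metric.sphere (φ c) r →
      ∀ x, G x = y → x ∉ D → x ∉ S := by
    rintro G hG x hx hxD ⟨v, hv, rfl⟩
    rw [← Metric.ball_union_sphere] at hv
    rcases hv with hv | hv
    · exact hxD ⟨v, hv, rfl⟩
    · exact hG ⟨v, hv, hx⟩
  have hfin₁ := finite_preimage_of_isCompact o b h₁ hC (hB₁ y hy) r₁
  have hfin₂ := finite_preimage_of_isCompact o b h₂ hC (hB₂ y hy) r₂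
  have hregchart : ∀ G : X → E, ContMDiff I 𝓘(ℝ, E) 1 G →
      (∀ x, G x = y → frameJacobian o b G x ≠ 0) →
      ∀ v ∈ Metric.ball (φ c) r, (G ∘ φ.symm) v = y → (fderiv ℝ (G ∘ φ.symm) v).det ≠ 0 := by
    intro G hG hreg v hv hvy
    have := (frameJacobian_ne_zero_iff o b hG c (φ.map_target (hball' hv))).1 (hreg _ hvy)
    rwa [φ.right_inv (hball' hv)] at this
  unfold signedCount
  rw [← finsum_mem_inter_add_sdiff D hfin₁, ← finsum_mem_inter_add_sdiff D hfin₂,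
    finsum_sign_frameJacobian_inter_ball o b h₁ hball',
    finsum_sign_frameJacobian_inter_ball o b h₂ hball']
  congr 1
  · congr 1
    refine finsum_sign_det_fderiv_congr_of_eqOn_compl hTo
      (h₁.contDiffOn_comp_extChartAt_symm c) (h₂.contDiffOn_comp_extChartAt_symm c) hr hball ?_
      s₁ s₂ (hregchart G₁ h₁ r₁) (hregchart G₂ h₂ r₂)
    intro v hv hvb
    refine heq _ ?_
    rintro ⟨w, hw, hwv⟩
    exact hvb (φ.symm.injOn (hball hw) hv hwv ▸ hw)
  · have hset : G₁ ⁻¹' {y} \ D = G₂ ⁻¹' {y} \ D := by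
      ext x
      constructor
      · rintro ⟨hx, hxD⟩
        exact ⟨(heq x (hDmem G₁ s₁ x hx hxD)).symm.trans hx, hxD⟩
      · rintro ⟨hx, hxD⟩
        exact ⟨(heq x (hDmem G₂ s₂ x hx hxD)).trans hx, hxD⟩
    rw [hset]
    refine finsum_mem_congr rfl ?_
    rintro x ⟨hx, hxD⟩
    have hev : G₁ =ᶠ[𝓝 x] G₂ := by
      filter_upwards [hSclosed.isOpen_compl.mem_nhds (hDmem G₂ s₂ x hx hxD)] with x' hx'
      exact heq x' hx'
    have : frameJacobian o b G₁ x = frameJacobian o b G₂ x := by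
      unfold frameJacobian
      rw [hev.mfderiv_eq]
      rfl
    rw [this]

end

variable [FiniteDimensional ℝ E] [T2Space X] [IsManifold I ∞ X] {d : ℕ}
  (o : ManifoldOrientation I X d) (b : Module.Basis (Fin d) ℝ E)

/-- A map may be translated by `a` over a compact set, one bump function at a time, without changing
the signed number of preimages of almost all points. -/
theorem ae_signedCount_eq_sub_smul [Nontrivial E] [MeasurableSpace E] [BorelSpace E]
    (μ : Measure E) [μ.IsAddHaarMeasure] {G : X → E} (hG : ContMDiff I 𝓘(ℝ, E) 1 G) {C : Set X}
    (hC : IsCompact C) (a : E) {B : Set E}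
    (hB : ∀ y ∈ B, ∀ t ∈ Icc (0 : ℝ) 1, G ⁻¹' {y + t • a} ⊆ C)
    (l : List (Σ c : X, SmoothBumpFunction I c)) :
    ∃ τ : X → ℝ, ContMDiff I 𝓘(ℝ, ℝ) ∞ τ ∧ (∀ x, τ x ∈ Icc (0 : ℝ) 1) ∧
      (∀ χ ∈ l, ∀ x, χ.2 x = 1 → τ x = 1) ∧
      ∀ᵐ y ∂μ, y ∈ B → signedCount o b G y = signedCount o b (fun x => G x - τ x • a) y := by
  induction l with
  | nil =>
    refine ⟨fun _ => 0, contMDiff_const, fun _ => by simp, by simp, ?_⟩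
    simp
  | cons χ l ih =>
    obtain ⟨τ, hτ, hτI, hτ1, hae⟩ := ih
    have hχs : ContMDiff I 𝓘(ℝ, ℝ) ∞ χ.2 := χ.2.contMDiff
    have hχI : ∀ x, χ.2 x ∈ Icc (0 : ℝ) 1 := fun x => χ.2.mem_Icc
    -- `1 - τ' = (1 - χ) (1 - τ)`, so that `τ'` changes `τ` only in the coordinate ball of `χ`
    set τ' : X → ℝ := fun x => τ x + χ.2 x * (1 - τ x) with hτ'
    have hτ's : ContMDiff I 𝓘(ℝ, ℝ) ∞ τ' := hτ.add (hχs.mul (contMDiff_const.sub hτ))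
    have hτ'I : ∀ x, τ' x ∈ Icc (0 : ℝ) 1 := fun x => by
      obtain ⟨h0, h1⟩ := hτI x
      obtain ⟨k0, k1⟩ := hχI x
      constructor
      · have := mul_nonneg k0 (sub_nonneg.2 h1)
        simp only [hτ']
        linarith
      · have := mul_le_mul_of_nonneg_right k1 (sub_nonneg.2 h1)
        simp only [hτ']
        linarith
    refine ⟨τ', hτ's, hτ'I, ?_, ?_⟩
    · intro ψ hψ x hx
      rcases List.mem_cons.1 hψ with rfl | hψ
      · simp [hτ', hx]
      · simp [hτ', hτ1 ψ hψ x hx]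
    · have hsm : ∀ σ : X → ℝ, ContMDiff I 𝓘(ℝ, ℝ) ∞ σ →
          ContMDiff I 𝓘(ℝ, E) 1 (fun x => G x - σ x • a) := fun σ hσ =>
        hG.sub ((hσ.of_le (by exact_mod_cast le_top)).smul contMDiff_const)
      have hsub : ∀ σ : X → ℝ, (∀ x, σ x ∈ Icc (0 : ℝ) 1) → ∀ y ∈ B,
          (fun x => G x - σ x • a) ⁻¹' {y} ⊆ C := fun σ hσ y hy x hx => by
        refine hB y hy (σ x) (hσ x) ?_
        have hx' : G x - σ x • a = y := hx
        rw [mem_preimage, mem_singleton_iff, ← hx']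
        abel
      have hcb := χ.2.closedBall_subset
      rw [I.range_eq_univ, inter_univ] at hcb
      have hstep := ae_signedCount_eq_of_eqOn_compl o b μ (hsm τ hτ) (hsm τ' hτ's) χ.2.rOut_pos
        hcb (fun x hx => ?_) hC (hsub τ hτI) (hsub τ' hτ'I)
      · filter_upwards [hae, hstep] with y h1 h2 hy
        rw [h1 hy, h2 hy]
      · have hx0 : χ.2 x = 0 := by
          by_contra hne
          have := χ.2.tsupport_subset_symm_image_closedBall (subset_tsupport _ hne)
          rw [I.range_eq_univ, inter_univ] at this
          exact hx this
        simp [hτ', hx0]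

/-- All regular values in a ball over which `G` is proper have the same signed number of
preimages. -/
theorem signedCount_eq_of_mem_ball [Nontrivial E] {G : X → E} (hG : ContMDiff I 𝓘(ℝ, E) 1 G)
    {z : E} {r : ℝ} (hproper : IsCompact (G ⁻¹' Metric.closedBall z r)) {v w : E}
    (hv : v ∈ Metric.ball z r) (hw : w ∈ Metric.ball z r)
    (hrv : ∀ x, G x = v → frameJacobian o b G x ≠ 0)
    (hrw : ∀ x, G x = w → frameJacobian o b G x ≠ 0) :
    signedCount o b G v = signedCount o b G w := by
  borelize E
  let μ : Measure E := Measure.addHaar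
  set C : Set X := G ⁻¹' Metric.closedBall z r with hCdef
  set a : E := w - v with ha
  set B : Set E := {y | y ∈ Metric.ball z r ∧ y + a ∈ Metric.ball z r} with hBdef
  have hBo : IsOpen B := Metric.isOpen_ball.inter
    (Metric.isOpen_ball.preimage (continuous_id.add continuous_const))
  have hvB : v ∈ B := ⟨hv, by rw [ha, add_sub_cancel]; exact hw⟩
  have hB : ∀ y ∈ B, ∀ t ∈ Icc (0 : ℝ) 1, G ⁻¹' {y + t • a} ⊆ C := by
    intro y hy t ht x hx
    have hx' : G x = y + t • a := hx
    rw [hCdef, mem_preimage, hx']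
    have := (convex_ball z r).add_smul_mem hy.1 hy.2 ht
    exact Metric.ball_subset_closedBall this
  have χ : ∀ x : X, SmoothBumpFunction I x := fun x => Classical.arbitrary _
  obtain ⟨t, -, ht⟩ := hproper.elim_nhds_subcover (fun x => interior {x' | χ x x' = 1})
    fun x _ => interior_mem_nhds.2 (χ x).eventuallyEq_one
  obtain ⟨τ, hτ, hτI, hτ1, hae⟩ := ae_signedCount_eq_sub_smul o b μ hG hproper a hB
    (t.toList.map fun x => ⟨x, χ x⟩)
  have hτC : ∀ x ∈ C, ∀ᶠ x' in 𝓝 x, τ x' = 1 := by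
    intro x hx
    obtain ⟨x₀, hx₀, hxx₀⟩ := mem_iUnion₂.1 (ht hx)
    filter_upwards [isOpen_interior.mem_nhds hxx₀] with x' hx'
    have h1 : x' ∈ {x' | χ x₀ x' = 1} := interior_subset hx'
    exact hτ1 ⟨x₀, χ x₀⟩ (List.mem_map.2 ⟨x₀, Finset.mem_toList.2 hx₀, rfl⟩) x' h1
  -- the preimages of `y` under the deformed map lie in `C`, near which this map is `G - a`
  have hshift : ∀ y ∈ B, signedCount o b (fun x => G x - τ x • a) y =
      signedCount o b G (y + a) := by
    intro y hy
    have hset : (fun x => G x - τ x • a) ⁻¹' {y} = G ⁻¹' {y + a} := by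
      ext x
      constructor
      · intro hx
        have hx' : G x - τ x • a = y := hx
        have hxC : x ∈ C := hB y hy (τ x) (hτI x) (by
          rw [mem_preimage, mem_singleton_iff, ← hx']; abel)
        rw [mem_preimage, mem_singleton_iff, ← hx', (hτC x hxC).self_of_nhds, one_smul,
          sub_add_cancel]
      · intro hx
        have hx' : G x = y + a := hx
        have hxC : x ∈ C := hB y hy 1 (by simp) (by rw [one_smul]; exact hx)
        rw [mem_preimage, mem_singleton_iff, hx', (hτC x hxC).self_of_nhds, one_smul,
          add_sub_cancel_right]
    unfold signedCount
    rw [hset]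
    refine finsum_mem_congr rfl fun x hx => ?_
    have hxC : x ∈ C := hB y hy 1 (by simp) (by rw [one_smul]; exact hx)
    have hev : (fun x => G x - τ x • a) =ᶠ[𝓝 x] fun x => G x - a := by
      filter_upwards [hτC x hxC] with x' hx'
      rw [hx', one_smul]
    have : frameJacobian o b (fun x => G x - τ x • a) x = frameJacobian o b G x := by
      unfold frameJacobian
      have hGx : HasMFDerivAt I 𝓘(ℝ, E) G x (mfderiv I 𝓘(ℝ, E) G x) :=
        ((hG.mdifferentiable one_ne_zero) x).hasMFDerivAt
      have h2 : HasMFDerivAt I 𝓘(ℝ, E) (fun x => G x - a) x (mfderiv I 𝓘(ℝ, E) G x) :=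
        ⟨(hG.sub contMDiff_const).continuous.continuousAt, hGx.2.sub_const a⟩
      rw [hev.mfderiv_eq, h2.mfderiv]
      rfl
    rw [this]
  have hnhds : ∀ u ∈ Metric.ball z r, Metric.closedBall z r ∈ 𝓝 u := fun u hu =>
    mem_of_superset (Metric.isOpen_ball.mem_nhds hu) Metric.ball_subset_closedBall
  have hcv := eventually_signedCount_eq o b hG (hnhds v hv) hproper hrv
  have hcw := eventually_signedCount_eq o b hG (hnhds w hw) hproper hrw
  have hcw' : ∀ᶠ y in 𝓝 v, signedCount o b G (y + a) = signedCount o b G w := by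
    have : Tendsto (fun y => y + a) (𝓝 v) (𝓝 (v + a)) :=
      (continuous_id.add continuous_const).tendsto v
    rw [ha, add_sub_cancel] at this
    exact this.eventually hcw
  obtain ⟨y, hyae, ⟨hy1, hy2⟩, hyB⟩ := (Measure.dense_of_ae hae).inter_nhds_nonempty
    (inter_mem (inter_mem hcv hcw') (hBo.mem_nhds hvB))
  rw [← hy1, hyae hyB, hshift y hyB, hy2]

/-- The degree: all regular values in a preconnected set over which `G` is proper have the same
signed number of preimages. -/
theorem signedCount_eq_of_isPreconnected [Nontrivial E] {G : X → E}
    (hG : ContMDiff I 𝓘(ℝ, E) 1 G) {O : Set E} (hO : IsPreconnected O)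
    (hproper : ∀ y ∈ O, ∃ K ∈ 𝓝 y, IsCompact (G ⁻¹' K)) {v w : E} (hv : v ∈ O) (hw : w ∈ O)
    (hrv : ∀ x, G x = v → frameJacobian o b G x ≠ 0)
    (hrw : ∀ x, G x = w → frameJacobian o b G x ≠ 0) :
    signedCount o b G v = signedCount o b G w := by
  set reg : E → Prop := fun y => ∀ x, G x = y → frameJacobian o b G x ≠ 0 with hreg
  have hloc : ∀ y ∈ O, ∃ k : ℤ, ∀ᶠ y' in 𝓝 y, reg y' → signedCount o b G y' = k := by
    intro y hy
    obtain ⟨K, hK, hGK⟩ := hproper y hy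
    obtain ⟨r, hr, hrK⟩ := Metric.nhds_basis_closedBall.mem_iff.1 hK
    have hcomp : IsCompact (G ⁻¹' Metric.closedBall y r) :=
      hGK.of_isClosed_subset (Metric.isClosed_closedBall.preimage hG.continuous)
        (preimage_mono hrK)
    obtain ⟨u, hu, hur⟩ := exists_regular_value o b (fun _ : Unit => hG) hK
      (fun _ => hGK) (Metric.ball_mem_nhds y hr)
    refine ⟨signedCount o b G u, ?_⟩
    filter_upwards [Metric.ball_mem_nhds y hr] with y' hy' hy'r
    exact signedCount_eq_of_mem_ball o b hG hcomp hy' hu hy'r (hur ())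
  choose! k hk using hloc
  have hcont : ContinuousOn k O := by
    intro y hy
    refine (continuousWithinAt_const (b := k y)).congr_of_eventuallyEq ?_ rfl
    filter_upwards [(hk y hy).eventually_nhds.filter_mono nhdsWithin_le_nhds,
      self_mem_nhdsWithin] with y' hy' hy'O
    obtain ⟨K, hK, hGK⟩ := hproper y' hy'O
    obtain ⟨u, hu, hur⟩ := exists_regular_value o b (fun _ : Unit => hG) hK
      (fun _ => hGK) (inter_mem hy' (hk y' hy'O))
    rw [← hu.1 (hur ()), ← hu.2 (hur ())]
  rw [(hk v hv).self_of_nhds hrv, (hk w hw).self_of_nhds hrw]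
  exact hO.constant hcont hv hw

end Invariance

/-! ### Maps to a vector space other than the model space -/

section Transfer

variable {E H : Type*} [NormedAddCommGroup E] [NormedSpace ℝ E] [TopologicalSpace H]
  {I : ModelWithCorners ℝ E H} {X : Type*} [TopologicalSpace X] [ChartedSpace H X]
  {W : Type*} [NormedAddCommGroup W] [NormedSpace ℝ W] {d : ℕ} (b : Module.Basis (Fin d) ℝ W)

theorem frameJacobian_equiv [IsManifold I 1 X] (o : ManifoldOrientation I X d)
    {W' : Type*} [NormedAddCommGroup W'] [NormedSpace ℝ W'] (L : W ≃L[ℝ] W')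
    {G : X → W} (hG : ContMDiff I 𝓘(ℝ, W) 1 G) (x : X) :
    frameJacobian o (b.map L.toLinearEquiv) (fun x => L (G x)) x = frameJacobian o b G x := by
  have hGx : HasMFDerivAt I 𝓘(ℝ, W) G x (mfderiv I 𝓘(ℝ, W) G x) :=
    ((hG.mdifferentiable one_ne_zero) x).hasMFDerivAt
  have hL : HasMFDerivAt 𝓘(ℝ, W) 𝓘(ℝ, W') L (G x) (L : W →L[ℝ] W') :=
    (L.hasFDerivAt (x := G x)).hasMFDerivAt
  refine (Module.Basis.det_map b L.toLinearEquiv _).trans (congrArg b.det ?_)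
  funext i
  have := congrArg (fun A : E →L[ℝ] W' => A (o.frame x i)) (hL.comp x hGx).mfderiv
  exact (congrArg L.symm this).trans (L.symm_apply_apply _)

theorem signedCount_equiv [IsManifold I 1 X] (o : ManifoldOrientation I X d)
    {W' : Type*} [NormedAddCommGroup W'] [NormedSpace ℝ W'] (L : W ≃L[ℝ] W')
    {G : X → W} (hG : ContMDiff I 𝓘(ℝ, W) 1 G) (y : W) :
    signedCount o (b.map L.toLinearEquiv) (fun x => L (G x)) (L y) = signedCount o b G y := by
  unfold signedCount
  refine finsum_mem_congr (by ext x; simp) fun x _ => ?_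
  rw [frameJacobian_equiv b o L hG]

theorem ContMDiff.continuousLinearEquiv_comp {W' : Type*} [NormedAddCommGroup W']
    [NormedSpace ℝ W'] (L : W ≃L[ℝ] W') {G : X → W} (hG : ContMDiff I 𝓘(ℝ, W) 1 G) :
    ContMDiff I 𝓘(ℝ, W') 1 (fun x => L (G x)) :=
  L.contDiff.contMDiff.comp hG

theorem isCompact_preimage_equiv {W' : Type*} [NormedAddCommGroup W'] [NormedSpace ℝ W']
    (L : W ≃L[ℝ] W') {G : X → W} {K : Set W} (hK : IsCompact (G ⁻¹' K)) :
    IsCompact ((fun x => L (G x)) ⁻¹' (L '' K)) := by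
  convert hK using 1
  ext x
  simp

variable [I.Boundaryless] [FiniteDimensional ℝ E] [IsManifold I ∞ X]
  (o : ManifoldOrientation I X d)

theorem exists_regular_value_of_equiv (L : W ≃L[ℝ] E) {ι : Type*} [Countable ι] {G : ι → X → W}
    (hG : ∀ i, ContMDiff I 𝓘(ℝ, W) 1 (G i)) {K N : Set W} {y : W} (hK : K ∈ 𝓝 y)
    (hGK : ∀ i, IsCompact (G i ⁻¹' K)) (hN : N ∈ 𝓝 y) :
    ∃ y' ∈ N, ∀ i x, G i x = y' → frameJacobian o b (G i) x ≠ 0 := by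
  have himg : ∀ {S : Set W}, S ∈ 𝓝 y → L '' S ∈ 𝓝 (L y) := fun hS =>
    L.toHomeomorph.isOpenMap.image_mem_nhds hS
  obtain ⟨_, ⟨y', hy', rfl⟩, hreg⟩ := exists_regular_value o (b.map L.toLinearEquiv)
    (fun i => (hG i).continuousLinearEquiv_comp L) (himg hK)
    (fun i => isCompact_preimage_equiv L (hGK i)) (himg hN)
  refine ⟨y', hy', fun i x hx => ?_⟩
  rw [← frameJacobian_equiv b o L (hG i)]
  exact hreg i x (by rw [hx])

theorem finite_preimage_of_isCompact_of_equiv [T2Space X] (L : W ≃L[ℝ] E) {G : X → W}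
    (hG : ContMDiff I 𝓘(ℝ, W) 1 G) {C : Set X} (hC : IsCompact C) {y : W} (hy : G ⁻¹' {y} ⊆ C)
    (hreg : ∀ x, G x = y → frameJacobian o b G x ≠ 0) : (G ⁻¹' {y}).Finite := by
  have hset : (fun x => L (G x)) ⁻¹' {L y} = G ⁻¹' {y} := by ext x; simp
  have := finite_preimage_of_isCompact o (b.map L.toLinearEquiv)
    (hG.continuousLinearEquiv_comp L) hC (y := L y) (hset ▸ hy) fun x hx => by
      rw [frameJacobian_equiv b o L hG]
      exact hreg x (L.injective hx)
  rwa [hset] at this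

theorem signedCount_eq_of_isPreconnected_of_equiv [T2Space X] [Nontrivial W] (L : W ≃L[ℝ] E)
    {G : X → W} (hG : ContMDiff I 𝓘(ℝ, W) 1 G) {O : Set W} (hO : IsPreconnected O)
    (hproper : ∀ y ∈ O, ∃ K ∈ 𝓝 y, IsCompact (G ⁻¹' K)) {v w : W} (hv : v ∈ O) (hw : w ∈ O)
    (hrv : ∀ x, G x = v → frameJacobian o b G x ≠ 0)
    (hrw : ∀ x, G x = w → frameJacobian o b G x ≠ 0) :
    signedCount o b G v = signedCount o b G w := by
  have : Nontrivial E := L.injective.nontrivial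
  rw [← signedCount_equiv b o L hG, ← signedCount_equiv b o L hG]
  refine signedCount_eq_of_isPreconnected o _ (hG.continuousLinearEquiv_comp L)
    (hO.image L L.continuous.continuousOn) ?_ (mem_image_of_mem L hv) (mem_image_of_mem L hw) ?_ ?_
  · rintro _ ⟨y, hy, rfl⟩
    obtain ⟨K, hK, hGK⟩ := hproper y hy
    exact ⟨L '' K, L.toHomeomorph.isOpenMap.image_mem_nhds hK, isCompact_preimage_equiv L hGK⟩
  · intro x hx
    rw [frameJacobian_equiv b o L hG]
    exact hrv x (L.injective hx)
  · intro x hx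
    rw [frameJacobian_equiv b o L hG]
    exact hrw x (L.injective hx)

end Transfer

/-! ### Derivatives of vector-valued maps -/

/-- `G : X → W` has derivative `A` at `x` in the preferred chart at `x`. This is `HasMFDerivAt`,
with the tangent spaces replaced by the vector spaces `E` and `W` that model them. -/
def HasVectorDerivAt {E H : Type*} [NormedAddCommGroup E] [NormedSpace ℝ E] [TopologicalSpace H]
    (I : ModelWithCorners ℝ E H) {X : Type*} [TopologicalSpace X] [ChartedSpace H X]
    {W : Type*} [NormedAddCommGroup W] [NormedSpace ℝ W] (G : X → W) (A : E →L[ℝ] W) (x : X) :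
    Prop :=
  ContinuousAt G x ∧
    HasFDerivWithinAt (G ∘ (extChartAt I x).symm) A (range I) (extChartAt I x x)

section HasVectorDerivAt

variable {E H : Type*} [NormedAddCommGroup E] [NormedSpace ℝ E] [TopologicalSpace H]
  {I : ModelWithCorners ℝ E H} {X : Type*} [TopologicalSpace X] [ChartedSpace H X]
  {E' H' : Type*} [NormedAddCommGroup E'] [NormedSpace ℝ E'] [TopologicalSpace H']
  {J : ModelWithCorners ℝ E' H'} {Y : Type*} [TopologicalSpace Y] [ChartedSpace H' Y]
  {W W' : Type*} [NormedAddCommGroup W] [NormedSpace ℝ W] [NormedAddCommGroup W']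
  [NormedSpace ℝ W'] {G G' : X → W} {A A' : E →L[ℝ] W} {x : X}

theorem HasVectorDerivAt.hasMFDerivAt (h : HasVectorDerivAt I G A x) :
    HasMFDerivAt I 𝓘(ℝ, W) G x A := h

theorem HasMFDerivAt.hasVectorDerivAt (h : HasMFDerivAt I 𝓘(ℝ, W) G x A) :
    HasVectorDerivAt I G A x := h

theorem HasVectorDerivAt.mfderiv_apply (h : HasVectorDerivAt I G A x) (u : TangentSpace I x) :
    (mfderiv I 𝓘(ℝ, W) G x u : W) = A u := by
  rw [h.hasMFDerivAt.mfderiv]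
  rfl

theorem ContMDiff.hasVectorDerivAt {n : WithTop ℕ∞} (hG : ContMDiff I 𝓘(ℝ, W) n G) (hn : n ≠ 0)
    (x : X) : HasVectorDerivAt I G (mfderiv I 𝓘(ℝ, W) G x) x :=
  ((hG.mdifferentiable hn) x).hasMFDerivAt

theorem HasVectorDerivAt.comp_fst (h : HasVectorDerivAt I G A x) (y : Y) :
    HasVectorDerivAt (I.prod J) (fun p : X × Y => G p.1)
      (A.comp (ContinuousLinearMap.fst ℝ E E')) (x, y) := by
  have h₁ : HasMFDerivAt I 𝓘(ℝ, W) G (Prod.fst (x, y)) A := h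
  exact (h₁.comp (x, y) (hasMFDerivAt_fst (I := I) (I' := J) (x, y))).hasVectorDerivAt

theorem HasVectorDerivAt.comp_snd (h : HasVectorDerivAt I G A x) (y : Y) :
    HasVectorDerivAt (J.prod I) (fun p : Y × X => G p.2)
      (A.comp (ContinuousLinearMap.snd ℝ E' E)) (y, x) := by
  have h₁ : HasMFDerivAt I 𝓘(ℝ, W) G (Prod.snd (y, x)) A := h
  exact (h₁.comp (y, x) (hasMFDerivAt_snd (I := J) (I' := I) (y, x))).hasVectorDerivAt

theorem HasFDerivAt.comp_hasVectorDerivAt {φ : W → W'} {φ' : W →L[ℝ] W'}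
    (hφ : HasFDerivAt φ φ' (G x)) (h : HasVectorDerivAt I G A x) :
    HasVectorDerivAt I (fun x => φ (G x)) (φ'.comp A) x := by
  refine ⟨hφ.continuousAt.comp h.1, ?_⟩
  have hφ' : HasFDerivAt φ φ' ((G ∘ (extChartAt I x).symm) (extChartAt I x x)) := by
    rwa [Function.comp_apply, extChartAt_to_inv]
  exact hφ'.comp_hasFDerivWithinAt _ h.2

theorem HasVectorDerivAt.prodMk {K : X → W'} {B : E →L[ℝ] W'} (h : HasVectorDerivAt I G A x)
    (hK : HasVectorDerivAt I K B x) : HasVectorDerivAt I (fun x => (G x, K x)) (A.prod B) x :=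
  ⟨h.1.prodMk hK.1, h.2.prodMk hK.2⟩

theorem HasVectorDerivAt.sub (h : HasVectorDerivAt I G A x) (h' : HasVectorDerivAt I G' A' x) :
    HasVectorDerivAt I (fun x => G x - G' x) (A - A') x :=
  ⟨h.1.sub h'.1, h.2.sub h'.2⟩

theorem HasVectorDerivAt.smul {c : X → ℝ} {c' : E →L[ℝ] ℝ} (hc : HasVectorDerivAt I c c' x)
    (h : HasVectorDerivAt I G A x) :
    HasVectorDerivAt I (fun x => c x • G x) (c x • A + c'.smulRight (G x)) x := by
  refine ⟨hc.1.smul h.1, ?_⟩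
  have := hc.2.smul h.2
  simp only [Function.comp_apply, extChartAt_to_inv] at this
  exact this

theorem hasVectorDerivAt_id (s : ℝ) :
    HasVectorDerivAt 𝓘(ℝ, ℝ) (fun s : ℝ => s) (ContinuousLinearMap.id ℝ ℝ) s :=
  hasMFDerivAt_id (I := 𝓘(ℝ, ℝ)) s

end HasVectorDerivAt

/-! ### Products of oriented manifolds -/

section ProductOrientation

/-- The positive frame at `p`, as a basis of the model vector space. -/
def ManifoldOrientation.basis {E H : Type*} [NormedAddCommGroup E] [NormedSpace ℝ E]
    [TopologicalSpace H] {I : ModelWithCorners ℝ E H} {X : Type*} [TopologicalSpace X]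
    [ChartedSpace H X] [IsManifold I 1 X] {d : ℕ} (o : ManifoldOrientation I X d) (p : X) :
    Module.Basis (Fin d) ℝ E :=
  o.frame p

theorem Module.Basis.det_prod_sumElim {ι κ E F : Type*} [Fintype ι] [DecidableEq ι] [Fintype κ]
    [DecidableEq κ] [AddCommGroup E] [Module ℝ E] [AddCommGroup F] [Module ℝ F]
    (b : Module.Basis ι ℝ E) (b' : Module.Basis κ ℝ F) (w : ι → E) (w' : κ → F) :
    (b.prod b').det (Sum.elim (fun i => (w i, 0)) (fun j => (0, w' j))) =
      b.det w * b'.det w' := by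
  rw [Module.Basis.det_apply, Module.Basis.det_apply, Module.Basis.det_apply]
  have : (b.prod b').toMatrix (Sum.elim (fun i => (w i, 0)) (fun j => (0, w' j))) =
      Matrix.fromBlocks (b.toMatrix w) 0 0 (b'.toMatrix w') := by
    ext i j
    rcases i with i | i <;> rcases j with j | j <;>
      simp [Module.Basis.toMatrix_apply]
  rw [this, Matrix.det_fromBlocks_zero₂₁]

variable {E H : Type*} [NormedAddCommGroup E] [NormedSpace ℝ E] [TopologicalSpace H]
  {I : ModelWithCorners ℝ E H} [I.Boundaryless] {X : Type*} [TopologicalSpace X] [ChartedSpace H X]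
  {E' H' : Type*} [NormedAddCommGroup E'] [NormedSpace ℝ E'] [TopologicalSpace H']
  {J : ModelWithCorners ℝ E' H'} [J.Boundaryless] {Y : Type*} [TopologicalSpace Y]
  [ChartedSpace H' Y] [IsManifold I 1 X] [IsManifold J 1 Y]

theorem tangentCoordChange_prod {p q : X × Y}
    (hq₁ : q.1 ∈ (extChartAt I p.1).source) (hq₂ : q.2 ∈ (extChartAt J p.2).source) :
    tangentCoordChange (I.prod J) q p q =
      (tangentCoordChange I q.1 p.1 q.1).prodMap (tangentCoordChange J q.2 p.2 q.2) := by
  have h₁ := hasFDerivWithinAt_tangentCoordChange (I := I) (x := q.1) (y := p.1) (z := q.1)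
    ⟨mem_extChartAt_source q.1, hq₁⟩
  have h₂ := hasFDerivWithinAt_tangentCoordChange (I := J) (x := q.2) (y := p.2) (z := q.2)
    ⟨mem_extChartAt_source q.2, hq₂⟩
  rw [I.range_eq_univ, hasFDerivWithinAt_univ] at h₁
  rw [J.range_eq_univ, hasFDerivWithinAt_univ] at h₂
  rw [tangentCoordChange_def, (I.prod J).range_eq_univ, fderivWithin_univ]
  refine HasFDerivAt.fderiv ?_
  have := HasFDerivAt.prodMap (p := (extChartAt I q.1 q.1, extChartAt J q.2 q.2)) h₁ h₂
  rw [extChartAt_prod, extChartAt_prod]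
  exact this

/-- The product orientation. The bijection `σ` orders the frame of the product. -/
def ManifoldOrientation.prod {d e k : ℕ} (o : ManifoldOrientation I X d)
    (o' : ManifoldOrientation J Y e) (σ : Fin d ⊕ Fin e ≃ Fin k) :
    ManifoldOrientation (I.prod J) (X × Y) k where
  frame p := ((o.basis p.1).prod
    (o'.basis p.2)).reindex σ
  coherent p := by
    have h₁ : ∀ᶠ q : X × Y in 𝓝 p, 0 < (o.basis p.1).det
        (fun i => tangentCoordChange I q.1 p.1 q.1 (o.basis q.1 i)) :=
      continuous_fst.continuousAt.eventually (o.coherent p.1)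
    have h₂ : ∀ᶠ q : X × Y in 𝓝 p, 0 < (o'.basis p.2).det
        (fun i => tangentCoordChange J q.2 p.2 q.2 (o'.basis q.2 i)) :=
      continuous_snd.continuousAt.eventually (o'.coherent p.2)
    filter_upwards [h₁, h₂,
      continuous_fst.continuousAt.eventually ((isOpen_extChartAt_source (I := I) p.1).mem_nhds
        (mem_extChartAt_source p.1)),
      continuous_snd.continuousAt.eventually ((isOpen_extChartAt_source (I := J) p.2).mem_nhds
        (mem_extChartAt_source p.2))] with q k₁ k₂ hq₁ hq₂
    have key := Module.Basis.det_prod_sumElim (o.basis p.1)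
      (o'.basis p.2)
      (fun i => tangentCoordChange I q.1 p.1 q.1 (o.basis q.1 i))
      (fun i => tangentCoordChange J q.2 p.2 q.2 (o'.basis q.2 i))
    have hpos := mul_pos k₁ k₂
    have hframe : (fun i => tangentCoordChange (I.prod J) q p q
        ((((o.basis q.1).prod
          (o'.basis q.2)).reindex σ) i)) ∘ σ =
        Sum.elim (fun i => ((tangentCoordChange I q.1 p.1 q.1 (o.basis q.1 i) : E), (0 : E')))
          (fun j => ((0 : E), (tangentCoordChange J q.2 p.2 q.2 (o'.basis q.2 j) : E'))) := by
      funext i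
      rw [Function.comp_apply, tangentCoordChange_prod hq₁ hq₂, Module.Basis.reindex_apply,
        Equiv.symm_apply_apply]
      rcases i with i | i <;> simp [-tangentBundleCore_coordChange]
    refine hpos.trans_eq (key.symm.trans ?_)
    rw [← hframe]
    exact (Module.Basis.det_reindex _ _ σ).symm

end ProductOrientation

/-! ### The linking determinant -/

section LinkingDeterminant

theorem ContactSpace.coord_injective {n : ℕ} :
    Function.Injective (coord : ContactSpace n → Fin (n + n + 1) → ℝ) := by
  intro w w' h
  have hx : ∀ i : Fin n, w.1 i = w'.1 i := fun i => by
    have := congrFun h ⟨2 * i, by omega⟩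
    have h1 : 2 * i.1 / 2 < n := by omega
    have h2 : 2 * i.1 % 2 = 0 := by omega
    simp only [coord, h1, h2, dif_pos, if_pos] at this
    have h3 : (⟨2 * i.1 / 2, h1⟩ : Fin n) = i := by ext; simp
    rwa [h3] at this
  have hy : ∀ i : Fin n, w.2.1 i = w'.2.1 i := fun i => by
    have := congrFun h ⟨2 * i + 1, by omega⟩
    have h1 : (2 * i.1 + 1) / 2 < n := by omega
    have h2 : ¬ (2 * i.1 + 1) % 2 = 0 := by omega
    simp only [coord, h1, h2, dif_pos, if_false] at this
    have h3 : (⟨(2 * i.1 + 1) / 2, h1⟩ : Fin n) = i := by ext; simp; omega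
    rwa [h3] at this
  have hz : w.2.2 = w'.2.2 := by
    have := congrFun h (Fin.last (n + n))
    have h1 : ¬ (n + n) / 2 < n := by omega
    simpa [coord, h1] using this
  exact Prod.ext (funext hx) (Prod.ext (funext hy) hz)

/-- The coordinates `(x₁, y₁, …, xₙ, yₙ, z)` as a linear isomorphism. -/
def ContactSpace.coordEquiv (n : ℕ) : ContactSpace n ≃ₗ[ℝ] (Fin (n + n + 1) → ℝ) :=
  LinearEquiv.ofInjectiveOfFinrankEq
    { toFun := coord
      map_add' := fun u v => by
        funext r
        simp only [coord, Pi.add_apply, Prod.fst_add, Prod.snd_add]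
        split_ifs <;> rfl
      map_smul' := fun c v => by
        funext r
        simp only [coord, Pi.smul_apply, Prod.smul_fst, Prod.smul_snd, RingHom.id_apply]
        split_ifs <;> rfl }
    coord_injective (by simp; ring)

/-- The basis of `ℝ^{2n+1}` dual to the coordinates `(x₁, y₁, …, xₙ, yₙ, z)`. -/
def contactBasis (n : ℕ) : Module.Basis (Fin (n + n + 1)) ℝ (ContactSpace n) :=
  Module.Basis.ofEquivFun (coordEquiv n)

theorem contactBasis_repr {n : ℕ} (w : ContactSpace n) (r : Fin (n + n + 1)) :
    (contactBasis n).repr w r = coord w r := rfl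

variable {E H : Type*} [NormedAddCommGroup E] [NormedSpace ℝ E] [TopologicalSpace H]
  {I : ModelWithCorners ℝ E H} {M : Type*} [TopologicalSpace M] [ChartedSpace H M]

/-- The differential of a map to `ℝ^{2n+1}`, on the vector space that models the tangent spaces. -/
def vectorDeriv {W : Type*} [NormedAddCommGroup W] [NormedSpace ℝ W] (I : ModelWithCorners ℝ E H)
    (f : M → W) (p : M) : E →L[ℝ] W :=
  mfderiv I 𝓘(ℝ, W) f p

theorem HasVectorDerivAt.vectorDeriv_eq {W : Type*} [NormedAddCommGroup W] [NormedSpace ℝ W]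
    {f : M → W} {A : E →L[ℝ] W} {p : M} (h : HasVectorDerivAt I f A p) :
    vectorDeriv I f p = A :=
  h.hasMFDerivAt.mfderiv

theorem ContMDiff.hasVectorDerivAt_vectorDeriv {W : Type*} [NormedAddCommGroup W] [NormedSpace ℝ W]
    {f : M → W} {n : WithTop ℕ∞} (hf : ContMDiff I 𝓘(ℝ, W) n f) (hn : n ≠ 0) (p : M) :
    HasVectorDerivAt I f (vectorDeriv I f p) p :=
  hf.hasVectorDerivAt hn p

theorem linkingDet_eq_det {n : ℕ} [IsManifold I 1 M] (o : ManifoldOrientation I M n)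
    (f g : M → ContactSpace n) (v : ContactSpace n) (pq : M × M) :
    linkingDet I o f g v pq = (contactBasis n).det (Fin.cons v (Fin.append
      (fun i => vectorDeriv I f pq.1 (o.basis pq.1 i))
      (fun i => vectorDeriv I g pq.2 (o.basis pq.2 i)))) := by
  rw [Module.Basis.det_apply]
  rfl

/-- Moving the first column to the last place changes no sign, since there are an even number of
other columns; reversing and rescaling columns multiplies the sign of the determinant by that of
the product of the factors. -/
theorem sign_det_eq_sign_det_cons_append {n : ℕ} {W : Type*} [AddCommGroup W] [Module ℝ W]
    (b : Module.Basis (Fin (n + n + 1)) ℝ W)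
    (A B : Fin n → W) (v : W) {c c' : ℝ} (hc : 0 < c) (hc' : 0 < c')
    (u : Fin (n + n + 1) → W) (hA : ∀ i, u (Fin.castAdd 1 (Fin.castAdd n i)) = -(c • A i))
    (hB : ∀ i, u (Fin.castAdd 1 (Fin.natAdd n i)) = c • B i)
    (hv : u (Fin.natAdd (n + n) 0) = -(c' • v)) :
    (SignType.sign (b.det u) : ℤ) =
      (-1) ^ (n + 1) * SignType.sign (b.det (Fin.cons v (Fin.append A B))) := by
  set t : Fin (n + n + 1) → W := Fin.cons v (Fin.append A B) with ht
  set k : Fin (n + n + 1) → ℝ :=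
    Fin.append (Fin.append (fun _ : Fin n => -c) (fun _ : Fin n => c)) (fun _ : Fin 1 => -c')
    with hk
  have hrot : ∀ j : Fin (n + n), finRotate (n + n + 1) (Fin.castAdd 1 j) = j.succ := fun j => by
    rw [finRotate_apply]
    exact Fin.coeSucc_eq_succ
  have hrot' : finRotate (n + n + 1) (Fin.natAdd (n + n) (0 : Fin 1)) = 0 := by
    rw [finRotate_apply]
    exact Fin.last_add_one _
  have hu : u = fun j => k j • (t ∘ finRotate (n + n + 1)) j := by
    funext j
    refine Fin.addCases (fun j => ?_) (fun j => ?_) j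
    · refine Fin.addCases (fun i => ?_) (fun i => ?_) j
      · rw [hA, Function.comp_apply, hrot, ht, Fin.cons_succ, Fin.append_left, hk, Fin.append_left,
          Fin.append_left, neg_smul]
      · rw [hB, Function.comp_apply, hrot, ht, Fin.cons_succ, Fin.append_right, hk, Fin.append_left,
          Fin.append_right]
    · rw [Subsingleton.elim j 0, hv, Function.comp_apply, hrot', ht, Fin.cons_zero, hk,
        Fin.append_right, neg_smul]
  have hprod : ∏ j, k j = (-1) ^ (n + 1) * (c ^ n * c ^ n * c') := by
    rw [Fin.prod_univ_add, Fin.prod_univ_add]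
    simp only [hk, Fin.append_left, Fin.append_right, Finset.prod_const, Finset.card_univ,
      Fintype.card_fin]
    rw [neg_pow c]
    ring
  have hdet : b.det u = (-1) ^ (n + 1) * (c ^ n * c ^ n * c') * b.det t := by
    rw [hu, b.det.map_smul_univ, b.det.map_perm, sign_finRotate, hprod]
    simp [← two_mul]
  have hpos : 0 < c ^ n * c ^ n * c' := by positivity
  rw [hdet, sign_mul, sign_mul, sign_pos hpos, sign_pow, sign_neg (by norm_num : (-1 : ℝ) < 0),
    mul_one, SignType.coe_mul]
  simp

/-- The positive frame of `M × M × ℝ` is made of the frames of the three factors. -/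
def rayOrientation [I.Boundaryless] {n : ℕ} [IsManifold I 1 M] (o : ManifoldOrientation I M n) :
    ManifoldOrientation ((I.prod I).prod 𝓘(ℝ, ℝ)) ((M × M) × ℝ) (n + n + 1) :=
  (o.prod o finSumFinEquiv).prod
    { frame := fun _ => (Module.Basis.singleton (Fin 1) ℝ : Module.Basis (Fin 1) ℝ ℝ)
      coherent := fun p => by
        refine Eventually.of_forall fun q => ?_
        have : (fun i => tangentCoordChange 𝓘(ℝ, ℝ) q p q
            ((Module.Basis.singleton (Fin 1) ℝ : Module.Basis (Fin 1) ℝ ℝ) i)) =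
            (Module.Basis.singleton (Fin 1) ℝ : Module.Basis (Fin 1) ℝ ℝ) := by
          funext i
          rw [tangentCoordChange_def, extChartAt_model_space_eq_id, extChartAt_model_space_eq_id]
          simp [fderivWithin_id]
        refine lt_of_lt_of_eq zero_lt_one ?_
        refine ((Module.Basis.det_self
          (Module.Basis.singleton (Fin 1) ℝ : Module.Basis (Fin 1) ℝ ℝ)).symm.trans ?_)
        exact congrArg _ this.symm } finSumFinEquiv

section

variable [I.Boundaryless] {n : ℕ} [IsManifold I 1 M] (o : ManifoldOrientation I M n)

theorem rayOrientation_basis_left (p q : M) (s : ℝ) (i : Fin n) :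
    (rayOrientation o).basis ((p, q), s) (Fin.castAdd 1 (Fin.castAdd n i)) =
      ((o.basis p i, 0), 0) := by
  change (((((o.basis p).prod (o.basis q)).reindex finSumFinEquiv).prod
    (Module.Basis.singleton (Fin 1) ℝ : Module.Basis (Fin 1) ℝ ℝ)).reindex finSumFinEquiv)
      (Fin.castAdd 1 (Fin.castAdd n i)) = ((o.basis p i, 0), 0)
  simp

theorem rayOrientation_basis_right (p q : M) (s : ℝ) (i : Fin n) :
    (rayOrientation o).basis ((p, q), s) (Fin.castAdd 1 (Fin.natAdd n i)) =
      ((0, o.basis q i), 0) := by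
  change (((((o.basis p).prod (o.basis q)).reindex finSumFinEquiv).prod
    (Module.Basis.singleton (Fin 1) ℝ : Module.Basis (Fin 1) ℝ ℝ)).reindex finSumFinEquiv)
      (Fin.castAdd 1 (Fin.natAdd n i)) = ((0, o.basis q i), 0)
  rw [Module.Basis.reindex_apply, finSumFinEquiv_symm_apply_castAdd, Module.Basis.prod_apply,
    Sum.elim_inl, Function.comp_apply, Module.Basis.reindex_apply,
    finSumFinEquiv_symm_apply_natAdd, Module.Basis.prod_apply]
  rfl

theorem rayOrientation_basis_last (p q : M) (s : ℝ) :
    (rayOrientation o).basis ((p, q), s) (Fin.natAdd (n + n) 0) = ((0, 0), 1) := by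
  change (((((o.basis p).prod (o.basis q)).reindex finSumFinEquiv).prod
    (Module.Basis.singleton (Fin 1) ℝ : Module.Basis (Fin 1) ℝ ℝ)).reindex finSumFinEquiv)
      (Fin.natAdd (n + n) 0) = ((0, 0), 1)
  rw [Module.Basis.reindex_apply, finSumFinEquiv_symm_apply_natAdd, Module.Basis.prod_apply]
  simp
  rfl

/-- The linking determinant is, up to a global sign, the local degree of a map on `M × M × ℝ` whose
differential is `(u, u', t) ↦ -c df(u) + c dg(u') - c' t v` with `c, c' > 0`. -/
theorem sign_det_comp_rayOrientation (f g : M → ContactSpace n) (v : ContactSpace n) (p q : M)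
    (s : ℝ) {c c' : ℝ} (hc : 0 < c) (hc' : 0 < c') (A : (E × E) × ℝ →L[ℝ] ContactSpace n)
    (h₁ : ∀ u, A ((u, 0), 0) = -(c • vectorDeriv I f p u))
    (h₂ : ∀ u, A ((0, u), 0) = c • vectorDeriv I g q u)
    (h₃ : A ((0, 0), 1) = -(c' • v)) :
    (SignType.sign ((contactBasis n).det fun i => A ((rayOrientation o).basis ((p, q), s) i)) : ℤ) =
      (-1) ^ (n + 1) * SignType.sign (linkingDet I o f g v (p, q)) := by
  rw [linkingDet_eq_det]
  refine sign_det_eq_sign_det_cons_append _ _ _ v hc hc' _ (fun i => ?_) (fun i => ?_) ?_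
  · simp only [rayOrientation_basis_left, h₁]
  · simp only [rayOrientation_basis_right, h₂]
  · simp only [rayOrientation_basis_last, h₃]

end

/-! ### Independence of the orientation -/

theorem Module.Basis.det_comp_eq_mul {ι R E W : Type*} [Fintype ι] [DecidableEq ι] [CommRing R]
    [AddCommGroup E] [Module R E] [AddCommGroup W] [Module R W] (b : Module.Basis ι R W)
    (A : E →ₗ[R] W) (e : Module.Basis ι R E) (w : ι → E) :
    b.det (fun i => A (w i)) = b.det (fun i => A (e i)) * e.det w := by
  have := AlternatingMap.eq_smul_basis_det e (b.det.compLinearMap A)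
  exact congrArg (fun φ : E [⋀^ι]→ₗ[R] R => φ w) this

theorem Module.Basis.det_reindex_prod {ι κ τ E F : Type*} [Fintype ι] [DecidableEq ι] [Fintype κ]
    [DecidableEq κ] [Fintype τ] [DecidableEq τ] [AddCommGroup E] [Module ℝ E] [AddCommGroup F]
    [Module ℝ F] (b e : Module.Basis ι ℝ E) (b' e' : Module.Basis κ ℝ F) (σ : ι ⊕ κ ≃ τ) :
    ((b.prod b').reindex σ).det ((e.prod e').reindex σ) = b.det e * b'.det e' := by
  have hcoe : ⇑(e.prod e') = Sum.elim (fun i => (e i, 0)) (fun j => (0, e' j)) := by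
    funext i
    rcases i with i | i <;> simp
  rw [Module.Basis.det_reindex, Module.Basis.coe_reindex, Function.comp_assoc,
    Equiv.symm_comp_self, Function.comp_id, hcoe, Module.Basis.det_prod_sumElim]

/-- Two orientations of a connected manifold agree everywhere or disagree everywhere. -/
theorem sign_det_orientation_eq [ConnectedSpace M] {n : ℕ} [IsManifold I 1 M]
    (o o' : ManifoldOrientation I M n) (p q : M) :
    SignType.sign ((o.basis p).det (o'.basis p)) =
      SignType.sign ((o.basis q).det (o'.basis q)) := by
  have hloc : ∀ x : M, ∀ᶠ x' in 𝓝 x, SignType.sign ((o.basis x').det (o'.basis x')) =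
      SignType.sign ((o.basis x).det (o'.basis x)) := by
    intro x
    have hxx := mem_extChartAt_source (I := I) x
    let b := o.basis x
    obtain ⟨hne, hev⟩ := eventually_sign_chartFrameDet_eq o b hxx
    obtain ⟨hne', hev'⟩ := eventually_sign_chartFrameDet_eq o' b hxx
    have hrel : ∀ x', chartFrameDet o' b x x' =
        chartFrameDet o b x x' * (o.basis x').det (o'.basis x') := fun x' =>
      Module.Basis.det_comp_eq_mul b (tangentCoordChange I x' x x' : E →ₗ[ℝ] E) (o.basis x')
        (o'.basis x')
    filter_upwards [hev, hev'] with x' h h'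
    rw [hrel, hrel, sign_mul, sign_mul, h] at h'
    exact mul_left_cancel₀ (sign_ne_zero.2 hne) h'
  have hcont : Continuous fun x : M => (SignType.sign ((o.basis x).det (o'.basis x)) : ℤ) := by
    refine continuous_iff_continuousAt.2 fun x => ?_
    refine (continuousAt_const (y := (SignType.sign ((o.basis x).det (o'.basis x)) : ℤ))).congr ?_
    filter_upwards [hloc x] with x' h
    rw [h]
  have := isPreconnected_univ.constant hcont.continuousOn (mem_univ p) (mem_univ q)
  rcases h₁ : SignType.sign ((o.basis p).det (o'.basis p)) <;>
    rcases h₂ : SignType.sign ((o.basis q).det (o'.basis q)) <;> simp_all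

/-- On a connected manifold the linking determinant does not depend on the orientation: a change of
orientation reverses the frames at both points. -/
theorem sign_linkingDet_congr [ConnectedSpace M] [I.Boundaryless] {n : ℕ} [IsManifold I 1 M]
    (o o' : ManifoldOrientation I M n) (f g : M → ContactSpace n) (v : ContactSpace n)
    (pq : M × M) :
    (SignType.sign (linkingDet I o' f g v pq) : ℤ) = SignType.sign (linkingDet I o f g v pq) := by
  obtain ⟨p, q⟩ := pq
  let A : (E × E) × ℝ →L[ℝ] ContactSpace n :=
    (-((vectorDeriv I f p).comp (ContinuousLinearMap.fst ℝ E E)) +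
      (vectorDeriv I g q).comp (ContinuousLinearMap.snd ℝ E E)).comp
        (ContinuousLinearMap.fst ℝ (E × E) ℝ) -
      (ContinuousLinearMap.snd ℝ (E × E) ℝ).smulRight v
  have key : ∀ o : ManifoldOrientation I M n,
      (SignType.sign ((contactBasis n).det
        fun i => A ((rayOrientation o).basis ((p, q), 0) i)) : ℤ) =
      (-1) ^ (n + 1) * SignType.sign (linkingDet I o f g v (p, q)) := fun o =>
    sign_det_comp_rayOrientation o f g v p q 0 one_pos one_pos A (by simp [A]) (by simp [A])
      (by simp [A])
  have hne : ((-1) ^ (n + 1) : ℤ) ≠ 0 := by simp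
  refine mul_left_cancel₀ hne ((key o').symm.trans (Eq.trans ?_ (key o)))
  have hmul : (contactBasis n).det (fun i => A ((rayOrientation o').basis ((p, q), 0) i)) =
      (contactBasis n).det (fun i => A ((rayOrientation o).basis ((p, q), 0) i)) *
        ((rayOrientation o).basis ((p, q), 0)).det ((rayOrientation o').basis ((p, q), 0)) :=
    Module.Basis.det_comp_eq_mul (contactBasis n) (A : (E × E) × ℝ →ₗ[ℝ] ContactSpace n)
      ((rayOrientation o).basis ((p, q), 0)) ((rayOrientation o').basis ((p, q), 0))
  have hprod : ((rayOrientation o).basis ((p, q), 0)).det ((rayOrientation o').basis ((p, q), 0)) =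
      (o.basis p).det (o'.basis p) * (o.basis q).det (o'.basis q) := by
    change (((((o.basis p).prod (o.basis q)).reindex finSumFinEquiv).prod
      (Module.Basis.singleton (Fin 1) ℝ : Module.Basis (Fin 1) ℝ ℝ)).reindex finSumFinEquiv).det
        (((((o'.basis p).prod (o'.basis q)).reindex finSumFinEquiv).prod
      (Module.Basis.singleton (Fin 1) ℝ : Module.Basis (Fin 1) ℝ ℝ)).reindex finSumFinEquiv) = _
    refine (Module.Basis.det_reindex_prod _ _ _ _ _).trans ?_
    rw [Module.Basis.det_self, mul_one]
    exact Module.Basis.det_reindex_prod _ _ _ _ _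
  have hunit : (o.basis q).det (o'.basis q) ≠ 0 :=
    ((o.basis q).isUnit_det (o'.basis q)).ne_zero
  rw [hmul, sign_mul, hprod, sign_mul, sign_det_orientation_eq o o' p q, ← sign_mul,
    sign_pos (mul_self_pos.2 hunit), mul_one]

end LinkingDeterminant

/-! ### Linking numbers -/

theorem neg_one_pow_mul_neg_one_pow (n : ℕ) : ((-1) ^ n * (-1) ^ n : ℤ) = 1 := by
  rw [← mul_pow]
  simp

theorem intCast_sign_eq_zero_iff {a : ℝ} : (SignType.sign a : ℤ) = 0 ↔ a = 0 := by
  rw [← sign_eq_zero_iff (a := a)]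
  cases SignType.sign a <;> simp

section RaySets

variable {M : Type*} {n : ℕ}

/-- The map `(p, q, s) ↦ e⁻ˢ (g q - f p)`, whose preimages of `v` are the preimages of the direction
`v` under the Gauss map. -/
def rayMap (f g : M → ContactSpace n) (x : (M × M) × ℝ) : ContactSpace n :=
  Real.exp (-x.2) • (g x.1.2 - f x.1.1)

/-- The map `(p, q, s) ↦ g q - f p - eˢ v`, whose preimages of `-w` are the preimages of the
direction `v` under the Gauss map of `f` and `g + w`. -/
def coneMap (f g : M → ContactSpace n) (v : ContactSpace n) (x : (M × M) × ℝ) : ContactSpace n :=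
  g x.1.2 - f x.1.1 - Real.exp x.2 • v

theorem rayMap_eq_iff {f g : M → ContactSpace n} {v : ContactSpace n} {x : (M × M) × ℝ} :
    rayMap f g x = v ↔ g x.1.2 - f x.1.1 = Real.exp x.2 • v := by
  rw [rayMap, Real.exp_neg]
  exact inv_smul_eq_iff₀ (Real.exp_pos _).ne'

/-- A preimage `(p, q)` of the direction `v` determines `s` in `g q - f p = eˢ v`, so a signed count
over `M × M` can be taken on `M × M × ℝ`. -/
theorem bijOn_fst_of_eq_exp_smul {f g : M → ContactSpace n} {v : ContactSpace n} (hv : v ≠ 0)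
    {S : Set ((M × M) × ℝ)} (hS : ∀ x, x ∈ S ↔ g x.1.2 - f x.1.1 = Real.exp x.2 • v) :
    BijOn Prod.fst S (gaussPreimage f g v) := by
  refine ⟨fun x hx => ⟨Real.exp x.2, Real.exp_pos _, (hS x).1 hx⟩, ?_, ?_⟩
  · rintro ⟨pq, s⟩ hx ⟨pq', s'⟩ hx' h
    obtain rfl : pq = pq' := h
    have := ((hS (pq, s)).1 hx).symm.trans ((hS (pq, s')).1 hx')
    obtain rfl : s = s' := Real.exp_injective (smul_left_injective ℝ hv this)
    rfl
  · rintro pq ⟨c, hc, h⟩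
    exact ⟨(pq, Real.log c), (hS _).2 (by simpa [Real.exp_log hc] using h), rfl⟩

theorem coneMap_eq_iff {f g : M → ContactSpace n} {v w : ContactSpace n} {x : (M × M) × ℝ} :
    coneMap f g v x = -w ↔ g x.1.2 + w - f x.1.1 = Real.exp x.2 • v := by
  have h : g x.1.2 + w - f x.1.1 - Real.exp x.2 • v = coneMap f g v x - -w := by
    unfold coneMap
    abel
  rw [← sub_eq_zero, ← h, sub_eq_zero]

end RaySets

section RayMap

variable {E H : Type*} [NormedAddCommGroup E] [NormedSpace ℝ E] [TopologicalSpace H]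
  {I : ModelWithCorners ℝ E H} {M : Type*} [TopologicalSpace M] [ChartedSpace H M] {n : ℕ}

theorem contMDiff_sub_prod {f g : M → ContactSpace n} (hf : ContMDiff I 𝓘(ℝ, ContactSpace n) 1 f)
    (hg : ContMDiff I 𝓘(ℝ, ContactSpace n) 1 g) :
    ContMDiff ((I.prod I).prod 𝓘(ℝ, ℝ)) 𝓘(ℝ, ContactSpace n) 1
      (fun x : (M × M) × ℝ => g x.1.2 - f x.1.1) :=
  (hg.comp (contMDiff_snd.comp contMDiff_fst)).sub (hf.comp (contMDiff_fst.comp contMDiff_fst))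

theorem contMDiff_rayMap {f g : M → ContactSpace n} (hf : ContMDiff I 𝓘(ℝ, ContactSpace n) 1 f)
    (hg : ContMDiff I 𝓘(ℝ, ContactSpace n) 1 g) :
    ContMDiff ((I.prod I).prod 𝓘(ℝ, ℝ)) 𝓘(ℝ, ContactSpace n) 1 (rayMap f g) := by
  have hexp : ContMDiff ((I.prod I).prod 𝓘(ℝ, ℝ)) 𝓘(ℝ, ℝ) 1
      (fun x : (M × M) × ℝ => Real.exp (-x.2)) :=
    (Real.contDiff_exp.comp contDiff_neg).contMDiff.comp contMDiff_snd
  exact hexp.smul (contMDiff_sub_prod hf hg)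

theorem contMDiff_coneMap {f g : M → ContactSpace n} (hf : ContMDiff I 𝓘(ℝ, ContactSpace n) 1 f)
    (hg : ContMDiff I 𝓘(ℝ, ContactSpace n) 1 g) (v : ContactSpace n) :
    ContMDiff ((I.prod I).prod 𝓘(ℝ, ℝ)) 𝓘(ℝ, ContactSpace n) 1 (coneMap f g v) := by
  have hexp : ContMDiff ((I.prod I).prod 𝓘(ℝ, ℝ)) 𝓘(ℝ, ℝ) 1
      (fun x : (M × M) × ℝ => Real.exp x.2) :=
    Real.contDiff_exp.contMDiff.comp contMDiff_snd
  exact (contMDiff_sub_prod hf hg).sub (hexp.smul contMDiff_const)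

theorem hasVectorDerivAt_sub_prod {f g : M → ContactSpace n}
    (hf : ContMDiff I 𝓘(ℝ, ContactSpace n) 1 f) (hg : ContMDiff I 𝓘(ℝ, ContactSpace n) 1 g)
    (p q : M) (s : ℝ) :
    HasVectorDerivAt ((I.prod I).prod 𝓘(ℝ, ℝ)) (fun x : (M × M) × ℝ => g x.1.2 - f x.1.1)
      (((vectorDeriv I g q).comp (ContinuousLinearMap.snd ℝ E E)).comp
          (ContinuousLinearMap.fst ℝ (E × E) ℝ) -
        ((vectorDeriv I f p).comp (ContinuousLinearMap.fst ℝ E E)).comp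
          (ContinuousLinearMap.fst ℝ (E × E) ℝ)) ((p, q), s) :=
  (((hg.hasVectorDerivAt_vectorDeriv one_ne_zero q).comp_snd p).comp_fst s).sub
    (((hf.hasVectorDerivAt_vectorDeriv one_ne_zero p).comp_fst q).comp_fst s)

theorem vectorDeriv_add_const {W : Type*} [NormedAddCommGroup W] [NormedSpace ℝ W] {g : M → W}
    (hg : ContMDiff I 𝓘(ℝ, W) 1 g) (w : W) (p : M) :
    vectorDeriv I (fun q => g q + w) p = vectorDeriv I g p := by
  have h := hg.hasVectorDerivAt_vectorDeriv one_ne_zero p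
  exact HasVectorDerivAt.vectorDeriv_eq ⟨h.1.add continuousAt_const, h.2.add_const w⟩

theorem linkingDet_add_const [IsManifold I 1 M] (o : ManifoldOrientation I M n)
    {f g : M → ContactSpace n}
    (hg : ContMDiff I 𝓘(ℝ, ContactSpace n) 1 g) (v w : ContactSpace n) (pq : M × M) :
    linkingDet I o f (fun q => g q + w) v pq = linkingDet I o f g v pq := by
  simp only [linkingDet_eq_det, vectorDeriv_add_const hg]

variable [I.Boundaryless] [IsManifold I 1 M] (o : ManifoldOrientation I M n)

/-- The common form of the local degrees of `rayMap` and `coneMap`. -/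
theorem sign_frameJacobian_of_hasVectorDerivAt {f g : M → ContactSpace n} {v : ContactSpace n}
    {G : (M × M) × ℝ → ContactSpace n} {A : (E × E) × ℝ →L[ℝ] ContactSpace n} {p q : M} {s : ℝ}
    (hA : HasVectorDerivAt ((I.prod I).prod 𝓘(ℝ, ℝ)) G A ((p, q), s)) {c c' : ℝ} (hc : 0 < c)
    (hc' : 0 < c') (h₁ : ∀ u, A ((u, 0), 0) = -(c • vectorDeriv I f p u))
    (h₂ : ∀ u, A ((0, u), 0) = c • vectorDeriv I g q u) (h₃ : A ((0, 0), 1) = -(c' • v)) :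
    (SignType.sign (frameJacobian (rayOrientation o) (contactBasis n) G ((p, q), s)) : ℤ) =
      (-1) ^ (n + 1) * SignType.sign (linkingDet I o f g v (p, q)) := by
  refine Eq.trans ?_ (sign_det_comp_rayOrientation o f g v p q s hc hc' A h₁ h₂ h₃)
  have : frameJacobian (rayOrientation o) (contactBasis n) G ((p, q), s) =
      (contactBasis n).det fun i => A ((rayOrientation o).basis ((p, q), s) i) :=
    congrArg (contactBasis n).det (funext fun i => hA.mfderiv_apply _)
  rw [this]

theorem sign_frameJacobian_rayMap {f g : M → ContactSpace n}
    (hf : ContMDiff I 𝓘(ℝ, ContactSpace n) 1 f) (hg : ContMDiff I 𝓘(ℝ, ContactSpace n) 1 g)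
    {v : ContactSpace n} {x : (M × M) × ℝ} (hx : rayMap f g x = v) :
    (SignType.sign (frameJacobian (rayOrientation o) (contactBasis n) (rayMap f g) x) : ℤ) =
      (-1) ^ (n + 1) * SignType.sign (linkingDet I o f g v x.1) := by
  obtain ⟨⟨p, q⟩, s⟩ := x
  have hs : HasVectorDerivAt ((I.prod I).prod 𝓘(ℝ, ℝ)) (fun x : (M × M) × ℝ => x.2)
      ((ContinuousLinearMap.id ℝ ℝ).comp (ContinuousLinearMap.snd ℝ (E × E) ℝ)) ((p, q), s) :=
    (hasVectorDerivAt_id s).comp_snd (p, q)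
  have hexp : HasFDerivAt (fun t : ℝ => Real.exp (-t))
      (ContinuousLinearMap.toSpanSingleton ℝ (-Real.exp (-s))) s := by
    have := ((hasDerivAt_neg s).exp).hasFDerivAt
    simpa using this
  have hA := (HasFDerivAt.comp_hasVectorDerivAt (x := ((p, q), s)) hexp hs).smul
    (hasVectorDerivAt_sub_prod hf hg p q s)
  refine sign_frameJacobian_of_hasVectorDerivAt o hA (Real.exp_pos (-s)) one_pos (fun u => ?_)
    (fun u => ?_) ?_
  · simp
  · simp
  · rw [← hx]
    simp [rayMap]

theorem sign_frameJacobian_coneMap {f g : M → ContactSpace n}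
    (hf : ContMDiff I 𝓘(ℝ, ContactSpace n) 1 f) (hg : ContMDiff I 𝓘(ℝ, ContactSpace n) 1 g)
    (v : ContactSpace n) (x : (M × M) × ℝ) :
    (SignType.sign (frameJacobian (rayOrientation o) (contactBasis n) (coneMap f g v) x) : ℤ) =
      (-1) ^ (n + 1) * SignType.sign (linkingDet I o f g v x.1) := by
  obtain ⟨⟨p, q⟩, s⟩ := x
  have hs : HasVectorDerivAt ((I.prod I).prod 𝓘(ℝ, ℝ)) (fun x : (M × M) × ℝ => x.2)
      ((ContinuousLinearMap.id ℝ ℝ).comp (ContinuousLinearMap.snd ℝ (E × E) ℝ)) ((p, q), s) :=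
    (hasVectorDerivAt_id s).comp_snd (p, q)
  have hexp : HasFDerivAt (fun t : ℝ => Real.exp t • v)
      (ContinuousLinearMap.toSpanSingleton ℝ (Real.exp s • v)) s :=
    ((Real.hasDerivAt_exp s).smul_const v).hasFDerivAt
  have hA := (hasVectorDerivAt_sub_prod hf hg p q s).sub
    (HasFDerivAt.comp_hasVectorDerivAt (x := ((p, q), s)) hexp hs)
  refine sign_frameJacobian_of_hasVectorDerivAt o hA one_pos (Real.exp_pos s) (fun u => ?_)
    (fun u => ?_) ?_
  · simp
  · simp
  · simp

/-- The signed number of preimages of the direction `v` under the Gauss map. -/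
def gaussCount (o : ManifoldOrientation I M n) (f g : M → ContactSpace n)
    (v : ContactSpace n) : ℤ :=
  ∑ᶠ pq ∈ gaussPreimage f g v, (SignType.sign (linkingDet I o f g v pq) : ℤ)

/-- The direction `v` is a regular value of the Gauss map. -/
def IsRegularDirection (o : ManifoldOrientation I M n) (f g : M → ContactSpace n)
    (v : ContactSpace n) : Prop :=
  v ≠ 0 ∧ ∀ pq ∈ gaussPreimage f g v, linkingDet I o f g v pq ≠ 0

/-- The signed count in the direction `v` as a signed count for `rayMap`, in which the direction is
the value. It serves to vary the direction. -/
theorem signedCount_rayMap {f g : M → ContactSpace n} (hf : ContMDiff I 𝓘(ℝ, ContactSpace n) 1 f)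
    (hg : ContMDiff I 𝓘(ℝ, ContactSpace n) 1 g) {v : ContactSpace n} (hv : v ≠ 0) :
    gaussCount o f g v =
      (-1) ^ (n + 1) * signedCount (rayOrientation o) (contactBasis n) (rayMap f g) v := by
  unfold gaussCount signedCount
  rw [mul_finsum_mem]
  refine (finsum_mem_eq_of_bijOn Prod.fst
    (bijOn_fst_of_eq_exp_smul hv fun x => rayMap_eq_iff) fun x hx => ?_).symm
  rw [sign_frameJacobian_rayMap o hf hg hx, ← mul_assoc, neg_one_pow_mul_neg_one_pow, one_mul]

/-- The signed count in the direction `v` as a signed count for `coneMap`, in which the translation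
vector `w` of `g` is the value. It serves to vary the translation. -/
theorem signedCount_coneMap {f g : M → ContactSpace n} (hf : ContMDiff I 𝓘(ℝ, ContactSpace n) 1 f)
    (hg : ContMDiff I 𝓘(ℝ, ContactSpace n) 1 g) {v : ContactSpace n} (hv : v ≠ 0)
    (w : ContactSpace n) :
    gaussCount o f (fun q => g q + w) v =
      (-1) ^ (n + 1) * signedCount (rayOrientation o) (contactBasis n) (coneMap f g v) (-w) := by
  unfold gaussCount signedCount
  rw [mul_finsum_mem]
  refine (finsum_mem_eq_of_bijOn Prod.fst
    (bijOn_fst_of_eq_exp_smul hv fun x => coneMap_eq_iff) fun x hx => ?_).symm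
  rw [sign_frameJacobian_coneMap o hf hg, ← mul_assoc, neg_one_pow_mul_neg_one_pow, one_mul,
    linkingDet_add_const o hg]

/-- A direction is regular iff it is a regular value of `rayMap`: the two conditions test the same
determinant. -/
theorem isRegularDirection_iff {f g : M → ContactSpace n}
    (hf : ContMDiff I 𝓘(ℝ, ContactSpace n) 1 f) (hg : ContMDiff I 𝓘(ℝ, ContactSpace n) 1 g)
    {v : ContactSpace n} (hv : v ≠ 0) :
    IsRegularDirection o f g v ↔ ∀ x, rayMap f g x = v →
      frameJacobian (rayOrientation o) (contactBasis n) (rayMap f g) x ≠ 0 := by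
  have hsign : ∀ x, rayMap f g x = v →
      (frameJacobian (rayOrientation o) (contactBasis n) (rayMap f g) x = 0 ↔
        linkingDet I o f g v x.1 = 0) := fun x hx => by
    have h := sign_frameJacobian_rayMap o hf hg hx
    rw [← intCast_sign_eq_zero_iff, h, mul_eq_zero, intCast_sign_eq_zero_iff]
    simp
  have hbij := bijOn_fst_of_eq_exp_smul hv (f := f) (g := g) (S := rayMap f g ⁻¹' {v})
    fun x => rayMap_eq_iff
  constructor
  · intro h x hx h0
    exact h.2 x.1 (hbij.mapsTo hx) ((hsign x hx).1 h0)
  · refine fun h => ⟨hv, fun pq hpq h0 => ?_⟩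
    obtain ⟨x, hx, rfl⟩ := hbij.surjOn hpq
    exact h x hx ((hsign x hx).2 h0)

theorem frameJacobian_coneMap_ne_zero {f g : M → ContactSpace n}
    (hf : ContMDiff I 𝓘(ℝ, ContactSpace n) 1 f) (hg : ContMDiff I 𝓘(ℝ, ContactSpace n) 1 g)
    {v w : ContactSpace n} (h : IsRegularDirection o f (fun q => g q + w) v) (x : (M × M) × ℝ)
    (hx : coneMap f g v x = -w) :
    frameJacobian (rayOrientation o) (contactBasis n) (coneMap f g v) x ≠ 0 := by
  intro h0
  have hs := sign_frameJacobian_coneMap o hf hg v x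
  have hne := h.2 x.1 ⟨Real.exp x.2, Real.exp_pos _, coneMap_eq_iff.1 hx⟩
  rw [linkingDet_add_const o hg] at hne
  rw [h0, sign_zero, SignType.coe_zero, zero_eq_mul] at hs
  rcases hs with hs | hs
  · exact pow_ne_zero _ (by norm_num) hs
  · exact hne (intCast_sign_eq_zero_iff.1 hs)

end RayMap

section LinkingNumber

variable {E H : Type*} [NormedAddCommGroup E] [NormedSpace ℝ E] [TopologicalSpace H]
  {I : ModelWithCorners ℝ E H} {M : Type*} [TopologicalSpace M] [ChartedSpace H M] {n : ℕ}

theorem isCompact_of_snd_bounded {X : Type*} [TopologicalSpace X] [CompactSpace X]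
    {S : Set (X × ℝ)} (hS : IsClosed S) {C : ℝ} (hC : ∀ x ∈ S, |x.2| ≤ C) : IsCompact S :=
  (isCompact_univ.prod (isCompact_Icc (a := -C) (b := C))).of_isClosed_subset hS
    fun x hx => ⟨mem_univ _, abs_le.1 (hC x hx)⟩

/-- `rayMap` is proper away from the origin: `s` is a difference of the logarithms of the norms of
`g q - f p` and of the value, which are both bounded. -/
theorem isCompact_preimage_rayMap [CompactSpace M] {f g : M → ContactSpace n} (hf : Continuous f)
    (hg : Continuous g) (hdisj : Disjoint (range f) (range g)) {K : Set (ContactSpace n)}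
    (hK : IsCompact K) (h0 : (0 : ContactSpace n) ∉ K) : IsCompact (rayMap f g ⁻¹' K) := by
  have hne : ∀ x : M × M, ‖g x.2 - f x.1‖ ≠ 0 := fun x => by
    rw [norm_ne_zero_iff, sub_ne_zero]
    exact fun h => disjoint_left.1 hdisj (mem_range_self x.1) (h ▸ mem_range_self x.2)
  have hD : Continuous fun x : M × M => g x.2 - f x.1 :=
    (hg.comp continuous_snd).sub (hf.comp continuous_fst)
  obtain ⟨C, hC⟩ := isCompact_univ.exists_bound_of_continuousOn
    (hD.norm.log hne).continuousOn
  have hlog : ContinuousOn (fun y : ContactSpace n => Real.log ‖y‖) K :=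
    continuous_norm.continuousOn.log fun y hy => norm_ne_zero_iff.2 fun h => h0 (h ▸ hy)
  obtain ⟨C', hC'⟩ := hK.exists_bound_of_continuousOn hlog
  have hcont : Continuous (rayMap f g) :=
    (Real.continuous_exp.comp continuous_snd.neg).smul (hD.comp continuous_fst)
  refine isCompact_of_snd_bounded (C := C + C') (hK.isClosed.preimage hcont) fun x hx => ?_
  have h₁ := hC x.1 (mem_univ _)
  have h₂ := hC' _ hx
  have h₃ : Real.log ‖rayMap f g x‖ = -x.2 + Real.log ‖g x.1.2 - f x.1.1‖ := by
    rw [rayMap, norm_smul, Real.log_mul (by simp) (hne x.1), Real.norm_eq_abs, Real.log_abs,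
      Real.log_exp]
  rw [Real.norm_eq_abs] at h₁ h₂
  rw [h₃] at h₂
  rw [abs_le] at *
  constructor <;> linarith [h₁.1, h₁.2, h₂.1, h₂.2]

/-- `coneMap` is proper away from the differences `g q - f p`: if `y` is the value, `eˢ ‖v‖` is the
norm of `g q - f p - y`, which is bounded above and away from `0`. -/
theorem isCompact_preimage_coneMap [CompactSpace M] {f g : M → ContactSpace n} (hf : Continuous f)
    (hg : Continuous g) {v : ContactSpace n} (hv : v ≠ 0) {K : Set (ContactSpace n)}
    (hK : IsCompact K) (hne : ∀ p q, g q - f p ∉ K) : IsCompact (coneMap f g v ⁻¹' K) := by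
  have hD : Continuous fun x : M × M => g x.2 - f x.1 :=
    (hg.comp continuous_snd).sub (hf.comp continuous_fst)
  have hlog : ContinuousOn (fun x : (M × M) × ContactSpace n =>
      Real.log ‖g x.1.2 - f x.1.1 - x.2‖) (univ ×ˢ K) := by
    refine ((hD.comp continuous_fst).sub continuous_snd).norm.continuousOn.log fun x hx => ?_
    refine norm_ne_zero_iff.2 (sub_ne_zero.2 fun h => hne x.1.1 x.1.2 ?_)
    have : g x.1.2 - f x.1.1 = x.2 := h
    exact this ▸ hx.2
  obtain ⟨C, hC⟩ := (isCompact_univ.prod hK).exists_bound_of_continuousOn hlog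
  have hcont : Continuous (coneMap f g v) :=
    (hD.comp continuous_fst).sub ((Real.continuous_exp.comp continuous_snd).smul continuous_const)
  refine isCompact_of_snd_bounded (C := C + |Real.log ‖v‖|) (hK.isClosed.preimage hcont)
    fun x hx => ?_
  have h₁ := hC (x.1, coneMap f g v x) ⟨mem_univ _, hx⟩
  have h₂ : g x.1.2 - f x.1.1 - coneMap f g v x = Real.exp x.2 • v := by
    rw [coneMap]
    abel
  dsimp only at h₁
  rw [h₂, norm_smul, Real.log_mul (by simp) (norm_ne_zero_iff.2 hv), Real.norm_eq_abs,
    Real.norm_eq_abs, Real.log_abs, Real.log_exp] at h₁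
  have h₃ := abs_sub_abs_le_abs_sub x.2 (-Real.log ‖v‖)
  rw [sub_neg_eq_add, abs_neg] at h₃
  linarith

/-- Equality of dimensions lets the degree theory of maps to the model space apply. -/
theorem nonempty_continuousLinearEquiv_contactSpace [IsManifold I 1 M]
    [FiniteDimensional ℝ E] {p : M} (o : ManifoldOrientation I M n) :
    Nonempty (ContactSpace n ≃L[ℝ] (E × E) × ℝ) := by
  have hE : Module.finrank ℝ E = n := by simpa using Module.finrank_eq_card_basis (o.basis p)
  refine FiniteDimensional.nonempty_continuousLinearEquiv_of_finrank_eq ?_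
  simp [hE]
  ring

variable [I.Boundaryless] [IsManifold I ∞ M] [FiniteDimensional ℝ E]
  (o : ManifoldOrientation I M n)

theorem finite_gaussPreimage [T2Space M] [CompactSpace M] [Nonempty M] {f g : M → ContactSpace n}
    (hf : ContMDiff I 𝓘(ℝ, ContactSpace n) 1 f) (hg : ContMDiff I 𝓘(ℝ, ContactSpace n) 1 g)
    (hdisj : Disjoint (range f) (range g)) {v : ContactSpace n}
    (hv : IsRegularDirection o f g v) : (gaussPreimage f g v).Finite := by
  obtain ⟨L⟩ := nonempty_continuousLinearEquiv_contactSpace (p := Classical.arbitrary M) o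
  rw [← (bijOn_fst_of_eq_exp_smul hv.1 (f := f) (g := g) (S := rayMap f g ⁻¹' {v})
    fun x => rayMap_eq_iff).image_eq]
  refine Finite.image _ ?_
  exact finite_preimage_of_isCompact_of_equiv (contactBasis n) (rayOrientation o) L
    (contMDiff_rayMap hf hg) (isCompact_preimage_rayMap hf.continuous hg.continuous hdisj
      isCompact_singleton fun h => hv.1 (mem_singleton_iff.1 h).symm) Subset.rfl
    ((isRegularDirection_iff o hf hg hv.1).1 hv)

/-- The signed count of preimages is the same for all regular directions. -/
theorem gaussCount_eq [T2Space M] [CompactSpace M] [Nonempty M] (hn : n ≠ 0)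
    {f g : M → ContactSpace n}
    (hf : ContMDiff I 𝓘(ℝ, ContactSpace n) 1 f) (hg : ContMDiff I 𝓘(ℝ, ContactSpace n) 1 g)
    (hdisj : Disjoint (range f) (range g)) {v w : ContactSpace n}
    (hv : IsRegularDirection o f g v) (hw : IsRegularDirection o f g w) :
    gaussCount o f g v = gaussCount o f g w := by
  obtain ⟨L⟩ := nonempty_continuousLinearEquiv_contactSpace (p := Classical.arbitrary M) o
  have hrank : 1 < Module.finrank ℝ (ContactSpace n) := by
    simp
    omega
  have : Nontrivial (ContactSpace n) := Module.nontrivial_of_finrank_pos (R := ℝ) (by omega)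
  rw [signedCount_rayMap o hf hg hv.1, signedCount_rayMap o hf hg hw.1]
  congr 1
  refine signedCount_eq_of_isPreconnected_of_equiv (contactBasis n) (rayOrientation o) L
    (contMDiff_rayMap hf hg) (O := {0}ᶜ)
    (isConnected_compl_singleton_of_one_lt_rank ?_ 0).isPreconnected
    (fun y hy => ?_) hv.1 hw.1 ((isRegularDirection_iff o hf hg hv.1).1 hv)
    ((isRegularDirection_iff o hf hg hw.1).1 hw)
  · rw [← Module.finrank_eq_rank]
    exact_mod_cast hrank
  · obtain ⟨K, hK, hKs, hKc⟩ := local_compact_nhds (isOpen_compl_singleton.mem_nhds hy)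
    exact ⟨K, hK, isCompact_preimage_rayMap hf.continuous hg.continuous hdisj hKc
      fun h => hKs h rfl⟩

/-- The linking number exists, and any one regular direction computes it. -/
theorem isLinkingNumber_iff [T2Space M] [CompactSpace M] [Nonempty M] (hn : n ≠ 0)
    {f g : M → ContactSpace n}
    (hf : ContMDiff I 𝓘(ℝ, ContactSpace n) 1 f) (hg : ContMDiff I 𝓘(ℝ, ContactSpace n) 1 g)
    (hdisj : Disjoint (range f) (range g)) {v : ContactSpace n}
    (hv : IsRegularDirection o f g v) (k : ℤ) :
    IsLinkingNumber I o f g k ↔ k = -gaussCount o f g v := by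
  constructor
  · exact fun h => (h.2 v hv.1 hv.2).2
  · rintro rfl
    refine ⟨hdisj, fun w hw hwr => ⟨finite_gaussPreimage o hf hg hdisj ⟨hw, hwr⟩, ?_⟩⟩
    rw [gaussCount_eq o hn hf hg hdisj hv ⟨hw, hwr⟩]
    rfl

/-- Sard's theorem: near any direction there is one that the linear isomorphisms `R i` move to
regular directions of the pairs `f i`, `g i`. -/
theorem exists_isRegularDirection [CompactSpace M] [Nonempty M] {ι : Type*} [Countable ι]
    {f g : ι → M → ContactSpace n} (hf : ∀ i, ContMDiff I 𝓘(ℝ, ContactSpace n) 1 (f i))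
    (hg : ∀ i, ContMDiff I 𝓘(ℝ, ContactSpace n) 1 (g i))
    (hdisj : ∀ i, Disjoint (range (f i)) (range (g i)))
    (R : ι → ContactSpace n ≃L[ℝ] ContactSpace n) {v : ContactSpace n} (hv : v ≠ 0)
    {N : Set (ContactSpace n)} (hN : N ∈ 𝓝 v) :
    ∃ w ∈ N, ∀ i, IsRegularDirection o (f i) (g i) (R i w) := by
  obtain ⟨L⟩ := nonempty_continuousLinearEquiv_contactSpace (p := Classical.arbitrary M) o
  obtain ⟨K, hK, hKs, hKc⟩ := local_compact_nhds (isOpen_compl_singleton.mem_nhds hv)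
  have hG : ∀ i, ContMDiff ((I.prod I).prod 𝓘(ℝ, ℝ)) 𝓘(ℝ, ContactSpace n) 1
      (fun x => (R i).symm (rayMap (f i) (g i) x)) := fun i =>
    (contMDiff_rayMap (hf i) (hg i)).continuousLinearEquiv_comp (R i).symm
  have hKG : ∀ i, IsCompact ((fun x => (R i).symm (rayMap (f i) (g i) x)) ⁻¹' K) := fun i => by
    have : (fun x => (R i).symm (rayMap (f i) (g i) x)) ⁻¹' K =
        rayMap (f i) (g i) ⁻¹' (R i '' K) := by
      ext x
      simp only [mem_preimage, mem_image]
      exact ⟨fun h => ⟨_, h, by simp⟩, by rintro ⟨y, hy, h⟩; rw [← h]; simpa using hy⟩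
    rw [this]
    refine isCompact_preimage_rayMap (hf i).continuous (hg i).continuous (hdisj i)
      (hKc.image (R i).continuous) ?_
    rintro ⟨y, hy, h⟩
    exact hKs hy (by simpa using h)
  obtain ⟨w, ⟨hwN, hwK⟩, hw⟩ := exists_regular_value_of_equiv (contactBasis n) (rayOrientation o) L
    hG hK hKG (inter_mem hN hK)
  refine ⟨w, hwN, fun i => ?_⟩
  have hw0 : R i w ≠ 0 := fun h => hKs hwK (by simpa using h)
  refine (isRegularDirection_iff o (hf i) (hg i) hw0).2 fun x hx h0 => ?_
  refine hw i x (by rw [hx, ContinuousLinearEquiv.symm_apply_apply]) ?_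
  rw [← frameJacobian_equiv (contactBasis n) (rayOrientation o) (R i) (hG i)]
  simp only [ContinuousLinearEquiv.apply_symm_apply]
  exact (Module.Basis.det_eq_det_mul_det _ (contactBasis n) _).trans
    (mul_eq_zero_of_right _ h0)

/-- The signed count of preimages of a direction is unchanged when `g` is translated by the vectors
of a connected set for which the translates stay disjoint from the image of `f`. -/
theorem gaussCount_add_const_eq [T2Space M] [CompactSpace M] [Nonempty M]
    {f g : M → ContactSpace n}
    (hf : ContMDiff I 𝓘(ℝ, ContactSpace n) 1 f) (hg : ContMDiff I 𝓘(ℝ, ContactSpace n) 1 g)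
    {S : Set (ContactSpace n)} (hS : IsPreconnected S)
    (hdisj : ∀ w ∈ S, Disjoint (range f) (range fun q => g q + w)) {v w w' : ContactSpace n}
    (hw : w ∈ S) (hw' : w' ∈ S) (hv : IsRegularDirection o f (fun q => g q + w) v)
    (hv' : IsRegularDirection o f (fun q => g q + w') v) :
    gaussCount o f (fun q => g q + w) v = gaussCount o f (fun q => g q + w') v := by
  obtain ⟨L⟩ := nonempty_continuousLinearEquiv_contactSpace (p := Classical.arbitrary M) o
  have : Nontrivial (ContactSpace n) := Module.nontrivial_of_finrank_pos (R := ℝ) (by simp)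
  rw [signedCount_coneMap o hf hg hv.1, signedCount_coneMap o hf hg hv.1]
  congr 1
  refine signedCount_eq_of_isPreconnected_of_equiv (contactBasis n) (rayOrientation o) L
    (contMDiff_coneMap hf hg v) (O := Neg.neg '' S)
    (hS.image _ continuous_neg.continuousOn) ?_ (mem_image_of_mem _ hw) (mem_image_of_mem _ hw')
    (fun x => frameJacobian_coneMap_ne_zero o hf hg hv x)
    (fun x => frameJacobian_coneMap_ne_zero o hf hg hv' x)
  rintro _ ⟨u, hu, rfl⟩
  have hcl : IsClosed (range fun x : M × M => g x.2 - f x.1) :=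
    (isCompact_range ((hg.continuous.comp continuous_snd).sub
      (hf.continuous.comp continuous_fst))).isClosed
  have hmem : -u ∈ (range fun x : M × M => g x.2 - f x.1)ᶜ := by
    rintro ⟨x, hx⟩
    refine disjoint_left.1 (hdisj u hu) (mem_range_self x.1) ⟨x.2, ?_⟩
    rw [sub_eq_iff_eq_add] at hx
    simp only [hx]
    abel
  obtain ⟨K, hK, hKs, hKc⟩ := local_compact_nhds (hcl.isOpen_compl.mem_nhds hmem)
  exact ⟨K, hK, isCompact_preimage_coneMap hf.continuous hg.continuous hv.1 hKc
    fun p q h => hKs h ⟨(p, q), rfl⟩⟩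

end LinkingNumber

/-! ### The Thurston–Bennequin number -/

section ThurstonBennequin

theorem ContactSpace.reebShift_eq_add {n : ℕ} (ε : ℝ) (w : ContactSpace n) :
    reebShift ε w = w + (0, 0, ε) := by
  simp [reebShift, Prod.ext_iff]

/-- A translate by less than the length of every Reeb chord is disjoint from the original. -/
theorem exists_forall_disjoint_reebShift {M : Type*} {n : ℕ} {f : M → ContactSpace n}
    (h : (reebChords f).Finite) :
    ∃ δ : ℝ, 0 < δ ∧ ∀ ε ∈ Ioo 0 δ, Disjoint (range f) (range fun p => reebShift ε (f p)) := by
  let S : Set ℝ := (fun pq : M × M => (f pq.2).2.2 - (f pq.1).2.2) '' reebChords f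
  have h0 : (0 : ℝ) ∉ S := by
    rintro ⟨pq, ⟨ℓ, hℓ, hpq⟩, h0⟩
    dsimp only at h0
    rw [hpq, reebShift] at h0
    simp only [add_sub_cancel_left] at h0
    exact hℓ.ne' h0
  have hS : Sᶜ ∈ 𝓝[>] (0 : ℝ) :=
    mem_nhdsWithin_of_mem_nhds ((h.image _).isClosed.isOpen_compl.mem_nhds h0)
  obtain ⟨δ, hδ, hsub⟩ := mem_nhdsGT_iff_exists_Ioo_subset.1 hS
  refine ⟨δ, hδ, fun ε hε => disjoint_left.2 ?_⟩
  rintro _ ⟨q, rfl⟩ ⟨p, hp⟩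
  refine hsub hε ⟨(p, q), ⟨ε, hε.1, hp.symm⟩, ?_⟩
  simp [← hp, reebShift]

variable {E H : Type*} [NormedAddCommGroup E] [NormedSpace ℝ E] [TopologicalSpace H]
  {I : ModelWithCorners ℝ E H} {M : Type*} [TopologicalSpace M] [ChartedSpace H M] {n : ℕ}
  [I.Boundaryless] [IsManifold I ∞ M]

theorem gaussCount_congr_orientation [ConnectedSpace M] (o o' : ManifoldOrientation I M n)
    (f g : M → ContactSpace n) (v : ContactSpace n) :
    gaussCount o' f g v = gaussCount o f g v :=
  finsum_mem_congr rfl fun pq _ => sign_linkingDet_congr o o' f g v pq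

theorem IsRegularDirection.congr_orientation [ConnectedSpace M] {o : ManifoldOrientation I M n}
    (o' : ManifoldOrientation I M n) {f g : M → ContactSpace n} {v : ContactSpace n}
    (h : IsRegularDirection o f g v) : IsRegularDirection o' f g v := by
  refine ⟨h.1, fun pq hpq h0 => h.2 pq hpq ?_⟩
  rwa [← intCast_sign_eq_zero_iff, sign_linkingDet_congr o o' f g v pq,
    intCast_sign_eq_zero_iff] at h0

/-- The Thurston–Bennequin number exists, and is computed by any one translation `ε₀` shorter than
all Reeb chords, any one regular direction, and any one orientation. -/
theorem isThurstonBennequinNumber_iff [FiniteDimensional ℝ E] [T2Space M] [CompactSpace M]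
    [ConnectedSpace M] (o : ManifoldOrientation I M n) (hn : n ≠ 0) {f : M → ContactSpace n}
    (hf : ContMDiff I 𝓘(ℝ, ContactSpace n) 1 f) {δ : ℝ}
    (hdisj : ∀ ε ∈ Ioo 0 δ, Disjoint (range f) (range fun p => reebShift ε (f p)))
    {ε₀ : ℝ} (hε₀ : ε₀ ∈ Ioo 0 δ) {v : ContactSpace n}
    (hv : IsRegularDirection o f (fun p => reebShift ε₀ (f p)) v) (k : ℤ) :
    IsThurstonBennequinNumber I f k ↔
      k = -gaussCount o f (fun p => reebShift ε₀ (f p)) v := by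
  have hshift : ∀ ε, (fun p => reebShift ε (f p)) = fun p => f p + (0, 0, ε) := fun ε =>
    funext fun p => reebShift_eq_add ε (f p)
  have hsmooth : ∀ ε, ContMDiff I 𝓘(ℝ, ContactSpace n) 1 fun p => reebShift ε (f p) := fun ε => by
    rw [hshift]
    exact hf.add contMDiff_const
  have key : ∀ (o' : ManifoldOrientation I M n), ∀ ε ∈ Ioo 0 δ,
      (IsLinkingNumber I o' f (fun p => reebShift ε (f p)) k ↔
        k = -gaussCount o f (fun p => reebShift ε₀ (f p)) v) := by
    intro o' ε hε
    -- a direction that is regular for both translates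
    obtain ⟨w, -, hw⟩ := exists_isRegularDirection o (ι := Bool) (f := fun _ => f)
      (g := fun i p => reebShift (if i then ε else ε₀) (f p)) (fun _ => hf) (fun i => hsmooth _)
      (fun i => by cases i <;> simp [hdisj _ hε, hdisj _ hε₀])
      (fun _ => ContinuousLinearEquiv.refl ℝ _) hv.1 univ_mem
    have hwε : IsRegularDirection o f (fun p => reebShift ε (f p)) w := by simpa using hw true
    have hwε₀ : IsRegularDirection o f (fun p => reebShift ε₀ (f p)) w := by simpa using hw false
    rw [isLinkingNumber_iff o' hn hf (hsmooth ε) (hdisj ε hε) (hwε.congr_orientation o'),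
      gaussCount_congr_orientation o o',
      ← gaussCount_eq o hn hf (hsmooth ε₀) (hdisj ε₀ hε₀) hwε₀ hv]
    have hconst : gaussCount o f (fun p => reebShift ε (f p)) w =
        gaussCount o f (fun p => reebShift ε₀ (f p)) w := by
      rw [hshift] at hwε hwε₀ ⊢
      rw [hshift]
      refine gaussCount_add_const_eq o hf hf (S := (fun t : ℝ => (0, 0, t)) '' Ioo 0 δ)
        (isPreconnected_Ioo.image _ (by fun_prop)) ?_ (mem_image_of_mem _ hε)
        (mem_image_of_mem _ hε₀) hwε hwε₀
      rintro _ ⟨t, ht, rfl⟩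
      rw [← hshift]
      exact hdisj t ht
    rw [hconst]
  constructor
  · rintro ⟨-, h⟩
    obtain ⟨ε, hlink, hε⟩ := ((h o).and (Ioo_mem_nhdsGT (hε₀.1.trans hε₀.2))).exists
    exact (key o ε hε).1 hlink
  · intro h
    refine ⟨⟨o⟩, fun o' => ?_⟩
    filter_upwards [Ioo_mem_nhdsGT (hε₀.1.trans hε₀.2)] with ε hε
    exact (key o' ε hε).2 h

end ThurstonBennequin

/-! ### Front spinning of points -/

section FrontSpin

variable {M : Type*} {n m : ℕ}

theorem UnitSphere.sum_sq (σ : UnitSphere m) : ∑ i, σ.1 i ^ 2 = 1 := by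
  have h : ‖σ.1‖ = 1 := by simp
  rw [← EuclideanSpace.real_norm_sq_eq, h, one_pow]

theorem UnitSphere.eq_of_pos_mul_eq {σ σ' : UnitSphere m} {a b : ℝ} (ha : 0 < a) (hb : 0 < b)
    (h : ∀ i, a * σ.1 i = b * σ'.1 i) : σ = σ' ∧ a = b := by
  have hsq : a ^ 2 = b ^ 2 := by
    have h1 : ∑ i, (a * σ.1 i) ^ 2 = ∑ i, (b * σ'.1 i) ^ 2 := by simp only [h]
    simpa only [mul_pow, ← Finset.mul_sum, UnitSphere.sum_sq, mul_one] using h1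
  have hab : a = b := (pow_left_inj₀ ha.le hb.le two_ne_zero).1 hsq
  subst hab
  refine ⟨Subtype.ext (PiLp.ext fun i => mul_left_cancel₀ ha.ne' (h i)), rfl⟩

theorem UnitSphere.mul_right_cancel {σ : UnitSphere m} {a b : ℝ}
    (h : ∀ i, a * σ.1 i = b * σ.1 i) : a = b := by
  have h1 : ∑ i, a * σ.1 i * σ.1 i = ∑ i, b * σ.1 i * σ.1 i := by simp only [h]
  simpa only [mul_assoc, ← Finset.mul_sum, ← sq, UnitSphere.sum_sq, mul_one] using h1

/-- The Reeb chords of the spinning are those of `f`, with one copy for each point of the sphere. -/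
theorem frontSpin_eq_reebShift_iff {c : ℝ} {f : M → ContactSpace (n + 1)}
    (hc : ∀ p, 0 < (f p).1 0 + c) (ε : ℝ) (p q : M) (σ τ : UnitSphere m) :
    frontSpin m c f (q, τ) = reebShift ε (frontSpin m c f (p, σ)) ↔
      τ = σ ∧ f q = reebShift ε (f p) := by
  constructor
  · intro h
    have hx : ∀ i, ((f q).1 0 + c) * τ.1 i = ((f p).1 0 + c) * σ.1 i := fun i => by
      simpa [frontSpin, reebShift] using congrFun (congrArg Prod.fst h) (Fin.castAdd n i)
    have hx' : ∀ j : Fin n, (f q).1 j.succ = (f p).1 j.succ := fun j => by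
      simpa [frontSpin, reebShift] using congrFun (congrArg Prod.fst h) (Fin.natAdd (m + 1) j)
    have hy : ∀ i, (f q).2.1 0 * τ.1 i = (f p).2.1 0 * σ.1 i := fun i => by
      simpa [frontSpin, reebShift] using congrFun (congrArg (fun w => w.2.1) h) (Fin.castAdd n i)
    have hy' : ∀ j : Fin n, (f q).2.1 j.succ = (f p).2.1 j.succ := fun j => by
      simpa [frontSpin, reebShift] using
        congrFun (congrArg (fun w => w.2.1) h) (Fin.natAdd (m + 1) j)
    have hz : (f q).2.2 = (f p).2.2 + ε := congrArg (fun w => w.2.2) h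
    obtain ⟨rfl, hx0⟩ := UnitSphere.eq_of_pos_mul_eq (hc q) (hc p) hx
    have hy0 := UnitSphere.mul_right_cancel hy
    refine ⟨rfl, Prod.ext (funext fun i => ?_) (Prod.ext (funext fun i => ?_) hz)⟩
    · exact Fin.cases (add_right_cancel hx0) hx' i
    · exact Fin.cases hy0 hy' i
  · rintro ⟨rfl, h⟩
    simp [frontSpin, h, reebShift]

theorem frontSpin_injective {c : ℝ} {f : M → ContactSpace (n + 1)}
    (hc : ∀ p, 0 < (f p).1 0 + c) (hf : Function.Injective f) :
    Function.Injective (frontSpin m c f) := by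
  rintro ⟨q, τ⟩ ⟨p, σ⟩ h
  have h0 : ∀ {k : ℕ} (w : ContactSpace k), reebShift 0 w = w := fun w => by
    simp [reebShift]
  rw [← h0 (frontSpin m c f (p, σ)), frontSpin_eq_reebShift_iff hc, h0] at h
  rw [h.1, hf h.2]

theorem disjoint_frontSpin_reebShift {c : ℝ} {f : M → ContactSpace (n + 1)}
    (hc : ∀ p, 0 < (f p).1 0 + c) {ε : ℝ}
    (h : Disjoint (range f) (range fun p => reebShift ε (f p))) :
    Disjoint (range (frontSpin m c f)) (range fun x => reebShift ε (frontSpin m c f x)) := by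
  refine disjoint_left.2 ?_
  rintro _ ⟨⟨q, τ⟩, rfl⟩ ⟨⟨p, σ⟩, hp⟩
  exact disjoint_left.1 h (mem_range_self q)
    ⟨p, ((frontSpin_eq_reebShift_iff hc ε p q σ τ).1 hp.symm).2.symm⟩

end FrontSpin

/-! ### The differential of the front spinning -/

section Spin

variable {n m : ℕ}

/-- The front spinning of a point `w` to the direction `s`, as a map between vector spaces. -/
def spinPoint (c : ℝ) (x : ContactSpace (n + 1) × EuclideanSpace ℝ (Fin (m + 1))) :
    ContactSpace (m + 1 + n) :=
  (Fin.append (fun i => (x.1.1 0 + c) * x.2 i) (fun j => x.1.1 j.succ),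
    Fin.append (fun i => x.1.2.1 0 * x.2 i) (fun j => x.1.2.1 j.succ), x.1.2.2)

/-- The linear map `(u, η) ↦ (u₁ s + λ η, u₂, …, uₙ₊₁, z)`, where `λ = a + i b` and `uⱼ` stands for
the complex number with real part the `j`-th `x`-coordinate and imaginary part the `j`-th
`y`-coordinate of `u`. The differential of `spinPoint` is of this form. -/
def spinDeriv (a b : ℝ) (s : EuclideanSpace ℝ (Fin (m + 1))) :
    ContactSpace (n + 1) × EuclideanSpace ℝ (Fin (m + 1)) →L[ℝ] ContactSpace (m + 1 + n) :=
  LinearMap.toContinuousLinearMap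
    { toFun := fun u =>
        (Fin.append (fun i => u.1.1 0 * s i + a * u.2 i) (fun j => u.1.1 j.succ),
          Fin.append (fun i => u.1.2.1 0 * s i + b * u.2 i) (fun j => u.1.2.1 j.succ),
          u.1.2.2)
      map_add' := fun u v => by
        refine Prod.ext (funext fun i => ?_) (Prod.ext (funext fun i => ?_) rfl) <;>
          refine Fin.addCases (fun i => ?_) (fun i => ?_) i <;> simp <;> ring
      map_smul' := fun r u => by
        refine Prod.ext (funext fun i => ?_) (Prod.ext (funext fun i => ?_) rfl) <;>
          refine Fin.addCases (fun i => ?_) (fun i => ?_) i <;> simp <;> ring }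

theorem spinDeriv_apply (a b : ℝ) (s : EuclideanSpace ℝ (Fin (m + 1)))
    (u : ContactSpace (n + 1) × EuclideanSpace ℝ (Fin (m + 1))) :
    spinDeriv a b s u =
      (Fin.append (fun i => u.1.1 0 * s i + a * u.2 i) (fun j => u.1.1 j.succ),
        Fin.append (fun i => u.1.2.1 0 * s i + b * u.2 i) (fun j => u.1.2.1 j.succ),
        u.1.2.2) := rfl

theorem contDiff_spinPoint (c : ℝ) :
    ContDiff ℝ ∞ (spinPoint c : ContactSpace (n + 1) × EuclideanSpace ℝ (Fin (m + 1)) → _) := by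
  refine ContDiff.prodMk (contDiff_pi.2 fun i => ?_)
    (ContDiff.prodMk (contDiff_pi.2 fun i => ?_) (by fun_prop)) <;>
    refine Fin.addCases (fun i => ?_) (fun i => ?_) i <;>
    simp only [Fin.append_left, Fin.append_right] <;> fun_prop

theorem hasFDerivAt_spinPoint (c : ℝ) (w : ContactSpace (n + 1))
    (s : EuclideanSpace ℝ (Fin (m + 1))) :
    HasFDerivAt (spinPoint c) (spinDeriv (w.1 0 + c) (w.2.1 0) s) (w, s) := by
  have hd := (contDiff_spinPoint (n := n) (m := m) c).differentiable (by simp) (w, s)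
  have hlin : ∀ a a' : ℝ, HasDerivAt (fun t : ℝ => a + t * a') a' 0 := fun a a' => by
    simpa using ((hasDerivAt_id (0 : ℝ)).mul_const a').const_add a
  have hmul : ∀ a a' b b' : ℝ,
      HasDerivAt (fun t : ℝ => (a + t * a') * (b + t * b')) (a' * b + a * b') 0 :=
    fun a a' b b' => by simpa using (hlin a a').fun_mul (hlin b b')
  have key : ∀ u, HasDerivAt (fun t : ℝ => spinPoint c ((w, s) + t • u))
      (spinDeriv (w.1 0 + c) (w.2.1 0) s u) 0 := by
    intro u
    refine HasDerivAt.prodMk (hasDerivAt_pi.2 fun i => ?_)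
      (HasDerivAt.prodMk (hasDerivAt_pi.2 fun i => ?_) ?_)
    · refine Fin.addCases (fun i => ?_) (fun i => ?_) i
      · simp only [Fin.append_left]
        refine (hmul (w.1 0 + c) (u.1.1 0) (s i) (u.2 i)).congr_of_eventuallyEq
          (Eventually.of_forall fun t => ?_)
        change (w.1 0 + t * u.1.1 0 + c) * (s i + t * u.2 i) =
          (w.1 0 + c + t * u.1.1 0) * (s i + t * u.2 i)
        ring
      · simp only [Fin.append_right]
        exact hlin _ _
    · refine Fin.addCases (fun i => ?_) (fun i => ?_) i
      · simp only [Fin.append_left]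
        exact hmul _ _ _ _
      · simp only [Fin.append_right]
        exact hlin _ _
    · exact hlin _ _
  have hfd : spinDeriv (w.1 0 + c) (w.2.1 0) s = fderiv ℝ (spinPoint c) (w, s) := by
    refine ContinuousLinearMap.ext fun u => ?_
    have hu : HasDerivAt (fun t : ℝ => (w, s) + t • u) u 0 := by
      simpa using ((hasDerivAt_id (0 : ℝ)).smul_const u).const_add (w, s)
    have h0 : HasFDerivAt (spinPoint c) (fderiv ℝ (spinPoint c) (w, s))
        ((w, s) + (0 : ℝ) • u) := by
      simpa using hd.hasFDerivAt
    have h1 := h0.comp_hasDerivAt (0 : ℝ) hu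
    exact (key u).unique h1
  rw [hfd]
  exact hd.hasFDerivAt

end Spin

section FrontSpinDeriv

variable {n m : ℕ}

theorem contMDiff_sphere_val :
    ContMDiff (𝓡 m) 𝓘(ℝ, EuclideanSpace ℝ (Fin (m + 1))) ∞
      (Subtype.val : UnitSphere m → EuclideanSpace ℝ (Fin (m + 1))) :=
  have := Fact.mk (finrank_euclideanSpace_fin (𝕜 := ℝ) (n := m + 1))
  contMDiff_coe_sphere

/-- The differential of the inclusion of the sphere. -/
def sphereDeriv (σ : UnitSphere m) :
    EuclideanSpace ℝ (Fin m) →L[ℝ] EuclideanSpace ℝ (Fin (m + 1)) :=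
  mfderiv (𝓡 m) 𝓘(ℝ, EuclideanSpace ℝ (Fin (m + 1)))
    (Subtype.val : UnitSphere m → EuclideanSpace ℝ (Fin (m + 1))) σ

theorem hasVectorDerivAt_sphere_val (σ : UnitSphere m) :
    HasVectorDerivAt (𝓡 m) (Subtype.val : UnitSphere m → EuclideanSpace ℝ (Fin (m + 1)))
      (sphereDeriv σ) σ :=
  contMDiff_sphere_val.hasVectorDerivAt (by simp) σ

theorem sphereDeriv_injective (σ : UnitSphere m) : Function.Injective (sphereDeriv σ) :=
  have := Fact.mk (finrank_euclideanSpace_fin (𝕜 := ℝ) (n := m + 1))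
  injective_mvfderiv_subtypeVal_sphere σ

/-- The tangent space of the sphere at `σ` is orthogonal to `σ`. This is what makes the spinning
Legendrian and separates the factors `M` and `S^m` in all computations below. -/
theorem sphereDeriv_orthogonal (σ : UnitSphere m) (η : EuclideanSpace ℝ (Fin m)) :
    ∑ i, sphereDeriv σ η i * σ.1 i = 0 := by
  have h : sphereDeriv σ η ∈ (Submodule.span ℝ {(σ : EuclideanSpace ℝ (Fin (m + 1)))})ᗮ := by
    have := Fact.mk (finrank_euclideanSpace_fin (𝕜 := ℝ) (n := m + 1))
    rw [← range_mvfderiv_subtypeVal (n := m) σ]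
    exact ⟨η, rfl⟩
  have := (Submodule.mem_orthogonal_singleton_iff_inner_right.1 h)
  rw [PiLp.inner_apply] at this
  simpa using this

variable {E H : Type*} [NormedAddCommGroup E] [NormedSpace ℝ E] [TopologicalSpace H]
  {I : ModelWithCorners ℝ E H} {M : Type*} [TopologicalSpace M] [ChartedSpace H M]

theorem contMDiff_frontSpin {f : M → ContactSpace (n + 1)}
    (hf : ContMDiff I 𝓘(ℝ, ContactSpace (n + 1)) ∞ f) (c : ℝ) :
    ContMDiff (I.prod (𝓡 m)) 𝓘(ℝ, ContactSpace (m + 1 + n)) ∞ (frontSpin m c f) :=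
  (contDiff_spinPoint c).contMDiff.comp
    ((hf.comp contMDiff_fst).prodMk_space (contMDiff_sphere_val.comp contMDiff_snd))

theorem HasVectorDerivAt.frontSpin {f : M → ContactSpace (n + 1)} {A : E →L[ℝ] ContactSpace (n + 1)}
    {p : M} (hf : HasVectorDerivAt I f A p) (c : ℝ) (σ : UnitSphere m) :
    HasVectorDerivAt (I.prod (𝓡 m)) (frontSpin m c f)
      ((spinDeriv ((f p).1 0 + c) ((f p).2.1 0) σ).comp
        ((A.comp (ContinuousLinearMap.fst ℝ E (EuclideanSpace ℝ (Fin m)))).prod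
          ((sphereDeriv σ).comp (ContinuousLinearMap.snd ℝ E (EuclideanSpace ℝ (Fin m))))))
      (p, σ) :=
  HasFDerivAt.comp_hasVectorDerivAt (G := fun x : M × UnitSphere m => (f x.1, x.2.1))
    (φ := spinPoint c) (x := (p, σ)) (hasFDerivAt_spinPoint c (f p) σ.1)
    ((hf.comp_fst σ).prodMk ((hasVectorDerivAt_sphere_val σ).comp_snd p))

theorem vectorDeriv_frontSpin {f : M → ContactSpace (n + 1)}
    (hf : ContMDiff I 𝓘(ℝ, ContactSpace (n + 1)) ∞ f) (c : ℝ) (p : M) (σ : UnitSphere m)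
    (u : E) (η : EuclideanSpace ℝ (Fin m)) :
    vectorDeriv (I.prod (𝓡 m)) (frontSpin m c f) (p, σ) (u, η) =
      spinDeriv ((f p).1 0 + c) ((f p).2.1 0) σ (vectorDeriv I f p u, sphereDeriv σ η) := by
  rw [((hf.hasVectorDerivAt_vectorDeriv (by simp) p).frontSpin c σ).vectorDeriv_eq]
  rfl

/-- The components along and orthogonal to `σ` of a vector in the image determine `u` and `η`. -/
theorem spinDeriv_injective {a b : ℝ} (ha : a ≠ 0)
    (σ : UnitSphere m) {u : ContactSpace (n + 1)} {η : EuclideanSpace ℝ (Fin m)}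
    (h : spinDeriv a b σ (u, sphereDeriv σ η) = 0) : u = 0 ∧ η = 0 := by
  rw [spinDeriv_apply] at h
  have hx : ∀ i, u.1 0 * σ.1 i + a * sphereDeriv σ η i = 0 := fun i => by
    simpa using congrFun (congrArg Prod.fst h) (Fin.castAdd n i)
  have hx' : ∀ j : Fin n, u.1 j.succ = 0 := fun j => by
    simpa using congrFun (congrArg Prod.fst h) (Fin.natAdd (m + 1) j)
  have hy : ∀ i, u.2.1 0 * σ.1 i + b * sphereDeriv σ η i = 0 := fun i => by
    simpa using congrFun (congrArg (fun w => w.2.1) h) (Fin.castAdd n i)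
  have hy' : ∀ j : Fin n, u.2.1 j.succ = 0 := fun j => by
    simpa using congrFun (congrArg (fun w => w.2.1) h) (Fin.natAdd (m + 1) j)
  have hz : u.2.2 = 0 := congrArg (fun w => w.2.2) h
  -- the component along `σ` of each equation isolates the part coming from `u`
  have hproj : ∀ a b : ℝ, (∀ i, a * σ.1 i + b * sphereDeriv σ η i = 0) → a = 0 := by
    intro a b hab
    have h1 : ∑ i, (a * σ.1 i + b * sphereDeriv σ η i) * σ.1 i = 0 := by simp [hab]
    have h2 : ∑ i, (a * σ.1 i + b * sphereDeriv σ η i) * σ.1 i =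
        a * ∑ i, σ.1 i ^ 2 + b * ∑ i, sphereDeriv σ η i * σ.1 i := by
      rw [Finset.mul_sum, Finset.mul_sum, ← Finset.sum_add_distrib]
      exact Finset.sum_congr rfl fun i _ => by ring
    rw [h2, UnitSphere.sum_sq, sphereDeriv_orthogonal] at h1
    simpa using h1
  have hx0 := hproj _ _ hx
  have hy0 := hproj _ _ hy
  have hη : sphereDeriv σ η = 0 := PiLp.ext fun i => by
    have := hx i
    rw [hx0, zero_mul, zero_add] at this
    exact (mul_eq_zero.1 this).resolve_left ha
  refine ⟨Prod.ext (funext fun i => Fin.cases hx0 hx' i)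
    (Prod.ext (funext fun i => Fin.cases hy0 hy' i) hz), ?_⟩
  exact sphereDeriv_injective σ (hη.trans (map_zero _).symm)

/-- The spinning of a vector of `ξ` by the sphere is again in `ξ`: the vectors tangent to the sphere
are orthogonal to the radial direction. -/
theorem spinDeriv_mem_contactPlane (c a b : ℝ) {w : ContactSpace (n + 1)} (σ : UnitSphere m)
    {u : ContactSpace (n + 1)} (hu : u ∈ contactPlane w) (η : EuclideanSpace ℝ (Fin m)) :
    spinDeriv a b σ (u, sphereDeriv σ η) ∈ contactPlane (spinPoint c (w, σ.1)) := by
  have hu' : u.2.2 - ∑ i, w.2.1 i * u.1 i = 0 := hu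
  rw [Fin.sum_univ_succ] at hu'
  change u.2.2 - ∑ i, (spinPoint c (w, σ.1)).2.1 i *
    (spinDeriv a b σ (u, sphereDeriv σ η)).1 i = 0
  rw [Fin.sum_univ_add, spinDeriv_apply, spinPoint]
  simp only [Fin.append_left, Fin.append_right]
  have : ∑ i, w.2.1 0 * σ.1 i * (u.1 0 * σ.1 i + a * sphereDeriv σ η i) =
      w.2.1 0 * u.1 0 * ∑ i, σ.1 i ^ 2 +
        w.2.1 0 * a * ∑ i, sphereDeriv σ η i * σ.1 i := by
    rw [Finset.mul_sum, Finset.mul_sum, ← Finset.sum_add_distrib]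
    exact Finset.sum_congr rfl fun i _ => by ring
  rw [this, UnitSphere.sum_sq, sphereDeriv_orthogonal]
  linarith

/-- The translation that makes `x₁` positive is what makes the spinning injective and immersive. -/
theorem IsLegendrianEmbedding.frontSpin [FiniteDimensional ℝ E] [CompactSpace M]
    {f : M → ContactSpace (n + 1)} (hf : IsLegendrianEmbedding I f) {c : ℝ}
    (hc : ∀ p, 0 < (f p).1 0 + c) :
    IsLegendrianEmbedding (I.prod (𝓡 m)) (frontSpin m c f) where
  dim := by
    have := hf.dim
    simp [this]
    ring
  smooth := contMDiff_frontSpin hf.smooth c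
  embedding := ((contMDiff_frontSpin hf.smooth c).continuous.isClosedEmbedding
    (frontSpin_injective hc hf.embedding.injective)).isEmbedding
  immersion := by
    rintro ⟨p, σ⟩
    change Function.Injective (vectorDeriv (I.prod (𝓡 m)) (_root_.frontSpin m c f) (p, σ))
    refine (injective_iff_map_eq_zero _).2 ?_
    rintro ⟨u, η⟩ h
    rw [vectorDeriv_frontSpin hf.smooth] at h
    obtain ⟨h1, rfl⟩ := spinDeriv_injective (hc p).ne' σ h
    have hinj : Function.Injective (vectorDeriv I f p) := hf.immersion p
    rw [(injective_iff_map_eq_zero _).1 hinj u h1]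
    rfl
  tangent := by
    rintro ⟨p, σ⟩ ⟨u, η⟩
    have := spinDeriv_mem_contactPlane c ((f p).1 0 + c) ((f p).2.1 0) σ (hf.tangent p u) η
    exact (vectorDeriv_frontSpin hf.smooth c p σ u η).symm ▸ this

theorem nonempty_homeomorph_range_frontSpin [CompactSpace M] {f : M → ContactSpace (n + 1)}
    (hf : IsEmbedding f) {c : ℝ} (hc : ∀ p, 0 < (f p).1 0 + c) :
    Nonempty (range (frontSpin m c f) ≃ₜ range f × UnitSphere m) := by
  have hcont : Continuous (frontSpin m c f) :=
    (contDiff_spinPoint c).continuous.comp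
      ((hf.continuous.comp continuous_fst).prodMk (continuous_subtype_val.comp continuous_snd))
  have hemb := (hcont.isClosedEmbedding (frontSpin_injective hc hf.injective)).isEmbedding
  exact ⟨hemb.toHomeomorph.symm.trans (hf.toHomeomorph.prodCongr (Homeomorph.refl _))⟩

end FrontSpinDeriv

/-! ### Orientation of the sphere -/

section SphereOrientation

/-- The determinant of `(v, A u₁, …, A u_d)` as an alternating form in `u`. -/
def consDet {E W : Type*} [NormedAddCommGroup E] [NormedSpace ℝ E] [NormedAddCommGroup W]
    [NormedSpace ℝ W] {d : ℕ} (b : Module.Basis (Fin (d + 1)) ℝ W) (v : W) (A : E →L[ℝ] W) :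
    E [⋀^Fin d]→ₗ[ℝ] ℝ :=
  (b.det.curryLeft v).compLinearMap (A : E →ₗ[ℝ] W)

/-- The form does not vanish when `A` is injective and `v` is transverse to its image. -/
theorem consDet_ne_zero {E W : Type*} [NormedAddCommGroup E] [NormedSpace ℝ E]
    [NormedAddCommGroup W] [NormedSpace ℝ W] {d : ℕ} (b : Module.Basis (Fin (d + 1)) ℝ W) {v : W}
    {A : E →L[ℝ] W} (e : Module.Basis (Fin d) ℝ E) (hA : Function.Injective A)
    (hv : ∀ u, A u ≠ v) : consDet b v A e ≠ 0 := by
  have hAe : LinearIndependent ℝ (fun i => A (e i)) :=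
    e.linearIndependent.map' (A : E →ₗ[ℝ] W) (LinearMap.ker_eq_bot.2 hA)
  have hli : LinearIndependent ℝ (Fin.cons v fun i => A (e i) : Fin (d + 1) → W) := by
    refine linearIndependent_finCons.2 ⟨hAe, fun hmem => ?_⟩
    have : v ∈ LinearMap.range (A : E →ₗ[ℝ] W) := by
      refine Submodule.span_le.2 ?_ hmem
      rintro _ ⟨i, rfl⟩
      exact ⟨e i, rfl⟩
    obtain ⟨u, hu⟩ := this
    exact hv u hu
  have := Module.Basis.finiteDimensional_of_finite b
  exact ((b.is_basis_iff_det).1 ⟨hli, hli.span_eq_top_of_card_eq_finrank'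
    (Module.finrank_eq_card_basis b).symm⟩).ne_zero

variable {E H : Type*} [NormedAddCommGroup E] [NormedSpace ℝ E] [FiniteDimensional ℝ E]
  [TopologicalSpace H]
  {I : ModelWithCorners ℝ E H} [I.Boundaryless] {X : Type*} [TopologicalSpace X]
  [ChartedSpace H X] [IsManifold I 1 X] {W : Type*} [NormedAddCommGroup W] [NormedSpace ℝ W]
  {d : ℕ}

/-- A hypersurface with a continuous transverse vector field `ν` is orientable: a frame is positive
if it makes, together with `ν`, a positive basis of the ambient space. -/
theorem nonempty_orientation_of_transverse [FiniteDimensional ℝ W] (hd : 0 < d)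
    (hE : Module.finrank ℝ E = d)
    (b : Module.Basis (Fin (d + 1)) ℝ W) {F : X → W} (hF : ContMDiff I 𝓘(ℝ, W) 1 F) {ν : X → W}
    (hν : Continuous ν)
    (hne : ∀ x, consDet b (ν x) (vectorDeriv I F x) ≠ 0) :
    Nonempty (ManifoldOrientation I X d) := by
  have hframe : ∀ x, ∃ e : Module.Basis (Fin d) ℝ E, 0 < consDet b (ν x) (vectorDeriv I F x) e := by
    intro x
    let e : Module.Basis (Fin d) ℝ E := (Module.finBasis ℝ E).reindex (finCongr hE)
    have h0 : consDet b (ν x) (vectorDeriv I F x) e ≠ 0 := fun h =>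
      hne x (e.ext_alternating fun v hv => by
        rw [AlternatingMap.eq_smul_basis_det e (consDet b (ν x) (vectorDeriv I F x)), h]
        simp)
    rcases lt_or_gt_of_ne h0 with h | h
    -- reverse the first vector of a negative frame
    · let w : Fin d → ℝˣ := fun i => if i = ⟨0, hd⟩ then -1 else 1
      refine ⟨e.unitsSMul w, ?_⟩
      have hw : ⇑(e.unitsSMul w) = fun i => (w i : ℝ) • e i := by
        funext i
        rw [Module.Basis.unitsSMul_apply]
        rfl
      have hprod : ∏ i, (w i : ℝ) = -1 := by
        rw [Finset.prod_eq_single ⟨0, hd⟩] <;> simp +contextual [w]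
      rw [hw, AlternatingMap.map_smul_univ, hprod]
      simpa using h
    · exact ⟨e, h⟩
  choose e he using hframe
  refine ⟨⟨fun x => e x, fun x => ?_⟩⟩
  have hxs := mem_extChartAt_source (I := I) x
  let B : X → E →L[ℝ] W := fun x' => fderiv ℝ (F ∘ (extChartAt I x).symm) (extChartAt I x x')
  have hderiv : ∀ x' ∈ (extChartAt I x).source,
      vectorDeriv I F x' = (B x').comp (tangentCoordChange I x' x x') := fun x' hx' =>
    mfderiv_eq_fderiv_comp_tangentCoordChange hF x hx'
  have hB : ContinuousAt B x := by
    have hCD : ContDiffOn ℝ 1 (F ∘ (extChartAt I x).symm) (extChartAt I x).target :=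
      contMDiffOn_iff_contDiffOn.1 (hF.comp_contMDiffOn (contMDiffOn_extChartAt_symm x))
    have h1 := (hCD.continuousOn_fderiv_of_isOpen (isOpen_extChartAt_target x) le_rfl).continuousAt
      ((isOpen_extChartAt_target x).mem_nhds (mem_extChartAt_target x))
    exact h1.comp (continuousAt_extChartAt x)
  have hBx : B x = vectorDeriv I F x := by
    rw [hderiv x hxs]
    ext v
    exact congrArg (B x) (tangentCoordChange_self hxs).symm
  have hpos : ∀ᶠ x' in 𝓝 x, 0 < consDet b (ν x') (B x') (e x) := by
    have hcont : ContinuousAt (fun x' => consDet b (ν x') (B x') (e x)) x := by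
      have hdet : Continuous fun w : Fin (d + 1) → W => b.det w :=
        Continuous.matrix_det (continuous_matrix fun i j =>
          ((b.coord i).continuous_of_finiteDimensional.comp (continuous_apply j)))
      refine hdet.continuousAt.comp (continuousAt_pi.2 fun i => ?_)
      refine Fin.cases ?_ (fun i => ?_) i
      · exact hν.continuousAt
      · exact hB.clm_apply continuousAt_const
    exact continuousAt_const.eventually_lt hcont (by rw [hBx]; exact he x)
  filter_upwards [hpos, (isOpen_extChartAt_source (I := I) x).mem_nhds hxs] with x' h hx'
  have h1 : consDet b (ν x') (B x') (fun i => tangentCoordChange I x' x x' (e x' i)) =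
      consDet b (ν x') (B x') (e x) *
        (e x).det (fun i => tangentCoordChange I x' x x' (e x' i)) := by
    conv_lhs => rw [AlternatingMap.eq_smul_basis_det (e x) (consDet b (ν x') (B x'))]
    rfl
  have h2 := he x'
  rw [hderiv x' hx'] at h2
  exact (pos_iff_pos_of_mul_pos (h1 ▸ h2)).1 h

/-- The outward normal is transverse to the sphere. -/
theorem nonempty_sphere_orientation {m : ℕ} (hm : 1 ≤ m) :
    Nonempty (ManifoldOrientation (𝓡 m) (UnitSphere m) m) := by
  let b := (EuclideanSpace.basisFun (Fin (m + 1)) ℝ).toBasis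
  refine nonempty_orientation_of_transverse (by omega) (by simp) b
    (contMDiff_sphere_val.of_le (by simp)) continuous_subtype_val fun σ h0 => ?_
  refine consDet_ne_zero b (EuclideanSpace.basisFun (Fin m) ℝ).toBasis (sphereDeriv_injective σ)
    (fun u hu => ?_) (congrArg (fun φ => φ (EuclideanSpace.basisFun (Fin m) ℝ).toBasis) h0)
  have h1 := sphereDeriv_orthogonal σ u
  rw [hu] at h1
  simp only [← sq, UnitSphere.sum_sq] at h1
  exact one_ne_zero h1

end SphereOrientation

/-! ### Legendrian tangent spaces are totally real -/

section Isotropy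

variable {n : ℕ}

theorem mem_contactPlane_iff {q w : ContactSpace n} :
    w ∈ contactPlane q ↔ w.2.2 = ∑ i, q.2.1 i * w.1 i :=
  LinearMap.mem_ker.trans sub_eq_zero

theorem complexStructure_mem_contactPlane (q w : ContactSpace n) :
    complexStructure q w ∈ contactPlane q := by
  rw [mem_contactPlane_iff]
  simp [complexStructure]

theorem finrank_contactPlane (q : ContactSpace n) : Module.finrank ℝ (contactPlane q) = n + n := by
  have hsurj : LinearMap.range (contactForm q) = ⊤ := by
    refine LinearMap.range_eq_top.2 fun z => ⟨(0, 0, z), ?_⟩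
    simp [contactForm]
  have h := LinearMap.finrank_range_add_finrank_ker (contactForm q)
  rw [hsurj, finrank_top] at h
  simp at h
  change Module.finrank ℝ (LinearMap.ker (contactForm q)) = n + n
  omega

/-- Since `ξ` has real dimension `2n`, the complexification of a linear map from an `n`-dimensional
space to `ξ` is bijective as soon as it is injective. -/
theorem bijOn_add_complexStructure {E : Type*} [AddCommGroup E] [Module ℝ E]
    [FiniteDimensional ℝ E] (hE : Module.finrank ℝ E = n) (q : ContactSpace n)
    (φ : E →ₗ[ℝ] ContactSpace n) (hφ : ∀ u, φ u ∈ contactPlane q)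
    (hinj : ∀ u w, φ u + complexStructure q (φ w) = 0 → u = 0 ∧ w = 0) :
    BijOn (fun u : E × E => φ u.1 + complexStructure q (φ u.2)) univ (contactPlane q) := by
  let J : ContactSpace n →ₗ[ℝ] ContactSpace n :=
    { toFun := complexStructure q
      map_add' := fun u v => by
        simp only [complexStructure, Prod.snd_add, Prod.fst_add, Pi.add_apply, mul_add,
          Finset.sum_add_distrib, neg_add, Prod.mk_add_mk]
      map_smul' := fun c v => Prod.ext (by simp [complexStructure]) (Prod.ext rfl
        (by simp [complexStructure, Finset.mul_sum, mul_left_comm])) }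
  let Ψ : E × E →ₗ[ℝ] contactPlane q :=
    LinearMap.codRestrict _ (φ.coprod (J ∘ₗ φ)) fun u =>
      Submodule.add_mem _ (hφ u.1) (complexStructure_mem_contactPlane q _)
  have hΨ : Function.Injective Ψ := (injective_iff_map_eq_zero _).2 fun u hu => by
    have h := hinj u.1 u.2 (congrArg Subtype.val hu)
    exact Prod.ext h.1 h.2
  have hsurj : Function.Surjective Ψ :=
    (LinearMap.injective_iff_surjective_of_finrank_eq_finrank
      (by rw [finrank_contactPlane, Module.finrank_prod, hE])).1 hΨ
  refine ⟨fun u _ => (Ψ u).2, fun u _ v _ h => hΨ (Subtype.ext h), fun w hw => ?_⟩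
  obtain ⟨u, hu⟩ := hsurj ⟨w, hw⟩
  exact ⟨u, mem_univ _, congrArg Subtype.val hu⟩

theorem eq_zero_of_mem_contactPlane {q w : ContactSpace n} (hw : w ∈ contactPlane q)
    (hx : ∀ i, w.1 i = 0) (hy : ∀ i, w.2.1 i = 0) : w = 0 := by
  rw [mem_contactPlane_iff] at hw
  simp only [hx, mul_zero, Finset.sum_const_zero] at hw
  exact Prod.ext (funext hx) (Prod.ext (funext hy) hw)

theorem hasDerivAt_contactForm {a b : ℝ → ContactSpace n} {a' b' : ContactSpace n} {t : ℝ}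
    (ha : HasDerivAt a a' t) (hb : HasDerivAt b b' t) :
    HasDerivAt (fun s => contactForm (a s) (b s))
      (contactForm (a t) b' - ∑ i, a'.2.1 i * (b t).1 i) t := by
  have hay : ∀ i, HasDerivAt (fun s => (a s).2.1 i) (a'.2.1 i) t := fun i =>
    hasDerivAt_pi.1 (ha.snd.fst) i
  have hbx : ∀ i, HasDerivAt (fun s => (b s).1 i) (b'.1 i) t := fun i => hasDerivAt_pi.1 hb.fst i
  have hbz : HasDerivAt (fun s => (b s).2.2) b'.2.2 t := hb.snd.snd
  have h := hbz.fun_sub (HasDerivAt.fun_sum (u := Finset.univ)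
    fun i _ => (hay i).fun_mul (hbx i))
  refine HasDerivAt.congr_deriv h ?_
  simp only [contactForm, LinearMap.coe_mk, AddHom.coe_mk, Finset.sum_add_distrib]
  ring

variable {E : Type*} [NormedAddCommGroup E] [NormedSpace ℝ E]

/-- A map tangent to `ξ` pulls back `dα = ∑ dxᵢ ∧ dyᵢ` to `0`. -/
theorem sum_fderiv_mul_fderiv_comm {h : E → ContactSpace n} {x : E}
    (hh : ContDiffAt ℝ 2 h x) (ht : ∀ᶠ x' in 𝓝 x, ∀ u, fderiv ℝ h x' u ∈ contactPlane (h x'))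
    (u v : E) :
    ∑ i, (fderiv ℝ h x v).2.1 i * (fderiv ℝ h x u).1 i =
      ∑ i, (fderiv ℝ h x u).2.1 i * (fderiv ℝ h x v).1 i := by
  have key : ∀ u v : E, contactForm (h x) (fderiv ℝ (fderiv ℝ h) x v u) =
      ∑ i, (fderiv ℝ h x v).2.1 i * (fderiv ℝ h x u).1 i := by
    intro u v
    have hline : HasDerivAt (fun t : ℝ => x + t • v) v 0 := by
      simpa using ((hasDerivAt_id (0 : ℝ)).smul_const v).const_add x
    have hx0 : x + (0 : ℝ) • v = x := by simp
    have ha : HasDerivAt (fun t : ℝ => h (x + t • v)) (fderiv ℝ h x v) 0 := by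
      have h1 : HasFDerivAt h (fderiv ℝ h x) (x + (0 : ℝ) • v) := by
        rw [hx0]
        exact (hh.differentiableAt (by norm_num)).hasFDerivAt
      exact h1.comp_hasDerivAt (0 : ℝ) hline
    have hb : HasDerivAt (fun t : ℝ => fderiv ℝ h (x + t • v) u)
        (fderiv ℝ (fderiv ℝ h) x v u) 0 := by
      have h1 : HasFDerivAt (fderiv ℝ h) (fderiv ℝ (fderiv ℝ h) x) (x + (0 : ℝ) • v) := by
        rw [hx0]
        exact ((hh.fderiv_right (m := 1) (by norm_num)).differentiableAt
          (by norm_num)).hasFDerivAt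
      have h2 : HasDerivAt (fun t : ℝ => fderiv ℝ h (x + t • v)) (fderiv ℝ (fderiv ℝ h) x v) 0 :=
        h1.comp_hasDerivAt (0 : ℝ) hline
      simpa using h2.clm_apply (hasDerivAt_const (0 : ℝ) u)
    have hzero : HasDerivAt (fun t : ℝ => contactForm (h (x + t • v)) (fderiv ℝ h (x + t • v) u))
        0 0 := by
      refine (hasDerivAt_const (0 : ℝ) (0 : ℝ)).congr_of_eventuallyEq ?_
      have hc : Tendsto (fun t : ℝ => x + t • v) (𝓝 0) (𝓝 x) := by
        simpa only [ContinuousAt, hx0] using hline.continuousAt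
      have : ∀ᶠ t in 𝓝 (0 : ℝ), ∀ u, fderiv ℝ h (x + t • v) u ∈ contactPlane (h (x + t • v)) :=
        hc.eventually ht
      filter_upwards [this] with t h1
      exact h1 u
    have := (hasDerivAt_contactForm ha hb).unique hzero
    rw [hx0] at this
    linarith
  have hsymm : IsSymmSndFDerivAt ℝ h x := hh.isSymmSndFDerivAt (by simp)
  rw [← key u v, ← key v u, hsymm u v]

end Isotropy

theorem two_le_infty : (2 : WithTop ℕ∞) ≤ ∞ := by
  exact WithTop.coe_le_coe.2 (le_top : (2 : ℕ∞) ≤ ⊤)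

section FibreIso

variable {E H : Type*} [NormedAddCommGroup E] [NormedSpace ℝ E] [TopologicalSpace H]
  {I : ModelWithCorners ℝ E H} {M : Type*} [TopologicalSpace M] [ChartedSpace H M]
  [IsManifold I 1 M] {n : ℕ}

theorem continuous_vectorDeriv {W : Type*} [NormedAddCommGroup W] [NormedSpace ℝ W] {f : M → W}
    (hf : ContMDiff I 𝓘(ℝ, W) 1 f) :
    Continuous fun U : TangentBundle I M => vectorDeriv I f U.proj U.snd :=
  (contMDiff_snd_tangentBundle_modelSpace (n := 0) W 𝓘(ℝ, W)).continuous.comp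
    (hf.continuous_tangentMap le_rfl)

variable [I.Boundaryless]

theorem fderiv_comp_extChartAt_symm_apply {W : Type*} [NormedAddCommGroup W]
    [NormedSpace ℝ W] {f : M → W} (hf : ContMDiff I 𝓘(ℝ, W) 1 f) (p : M) {x : E}
    (hx : x ∈ (extChartAt I p).target) (u : E) :
    ∃ v : E, fderiv ℝ (f ∘ (extChartAt I p).symm) x u =
      vectorDeriv I f ((extChartAt I p).symm x) v := by
  have h₁ : MDifferentiableAt 𝓘(ℝ, E) I (extChartAt I p).symm x :=
    (contMDiffOn_extChartAt_symm p |>.contMDiffAt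
      ((isOpen_extChartAt_target p).mem_nhds hx)).mdifferentiableAt one_ne_zero
  have h₂ : MDifferentiableAt I 𝓘(ℝ, W) f ((extChartAt I p).symm x) :=
    (hf.mdifferentiable one_ne_zero) _
  have h := mfderiv_comp x h₂ h₁
  rw [mfderiv_eq_fderiv] at h
  exact ⟨mfderiv 𝓘(ℝ, E) I (extChartAt I p).symm x u, congrArg (fun A : E →L[ℝ] W => A u) h⟩

/-- Legendrian tangent spaces are isotropic for `dα`. -/
theorem IsLegendrianEmbedding.sum_vectorDeriv_mul_comm [IsManifold I 2 M] {f : M → ContactSpace n}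
    (hf : IsLegendrianEmbedding I f) (p : M) (u v : E) :
    ∑ i, (vectorDeriv I f p v).2.1 i * (vectorDeriv I f p u).1 i =
      ∑ i, (vectorDeriv I f p u).2.1 i * (vectorDeriv I f p v).1 i := by
  have hmem := mem_extChartAt_target (I := I) p
  have hnhds := (isOpen_extChartAt_target (I := I) p).mem_nhds hmem
  have hCD : ContDiffAt ℝ 2 (f ∘ (extChartAt I p).symm) (extChartAt I p p) :=
    (contMDiffOn_iff_contDiffOn.1 ((hf.smooth.of_le two_le_infty).comp_contMDiffOn
      (contMDiffOn_extChartAt_symm (n := 2) p))).contDiffAt hnhds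
  have hD : vectorDeriv I f p = fderiv ℝ (f ∘ (extChartAt I p).symm) (extChartAt I p p) := by
    refine HasVectorDerivAt.vectorDeriv_eq ⟨hf.smooth.continuous.continuousAt, ?_⟩
    rw [I.range_eq_univ, hasFDerivWithinAt_univ]
    exact (hCD.differentiableAt (by norm_num)).hasFDerivAt
  rw [hD]
  refine sum_fderiv_mul_fderiv_comm hCD ?_ u v
  filter_upwards [hnhds] with x hx u
  obtain ⟨v, hv⟩ := fderiv_comp_extChartAt_symm_apply (hf.smooth.of_le (by simp)) p hx u
  rw [hv]
  exact hf.tangent _ v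

/-- `df_ℂ` is an isomorphism onto `ξ`: if `df u + J df w = 0`, then `dα (df w, J df w)`, the square
of the length of `df w`, is `- dα (df w, df u) = 0`. -/
theorem IsLegendrianEmbedding.isComplexFibreIso [FiniteDimensional ℝ E] [IsManifold I 2 M]
    {f : M → ContactSpace n} (hf : IsLegendrianEmbedding I f) :
    IsComplexFibreIso I f
      (fun u => (mfderiv I 𝓘(ℝ, ContactSpace n) f u.proj u.snd : ContactSpace n)) where
  continuous_base := hf.smooth.continuous
  continuous_map := continuous_vectorDeriv (hf.smooth.of_le (by simp))
  linear p := (vectorDeriv I f p).toLinearMap.isLinear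
  bijective p := by
    have hinj : ∀ u : E, vectorDeriv I f p u = 0 → u = 0 :=
      (injective_iff_map_eq_zero _).1 (hf.immersion p)
    refine bijOn_add_complexStructure hf.dim (f p) (vectorDeriv I f p : E →ₗ[ℝ] ContactSpace n)
      (hf.tangent p) fun u w h => ?_
    change vectorDeriv I f p u + complexStructure (f p) (vectorDeriv I f p w) = 0 at h
    have hsymm := hf.sum_vectorDeriv_mul_comm p u w
    have hmem : vectorDeriv I f p w ∈ contactPlane (f p) := hf.tangent p w
    set U := vectorDeriv I f p u with hU
    set W := vectorDeriv I f p w with hW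
    have hx : ∀ i, U.1 i = W.2.1 i := fun i => by
      have := congrFun (congrArg Prod.fst h) i
      simpa [complexStructure, add_neg_eq_zero] using this
    have hy : ∀ i, U.2.1 i = -W.1 i := fun i => by
      have := congrFun (congrArg (fun w => w.2.1) h) i
      simpa [complexStructure, add_eq_zero_iff_eq_neg] using this
    simp only [hx, hy] at hsymm
    have hsum : ∑ i, (W.2.1 i ^ 2 + W.1 i ^ 2) = 0 := by
      rw [Finset.sum_add_distrib]
      simp only [neg_mul, Finset.sum_neg_distrib, ← sq] at hsymm
      linarith
    have hzero := (Finset.sum_eq_zero_iff_of_nonneg fun i _ => by positivity).1 hsum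
    have hW0 : W = 0 := by
      refine eq_zero_of_mem_contactPlane hmem (fun i => ?_) (fun i => ?_) <;>
        · have := hzero i (Finset.mem_univ i)
          nlinarith [sq_nonneg (W.2.1 i), sq_nonneg (W.1 i)]
    have hU0 : U = 0 := by
      rw [hW0] at h
      simpa [complexStructure, Prod.ext_iff, funext_iff] using h
    exact ⟨hinj u hU0, hinj w hW0⟩

end FibreIso

/-! ### Rotation classes -/

section Homotopy

variable {E H : Type*} [NormedAddCommGroup E] [NormedSpace ℝ E] [TopologicalSpace H]
  {I : ModelWithCorners ℝ E H} {M : Type*} [TopologicalSpace M] [ChartedSpace H M]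
  [IsManifold I 1 M] {n : ℕ}
  {a a' a'' : (M → ContactSpace n) × (TangentBundle I M → ContactSpace n)}

theorem FibreIsoHomotopic.refl (h : IsComplexFibreIso I a.1 a.2) : FibreIsoHomotopic I a a :=
  ⟨fun x => a.1 x.2, fun x => a.2 x.2, h.continuous_base.comp continuous_snd,
    h.continuous_map.comp continuous_snd, fun _ => h, rfl, rfl⟩

theorem FibreIsoHomotopic.symm (h : FibreIsoHomotopic I a a') : FibreIsoHomotopic I a' a := by
  obtain ⟨B, Φ, hB, hΦ, hiso, h0, h1⟩ := h
  refine ⟨fun x => B (unitInterval.symm x.1, x.2), fun x => Φ (unitInterval.symm x.1, x.2),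
    hB.comp ((unitInterval.continuous_symm.comp continuous_fst).prodMk continuous_snd),
    hΦ.comp ((unitInterval.continuous_symm.comp continuous_fst).prodMk continuous_snd),
    fun s => hiso (unitInterval.symm s), ?_, ?_⟩
  · simpa using h1
  · simpa using h0

theorem FibreIsoHomotopic.trans (h : FibreIsoHomotopic I a a') (h' : FibreIsoHomotopic I a' a'') :
    FibreIsoHomotopic I a a'' := by
  obtain ⟨B, Φ, hB, hΦ, hiso, h0, h1⟩ := h
  obtain ⟨B', Φ', hB', hΦ', hiso', h0', h1'⟩ := h'
  have hmid : (fun p => B (1, p)) = fun p => B' (0, p) :=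
    (congrArg Prod.fst h1).trans (congrArg Prod.fst h0').symm
  have hmid' : (fun u => Φ (1, u)) = fun u => Φ' (0, u) :=
    (congrArg Prod.snd h1).trans (congrArg Prod.snd h0').symm
  let F : ContinuousMap.Homotopy (⟨fun p => B (0, p), by fun_prop⟩ : C(M, ContactSpace n))
      ⟨fun p => B (1, p), by fun_prop⟩ := ⟨⟨B, hB⟩, fun _ => rfl, fun _ => rfl⟩
  let F' : ContinuousMap.Homotopy (⟨fun p => B (1, p), by fun_prop⟩ : C(M, ContactSpace n))
      ⟨fun p => B' (1, p), by fun_prop⟩ :=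
    ⟨⟨B', hB'⟩, fun p => (congrFun hmid p).symm, fun _ => rfl⟩
  let G : ContinuousMap.Homotopy
      (⟨fun u => Φ (0, u), by fun_prop⟩ : C(TangentBundle I M, ContactSpace n))
      ⟨fun u => Φ (1, u), by fun_prop⟩ := ⟨⟨Φ, hΦ⟩, fun _ => rfl, fun _ => rfl⟩
  let G' : ContinuousMap.Homotopy
      (⟨fun u => Φ (1, u), by fun_prop⟩ : C(TangentBundle I M, ContactSpace n))
      ⟨fun u => Φ' (1, u), by fun_prop⟩ :=
    ⟨⟨Φ', hΦ'⟩, fun p => (congrFun hmid' p).symm, fun _ => rfl⟩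
  refine ⟨F.trans F', G.trans G', map_continuous _, map_continuous _, fun s => ?_, ?_, ?_⟩
  · simp only [ContinuousMap.Homotopy.trans_apply]
    split_ifs with hs
    · exact hiso ⟨2 * s, (unitInterval.mul_pos_mem_iff zero_lt_two).2 ⟨s.2.1, hs⟩⟩
    · exact hiso' ⟨2 * s - 1, unitInterval.two_mul_sub_one_mem_iff.2 ⟨(not_le.1 hs).le, s.2.2⟩⟩
  · rw [← h0]
    simp
  · rw [← h1']
    simp

end Homotopy

section SpinHomotopy

variable {E H : Type*} [NormedAddCommGroup E] [NormedSpace ℝ E]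
  [TopologicalSpace H]
  {I : ModelWithCorners ℝ E H} {M : Type*} [TopologicalSpace M] [ChartedSpace H M]
  [IsManifold I 1 M] {n m : ℕ}

theorem continuous_spinDeriv :
    Continuous fun x : ((ℝ × ℝ) × EuclideanSpace ℝ (Fin (m + 1))) ×
        (ContactSpace (n + 1) × EuclideanSpace ℝ (Fin (m + 1))) =>
      spinDeriv x.1.1.1 x.1.1.2 x.1.2 x.2 := by
  simp only [spinDeriv_apply]
  refine (continuous_pi fun i => ?_).prodMk ((continuous_pi fun i => ?_).prodMk (by fun_prop)) <;>
    refine Fin.addCases (fun i => ?_) (fun i => ?_) i <;>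
    simp only [Fin.append_left, Fin.append_right] <;> fun_prop

/-- The inclusion of the tangent spaces of the sphere, pulled back to the product. -/
theorem continuous_sphereDeriv_snd :
    Continuous fun U : TangentBundle (I.prod (𝓡 m)) (M × UnitSphere m) =>
      sphereDeriv U.proj.2 U.snd.2 := by
  have h : ContMDiff (I.prod (𝓡 m)) 𝓘(ℝ, EuclideanSpace ℝ (Fin (m + 1))) 1
      (fun x : M × UnitSphere m => x.2.1) :=
    (contMDiff_sphere_val.of_le (by simp)).comp contMDiff_snd
  refine (continuous_vectorDeriv h).congr fun U => ?_
  have := ((hasVectorDerivAt_sphere_val U.proj.2).comp_snd (J := I) U.proj.1).vectorDeriv_eq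
  exact congrArg (fun A : E × EuclideanSpace ℝ (Fin m) →L[ℝ] _ => A U.snd) this

/-- The projection `T(M × S^m) → TM`. -/
def tangentFst (U : TangentBundle (I.prod (𝓡 m)) (M × UnitSphere m)) : TangentBundle I M :=
  ⟨U.proj.1, U.snd.1⟩

theorem continuous_tangentFst :
    Continuous (tangentFst : TangentBundle (I.prod (𝓡 m)) (M × UnitSphere m) →
      TangentBundle I M) := by
  refine ((contMDiff_fst (I := I) (J := 𝓡 m) (M := M) (N := UnitSphere m)
    (n := 1)).continuous_tangentMap le_rfl).congr fun U => ?_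
  exact tangentMap_prodFst

variable [FiniteDimensional ℝ E]

/-- The complexification of `spinDeriv` is fibrewise an isomorphism: its components along and
orthogonal to `σ` are those of the given isomorphism and multiplication by `a + i b`. -/
theorem bijOn_spinDeriv (hE : Module.finrank ℝ E = n + 1) {q : ContactSpace (n + 1)} {c a b : ℝ}
    (ha : a ≠ 0) (φ : E →ₗ[ℝ] ContactSpace (n + 1))
    (hφ : BijOn (fun u : E × E => φ u.1 + complexStructure q (φ u.2)) univ (contactPlane q))
    (σ : UnitSphere m) :
    BijOn (fun u : (E × EuclideanSpace ℝ (Fin m)) × (E × EuclideanSpace ℝ (Fin m)) =>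
        spinDeriv a b σ (φ u.1.1, sphereDeriv σ u.1.2) + complexStructure (spinPoint c (q, σ.1))
          (spinDeriv a b σ (φ u.2.1, sphereDeriv σ u.2.2)))
      univ (contactPlane (spinPoint c (q, σ.1))) := by
  have hmem : ∀ u, φ u ∈ contactPlane q := fun u => by
    have h := hφ.mapsTo (mem_univ (u, (0 : E)))
    have h0 : complexStructure q 0 = 0 := by simp [complexStructure]
    simpa [h0] using h
  let ψ : E × EuclideanSpace ℝ (Fin m) →ₗ[ℝ] ContactSpace (m + 1 + n) :=
    (spinDeriv a b σ.1).toLinearMap ∘ₗ φ.prodMap (sphereDeriv σ).toLinearMap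
  refine bijOn_add_complexStructure (by simp [hE]; ring) (spinPoint c (q, σ.1)) ψ
    (fun u => spinDeriv_mem_contactPlane c a b σ (hmem u.1) u.2) ?_
  rintro ⟨u, η⟩ ⟨w, θ⟩ h
  change spinDeriv a b σ (φ u, sphereDeriv σ η) + complexStructure (spinPoint c (q, σ.1))
    (spinDeriv a b σ (φ w, sphereDeriv σ θ)) = 0 at h
  rw [spinDeriv_apply, spinDeriv_apply] at h
  have hx : ∀ i, ((φ u).1 0 * σ.1 i + a * sphereDeriv σ η i) -
      ((φ w).2.1 0 * σ.1 i + b * sphereDeriv σ θ i) = 0 := fun i => by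
    simpa [complexStructure, sub_eq_add_neg] using
      congrFun (congrArg Prod.fst h) (Fin.castAdd n i)
  have hy : ∀ i, ((φ u).2.1 0 * σ.1 i + b * sphereDeriv σ η i) +
      ((φ w).1 0 * σ.1 i + a * sphereDeriv σ θ i) = 0 := fun i => by
    simpa [complexStructure] using congrFun (congrArg (fun w => w.2.1) h) (Fin.castAdd n i)
  have hx' : ∀ j : Fin n, (φ u).1 j.succ - (φ w).2.1 j.succ = 0 := fun j => by
    simpa [complexStructure, sub_eq_add_neg] using
      congrFun (congrArg Prod.fst h) (Fin.natAdd (m + 1) j)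
  have hy' : ∀ j : Fin n, (φ u).2.1 j.succ + (φ w).1 j.succ = 0 := fun j => by
    simpa [complexStructure] using congrFun (congrArg (fun w => w.2.1) h) (Fin.natAdd (m + 1) j)
  -- the component along `σ`
  have hproj : ∀ r s t : ℝ,
      (∀ i, r * σ.1 i + (s * sphereDeriv σ η i + t * sphereDeriv σ θ i) = 0) → r = 0 := by
    intro r s t hrst
    have h1 : ∑ i, (r * σ.1 i + (s * sphereDeriv σ η i + t * sphereDeriv σ θ i)) * σ.1 i = 0 := by
      simp [hrst]
    have h2 : ∑ i, (r * σ.1 i + (s * sphereDeriv σ η i + t * sphereDeriv σ θ i)) * σ.1 i =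
        r * ∑ i, σ.1 i ^ 2 + s * ∑ i, sphereDeriv σ η i * σ.1 i +
          t * ∑ i, sphereDeriv σ θ i * σ.1 i := by
      rw [Finset.mul_sum, Finset.mul_sum, Finset.mul_sum, ← Finset.sum_add_distrib,
        ← Finset.sum_add_distrib]
      exact Finset.sum_congr rfl fun i _ => by ring
    rw [h2, UnitSphere.sum_sq, sphereDeriv_orthogonal, sphereDeriv_orthogonal] at h1
    simpa using h1
  have hx0 : (φ u).1 0 - (φ w).2.1 0 = 0 := hproj _ a (-b) fun i => by linear_combination hx i
  have hy0 : (φ u).2.1 0 + (φ w).1 0 = 0 := hproj _ b a fun i => by linear_combination hy i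
  -- the components orthogonal to `σ` say that `(a + i b) (η + i θ) = 0`
  have hab : a ^ 2 + b ^ 2 ≠ 0 := by positivity
  have hη : sphereDeriv σ η = 0 := PiLp.ext fun i => by
    refine (mul_eq_zero.1 ?_ : a ^ 2 + b ^ 2 = 0 ∨ sphereDeriv σ η i = 0).resolve_left hab
    linear_combination a * hx i + b * hy i - a * σ.1 i * hx0 - b * σ.1 i * hy0
  have hθ : sphereDeriv σ θ = 0 := PiLp.ext fun i => by
    refine (mul_eq_zero.1 ?_ : a ^ 2 + b ^ 2 = 0 ∨ sphereDeriv σ θ i = 0).resolve_left hab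
    linear_combination a * hy i - b * hx i - a * σ.1 i * hy0 + b * σ.1 i * hx0
  have hzero : φ u + complexStructure q (φ w) = 0 := by
    refine eq_zero_of_mem_contactPlane (hφ.mapsTo (mem_univ (u, w)))
      (fun i => Fin.cases ?_ (fun j => ?_) i) (fun i => Fin.cases ?_ (fun j => ?_) i)
    · simpa [complexStructure, sub_eq_add_neg] using hx0
    · simpa [complexStructure, sub_eq_add_neg] using hx' j
    · simpa [complexStructure] using hy0
    · simpa [complexStructure] using hy' j
  have huw : (u, w) = ((0 : E), (0 : E)) := by
    refine hφ.injOn (mem_univ _) (mem_univ _) ?_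
    have h0 : complexStructure q 0 = 0 := by simp [complexStructure]
    simp [hzero, h0]
  obtain ⟨rfl, rfl⟩ := Prod.mk.inj huw
  rw [sphereDeriv_injective σ (hη.trans (map_zero _).symm),
    sphereDeriv_injective σ (hθ.trans (map_zero _).symm)]
  exact ⟨rfl, rfl⟩

/-- The spinning of a homotopy. On the tangent spaces of the sphere, the differentials of the two
spinnings are multiplication by the functions `x₁ + c + i y₁`, which take values in the right
half-plane and are connected there by a segment. -/
theorem FibreIsoHomotopic.frontSpin (hE : Module.finrank ℝ E = n + 1)
    {f g : M → ContactSpace (n + 1)}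
    (hf : ContMDiff I 𝓘(ℝ, ContactSpace (n + 1)) ∞ f)
    (hg : ContMDiff I 𝓘(ℝ, ContactSpace (n + 1)) ∞ g) {c c' : ℝ} (hc : ∀ p, 0 < (f p).1 0 + c)
    (hc' : ∀ p, 0 < (g p).1 0 + c')
    (h : FibreIsoHomotopic I
      (g, fun u => (mfderiv I 𝓘(ℝ, ContactSpace (n + 1)) g u.proj u.snd : ContactSpace (n + 1)))
      (f, fun u => (mfderiv I 𝓘(ℝ, ContactSpace (n + 1)) f u.proj u.snd : ContactSpace (n + 1)))) :
    FibreIsoHomotopic (I.prod (𝓡 m))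
      (frontSpin m c' g, fun u => (mfderiv (I.prod (𝓡 m)) 𝓘(ℝ, ContactSpace (m + 1 + n))
        (frontSpin m c' g) u.proj u.snd : ContactSpace (m + 1 + n)))
      (frontSpin m c f, fun u => (mfderiv (I.prod (𝓡 m)) 𝓘(ℝ, ContactSpace (m + 1 + n))
        (frontSpin m c f) u.proj u.snd : ContactSpace (m + 1 + n))) := by
  obtain ⟨B, Φ, hB, hΦ, hiso, h0, h1⟩ := h
  let cs : unitInterval → ℝ := fun s => (1 - s) * c' + s * c
  let a : unitInterval × M → ℝ := fun x =>
    (1 - x.1) * ((g x.2).1 0 + c') + x.1 * ((f x.2).1 0 + c)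
  let b : unitInterval × M → ℝ := fun x => (1 - x.1) * (g x.2).2.1 0 + x.1 * (f x.2).2.1 0
  have ha : ∀ x, a x ≠ 0 := fun x => ne_of_gt <| by
    have h2 := x.1.2.1
    have h3 := sub_nonneg.2 x.1.2.2
    have h4 := hc x.2
    have h5 := hc' x.2
    rcases h2.eq_or_lt with h6 | h6
    · simp only [a, ← h6]
      simpa using h5
    · have := mul_pos h6 h4
      have := mul_nonneg h3 h5.le
      simp only [a]
      linarith
  have hfc := hf.continuous
  have hgc := hg.continuous
  have hac : Continuous a := by fun_prop
  have hbc : Continuous b := by fun_prop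
  let B' : unitInterval × (M × UnitSphere m) → ContactSpace (m + 1 + n) := fun x =>
    spinPoint (cs x.1) (B (x.1, x.2.1), x.2.2.1)
  let Φ' : unitInterval × TangentBundle (I.prod (𝓡 m)) (M × UnitSphere m) →
      ContactSpace (m + 1 + n) := fun x =>
    spinDeriv (a (x.1, x.2.proj.1)) (b (x.1, x.2.proj.1)) x.2.proj.2.1
      (Φ (x.1, tangentFst x.2), sphereDeriv x.2.proj.2 x.2.snd.2)
  have hB' : Continuous B' := by
    refine (continuous_pi fun i => ?_).prodMk ((continuous_pi fun i => ?_).prodMk (by fun_prop)) <;>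
      refine Fin.addCases (fun i => ?_) (fun i => ?_) i <;>
      simp only [Fin.append_left, Fin.append_right, cs] <;> fun_prop
  have hΦ' : Continuous Φ' := by
    have hproj : Continuous fun x : unitInterval ×
        TangentBundle (I.prod (𝓡 m)) (M × UnitSphere m) => x.2.proj :=
      (FiberBundle.continuous_proj (E × EuclideanSpace ℝ (Fin m))
        (TangentSpace (I.prod (𝓡 m)) : M × UnitSphere m → Type _)).comp continuous_snd
    have hpM : Continuous fun x : unitInterval ×
        TangentBundle (I.prod (𝓡 m)) (M × UnitSphere m) => (x.1, x.2.proj.1) :=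
      continuous_fst.prodMk (continuous_fst.comp hproj)
    exact continuous_spinDeriv.comp
      ((((hac.comp hpM).prodMk (hbc.comp hpM)).prodMk
        (continuous_subtype_val.comp (continuous_snd.comp hproj))).prodMk
        ((hΦ.comp (continuous_fst.prodMk (continuous_tangentFst.comp continuous_snd))).prodMk
          (continuous_sphereDeriv_snd.comp continuous_snd)))
  refine ⟨B', Φ', hB', hΦ', fun s => ⟨by fun_prop, by fun_prop, ?_, ?_⟩, ?_, ?_⟩
  · rintro ⟨p, σ⟩
    have hl := (hiso s).linear p
    let φ : E →ₗ[ℝ] ContactSpace (n + 1) := IsLinearMap.mk' (fun u : E => Φ (s, ⟨p, u⟩)) hl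
    exact ((spinDeriv (a (s, p)) (b (s, p)) σ.1).toLinearMap ∘ₗ
      φ.prodMap (sphereDeriv σ).toLinearMap).isLinear
  · rintro ⟨p, σ⟩
    have hl := (hiso s).linear p
    let φ : E →ₗ[ℝ] ContactSpace (n + 1) := IsLinearMap.mk' (fun u : E => Φ (s, ⟨p, u⟩)) hl
    have hφ : BijOn (fun u : E × E => φ u.1 + complexStructure (B (s, p)) (φ u.2)) univ
        (contactPlane (B (s, p))) := (hiso s).bijective p
    have key := bijOn_spinDeriv (c := cs s) (b := b (s, p)) hE (ha (s, p)) φ hφ σ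
    exact key
  · refine Prod.ext (funext fun x => ?_) (funext fun U => ?_)
    · have := congrFun (congrArg Prod.fst h0) x.1
      dsimp only at this
      simp only [B', cs, this]
      simp [spinPoint, _root_.frontSpin]
    · have := congrFun (congrArg Prod.snd h0) (tangentFst U)
      refine Eq.trans ?_ (vectorDeriv_frontSpin hg c' U.proj.1 U.proj.2 U.snd.1 U.snd.2).symm
      simp only [Φ', a, b]
      dsimp only at this
      rw [this]
      simp
      rfl
  · refine Prod.ext (funext fun x => ?_) (funext fun U => ?_)
    · have := congrFun (congrArg Prod.fst h1) x.1
      dsimp only at this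
      simp only [B', cs, this]
      simp [spinPoint, _root_.frontSpin]
    · have := congrFun (congrArg Prod.snd h1) (tangentFst U)
      refine Eq.trans ?_ (vectorDeriv_frontSpin hf c U.proj.1 U.proj.2 U.snd.1 U.snd.2).symm
      simp only [Φ', a, b]
      dsimp only at this
      rw [this]
      simp
      rfl

/-- Rotation classes are equivalence classes that contain the differentials, so that it is enough to
spin a homotopy between the differentials of `g` and `f`. -/
theorem rotationClass_frontSpin_eq [CompactSpace M] [I.Boundaryless] [IsManifold I 2 M]
    {f g : M → ContactSpace (n + 1)} (hf : IsLegendrianEmbedding I f)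
    (hg : IsLegendrianEmbedding I g) {c c' : ℝ} (hc : ∀ p, 0 < (f p).1 0 + c)
    (hc' : ∀ p, 0 < (g p).1 0 + c') (h : rotationClass I g = rotationClass I f) :
    rotationClass (I.prod (𝓡 m)) (frontSpin m c' g) =
      rotationClass (I.prod (𝓡 m)) (frontSpin m c f) := by
  have hmem : FibreIsoHomotopic I
      (g, fun u => (mfderiv I 𝓘(ℝ, ContactSpace (n + 1)) g u.proj u.snd : ContactSpace (n + 1)))
      (f, fun u => (mfderiv I 𝓘(ℝ, ContactSpace (n + 1)) f u.proj u.snd : ContactSpace (n + 1))) :=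
    h.ge (FibreIsoHomotopic.refl hf.isComplexFibreIso)
  have hspin := hmem.frontSpin (m := m) hf.dim hf.smooth hg.smooth hc hc'
  ext x
  exact ⟨hspin.symm.trans, hspin.trans⟩

end SpinHomotopy

/-! ### The linking determinant of a spinning -/

section Shuffle

variable {N : ℕ}

/-- The position of each column of the linking determinant in the coordinate order: `∂_z` is first
among the columns `∂_z, ∂_{x₁}, …, ∂_{y₁}, …` and last in the order `x₁, y₁, …, z`. -/
def shuffle (N : ℕ) : Fin (N + N + 1) → Fin (N + N + 1) :=
  Fin.cons (Fin.last (N + N)) (Fin.append (fun i : Fin N => ⟨2 * i, by omega⟩)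
    (fun i : Fin N => ⟨2 * i + 1, by omega⟩))

theorem shuffle_zero : shuffle N 0 = Fin.last (N + N) := rfl

theorem shuffle_left (i : Fin N) :
    shuffle N (Fin.castAdd N i).succ = ⟨2 * i, by omega⟩ := by
  rw [shuffle, Fin.cons_succ, Fin.append_left]

theorem shuffle_right (i : Fin N) :
    shuffle N (Fin.natAdd N i).succ = ⟨2 * i + 1, by omega⟩ := by
  rw [shuffle, Fin.cons_succ, Fin.append_right]

theorem shuffle_injective : Function.Injective (shuffle N) := by
  have hlast : ∀ i : Fin (N + N), (shuffle N i.succ).1 < N + N := fun i => by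
    refine Fin.addCases (fun i => ?_) (fun i => ?_) i
    · simp only [shuffle_left]
      omega
    · simp only [shuffle_right]
      omega
  intro a b
  refine Fin.cases (Fin.cases (fun _ => rfl) (fun b h => ?_) b)
    (fun a => Fin.cases (fun h => ?_) (fun b h => ?_) b) a
  · exact absurd (congrArg Fin.val h).symm (hlast b).ne
  · exact absurd (congrArg Fin.val h) (hlast a).ne
  · congr 1
    revert h
    refine Fin.addCases (fun a => ?_) (fun a => ?_) a <;>
      refine Fin.addCases (fun b => ?_) (fun b => ?_) b <;>
      simp only [shuffle_left, shuffle_right, Fin.ext_iff, Fin.val_castAdd, Fin.val_natAdd] <;>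
      omega

/-- `shuffle` as a permutation. -/
def shufflePerm (N : ℕ) : Equiv.Perm (Fin (N + N + 1)) :=
  Equiv.ofBijective (shuffle N) (Finite.injective_iff_bijective.1 shuffle_injective)

theorem shufflePerm_apply (i : Fin (N + N + 1)) : shufflePerm N i = shuffle N i := rfl

/-- The inversions of `shuffle` are `∂_z` with each of the `2N` other columns, an even number, and
`∂_{xᵢ}` with `∂_{yⱼ}` for `j < i`. -/
theorem sign_shufflePerm : (Equiv.Perm.sign (shufflePerm N) : ℤ) = (-1) ^ (N * (N - 1) / 2) := by
  have h : Equiv.Perm.sign (shufflePerm N) = ∏ i, ∏ j,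
      (if i < j ∧ shuffle N j < shuffle N i then -1 else 1 : ℤˣ) := by
    rw [Equiv.Perm.sign_eq_prod_prod_Ioi]
    refine Finset.prod_congr rfl fun i _ => ?_
    rw [← Finset.prod_subset (Finset.subset_univ (Finset.Ioi i))]
    · refine Finset.prod_congr rfl fun j hj => ?_
      have hij : i < j := Finset.mem_Ioi.1 hj
      have hne : shuffle N i ≠ shuffle N j := fun h => hij.ne (shuffle_injective h)
      rw [shufflePerm_apply, shufflePerm_apply]
      rcases lt_or_gt_of_ne hne with h | h
      · rw [if_pos h, if_neg fun h' => h.not_gt h'.2]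
      · rw [if_neg h.not_gt, if_pos ⟨hij, h⟩]
    · intro j _ hj
      rw [if_neg fun h => hj (Finset.mem_Ioi.2 h.1)]
  rw [h, Fin.prod_univ_succ, Fin.prod_univ_succ, Fin.prod_univ_add]
  simp only [Fin.prod_univ_succ (n := N + N), Fin.prod_univ_add, shuffle_zero, shuffle_left,
    shuffle_right, Fin.lt_def, Fin.val_last, Fin.val_succ, Fin.val_castAdd, Fin.val_natAdd,
    Fin.val_zero]
  -- which pairs of columns are inverted
  have e1 : ∀ i : Fin N, 2 * i.1 < N + N := fun i => by omega
  have e2 : ∀ i : Fin N, 2 * i.1 + 1 < N + N := fun i => by omega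
  have e3 : ∀ i j : Fin N, ¬ (i.1 + 1 < j.1 + 1 ∧ 2 * j.1 < 2 * i.1) := fun i j => by omega
  have e4 : ∀ i j : Fin N, ¬ (N + i.1 + 1 < j.1 + 1 ∧ 2 * j.1 < 2 * i.1 + 1) := fun i j => by omega
  have e5 : ∀ i j : Fin N, ¬ (N + i.1 + 1 < N + j.1 + 1 ∧ 2 * j.1 + 1 < 2 * i.1 + 1) :=
    fun i j => by omega
  have e6 : ∀ i j : Fin N, (i.1 + 1 < N + j.1 + 1 ∧ 2 * j.1 + 1 < 2 * i.1) ↔ j < i :=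
    fun i j => by rw [Fin.lt_def]; omega
  have hcount : ∀ i : Fin N, ∏ j : Fin N, (if j < i then -1 else 1 : ℤˣ) = (-1) ^ i.1 := fun i => by
    rw [Finset.prod_ite, Finset.prod_const_one, mul_one, Finset.prod_const]
    congr 1
    rw [Finset.filter_gt_eq_Iio, Fin.card_Iio]
  simp only [e1, e2, e3, e4, e5, e6, hcount, if_false, Finset.prod_const_one, mul_one, one_mul,
    Nat.not_lt_zero, false_and, Nat.zero_lt_succ, true_and, if_true, Finset.prod_const,
    Finset.card_univ, Fintype.card_fin, lt_self_iff_false]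
  rw [Finset.prod_pow_eq_pow_sum, Fin.sum_univ_eq_sum_range (fun i => i), Finset.sum_range_id,
    ← mul_pow]
  simp

/-- The standard basis of `ℝ^{2N+1}`, with the coordinates in the order `x`, `y`, `z`. -/
def productBasis (N : ℕ) : Module.Basis (Fin N ⊕ (Fin N ⊕ Fin 1)) ℝ (ContactSpace N) :=
  (Pi.basisFun ℝ (Fin N)).prod ((Pi.basisFun ℝ (Fin N)).prod (Module.Basis.singleton (Fin 1) ℝ))

/-- The columns of the linking determinant, indexed by the rows of the `productBasis`. -/
def columnIndex (N : ℕ) : Fin N ⊕ (Fin N ⊕ Fin 1) → Fin (N + N + 1) :=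
  Sum.elim (fun i => (Fin.castAdd N i).succ)
    (Sum.elim (fun i => (Fin.natAdd N i).succ) (fun _ => 0))

theorem columnIndex_bijective : Function.Bijective (columnIndex N) := by
  refine (Fintype.bijective_iff_injective_and_card _).2 ⟨?_, by simp; ring⟩
  rintro (a | a | a) (b | b | b) h <;>
    simp only [columnIndex, Sum.elim_inl, Sum.elim_inr, Fin.ext_iff, Fin.val_succ,
      Fin.val_castAdd, Fin.val_natAdd, Fin.val_zero] at h
  · rw [Fin.ext (by omega : a.1 = b.1)]
  · omega
  · omega
  · omega
  · rw [Fin.ext (by omega : a.1 = b.1)]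
  · omega
  · omega
  · omega
  · rw [Subsingleton.elim a b]

theorem coord_two_mul (w : ContactSpace N) (i : Fin N) : coord w ⟨2 * i, by omega⟩ = w.1 i := by
  have h1 : 2 * i.1 / 2 < N := by omega
  have h2 : 2 * i.1 % 2 = 0 := by omega
  simp only [coord, h1, h2, dif_pos, if_pos]
  exact congrArg w.1 (Fin.ext (by dsimp only; omega))

theorem coord_two_mul_add_one (w : ContactSpace N) (i : Fin N) :
    coord w ⟨2 * i + 1, by omega⟩ = w.2.1 i := by
  have h1 : (2 * i.1 + 1) / 2 < N := by omega
  have h2 : ¬ (2 * i.1 + 1) % 2 = 0 := by omega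
  simp only [coord, h1, h2, dif_pos, if_false]
  exact congrArg w.2.1 (Fin.ext (by dsimp only; omega))

theorem coord_last (w : ContactSpace N) : coord w (Fin.last (N + N)) = w.2.2 := by
  have h1 : ¬ (N + N) / 2 < N := by omega
  simp [coord, h1]

theorem contactBasis_eq_reindex :
    contactBasis N = (productBasis N).reindex
      ((Equiv.ofBijective (columnIndex N) columnIndex_bijective).trans (shufflePerm N)) := by
  refine Module.Basis.eq_ofRepr_eq_repr fun w r => ?_
  obtain ⟨s, rfl⟩ := ((Equiv.ofBijective (columnIndex N) columnIndex_bijective).trans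
    (shufflePerm N)).surjective r
  rw [Module.Basis.repr_reindex_apply, Equiv.symm_apply_apply, contactBasis_repr]
  change coord w (shuffle N (columnIndex N s)) = _
  rcases s with i | i | i
  · exact ((congrArg (coord w) (shuffle_left i)).trans (coord_two_mul w i)).trans
      (by simp [productBasis])
  · exact ((congrArg (coord w) (shuffle_right i)).trans (coord_two_mul_add_one w i)).trans
      (by simp [productBasis])
  · exact (coord_last w).trans (by simp [productBasis])

/-- The sign of the shuffle relates the order `(x₁, y₁, …, z)` to the order `(x, y, z)`. -/
theorem contactBasis_det_cons_append (A B : Fin N → ContactSpace N) (v : ContactSpace N) :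
    (contactBasis N).det (Fin.cons v (Fin.append A B)) =
      (-1) ^ (N * (N - 1) / 2) * (productBasis N).det (Sum.elim A (Sum.elim B fun _ => v)) := by
  set t : Fin (N + N + 1) → ContactSpace N := Fin.cons v (Fin.append A B) with ht
  have h1 : (contactBasis N).det t =
      Equiv.Perm.sign (shufflePerm N) • (contactBasis N).det (t ∘ (shufflePerm N).symm) := by
    rw [← AlternatingMap.map_perm, Function.comp_assoc, Equiv.symm_comp_self, Function.comp_id]
  have h2 : (contactBasis N).det (t ∘ (shufflePerm N).symm) =
      (productBasis N).det (Sum.elim A (Sum.elim B fun _ => v)) := by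
    rw [contactBasis_eq_reindex, Module.Basis.det_reindex]
    congr 1
    funext s
    simp only [Function.comp_apply, Equiv.trans_apply, Equiv.symm_apply_apply,
      Equiv.ofBijective_apply]
    rcases s with i | i | i
    · exact Fin.append_left _ _ i
    · exact Fin.append_right _ _ i
    · rfl
  rw [h1, h2, Units.smul_def, sign_shufflePerm, zsmul_eq_mul]
  simp

end Shuffle

section SpinSplit

variable {n m : ℕ}

/-- The splitting of the tangent space of `ℝ^{2(n+m)+3}` at a point of a spinning into the part
spanned by the radial direction `σ` of the sphere and the remaining coordinates, which is a copy of
`ℝ^{2n+3}`, and two copies of the tangent space of the sphere, in the `x`- and `y`-coordinates. -/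
def spinSplit (σ : UnitSphere m) :
    ContactSpace (n + 1) × (EuclideanSpace ℝ (Fin m) × EuclideanSpace ℝ (Fin m)) →ₗ[ℝ]
      ContactSpace (m + 1 + n) where
  toFun u :=
    (Fin.append (fun i => u.1.1 0 * σ.1 i + sphereDeriv σ u.2.1 i) (fun j => u.1.1 j.succ),
      Fin.append (fun i => u.1.2.1 0 * σ.1 i + sphereDeriv σ u.2.2 i) (fun j => u.1.2.1 j.succ),
      u.1.2.2)
  map_add' u v := by
    refine Prod.ext (funext fun i => ?_) (Prod.ext (funext fun i => ?_) rfl) <;>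
      refine Fin.addCases (fun i => ?_) (fun i => ?_) i <;> simp <;> ring
  map_smul' r u := by
    refine Prod.ext (funext fun i => ?_) (Prod.ext (funext fun i => ?_) rfl) <;>
      refine Fin.addCases (fun i => ?_) (fun i => ?_) i <;> simp <;> ring

theorem spinSplit_apply (σ : UnitSphere m) (u : ContactSpace (n + 1) ×
    (EuclideanSpace ℝ (Fin m) × EuclideanSpace ℝ (Fin m))) :
    spinSplit σ u =
      (Fin.append (fun i => u.1.1 0 * σ.1 i + sphereDeriv σ u.2.1 i) (fun j => u.1.1 j.succ),
        Fin.append (fun i => u.1.2.1 0 * σ.1 i + sphereDeriv σ u.2.2 i)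
          (fun j => u.1.2.1 j.succ), u.1.2.2) := rfl

theorem spinDeriv_eq_spinSplit (a b : ℝ) (σ : UnitSphere m) (w : ContactSpace (n + 1))
    (η : EuclideanSpace ℝ (Fin m)) :
    spinDeriv a b σ (w, sphereDeriv σ η) = spinSplit σ (w, a • η, b • η) := by
  simp [spinDeriv_apply, spinSplit_apply]

theorem spinSplit_injective (σ : UnitSphere m) :
    Function.Injective (spinSplit σ : ContactSpace (n + 1) × _ →ₗ[ℝ] _) := by
  refine (injective_iff_map_eq_zero _).2 ?_
  rintro ⟨w, ξ, ζ⟩ h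
  rw [spinSplit_apply] at h
  have hx : ∀ i, w.1 0 * σ.1 i + sphereDeriv σ ξ i = 0 := fun i => by
    simpa using congrFun (congrArg Prod.fst h) (Fin.castAdd n i)
  have hx' : ∀ j : Fin n, w.1 j.succ = 0 := fun j => by
    simpa using congrFun (congrArg Prod.fst h) (Fin.natAdd (m + 1) j)
  have hy : ∀ i, w.2.1 0 * σ.1 i + sphereDeriv σ ζ i = 0 := fun i => by
    simpa using congrFun (congrArg (fun w => w.2.1) h) (Fin.castAdd n i)
  have hy' : ∀ j : Fin n, w.2.1 j.succ = 0 := fun j => by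
    simpa using congrFun (congrArg (fun w => w.2.1) h) (Fin.natAdd (m + 1) j)
  have hz : w.2.2 = 0 := congrArg (fun w => w.2.2) h
  have hproj : ∀ (a : ℝ) (η : EuclideanSpace ℝ (Fin m)),
      (∀ i, a * σ.1 i + sphereDeriv σ η i = 0) → a = 0 ∧ η = 0 := by
    intro a η hab
    have h1 : ∑ i, (a * σ.1 i + sphereDeriv σ η i) * σ.1 i = 0 := by simp [hab]
    have h2 : ∑ i, (a * σ.1 i + sphereDeriv σ η i) * σ.1 i =
        a * ∑ i, σ.1 i ^ 2 + ∑ i, sphereDeriv σ η i * σ.1 i := by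
      rw [Finset.mul_sum, ← Finset.sum_add_distrib]
      exact Finset.sum_congr rfl fun i _ => by ring
    rw [h2, UnitSphere.sum_sq, sphereDeriv_orthogonal, mul_one, add_zero] at h1
    subst h1
    refine ⟨rfl, sphereDeriv_injective σ (Eq.trans (PiLp.ext fun i => ?_) (map_zero _).symm)⟩
    simpa using hab i
  obtain ⟨hx0, rfl⟩ := hproj _ _ hx
  obtain ⟨hy0, rfl⟩ := hproj _ _ hy
  exact Prod.ext (Prod.ext (funext fun i => Fin.cases hx0 hx' i)
    (Prod.ext (funext fun i => Fin.cases hy0 hy' i) hz)) rfl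

/-- The determinant of multiplication by a matrix with rows `(a, a')` and `(b, b')` on `E × E`. -/
theorem det_prod_smul_smul {ι E : Type*} [Fintype ι] [DecidableEq ι] [AddCommGroup E] [Module ℝ E]
    (e : Module.Basis ι ℝ E) {a : ℝ} (b a' b' : ℝ) (ha : a ≠ 0) :
    (e.prod e).det (Sum.elim (fun j => (a • e j, b • e j)) (fun j => (a' • e j, b' • e j))) =
      (a * b' - a' * b) ^ Fintype.card ι := by
  have h : (e.prod e).toMatrix
      (Sum.elim (fun j => (a • e j, b • e j)) (fun j => (a' • e j, b' • e j))) =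
      Matrix.fromBlocks (a • 1) (a' • 1) (b • 1) (b' • 1) := by
    ext i j
    rcases i with i | i <;> rcases j with j | j <;>
      simp [Module.Basis.toMatrix_apply, Matrix.one_apply, Finsupp.single_apply, eq_comm]
  let inv : Invertible (a • (1 : Matrix ι ι ℝ)) :=
    ⟨a⁻¹ • 1, by simp [smul_smul, ha], by simp [smul_smul, ha]⟩
  have hinv : ⅟(a • (1 : Matrix ι ι ℝ)) = a⁻¹ • 1 := rfl
  rw [Module.Basis.det_apply, h, Matrix.det_fromBlocks₁₁, hinv]
  simp only [Matrix.mul_smul, smul_smul, ← sub_smul,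
    Matrix.det_smul, Matrix.det_one, mul_one, ← mul_pow]
  congr 1
  field_simp

/-- The rows and columns of the linking determinant of a spinning, split into those of the original
and those of the sphere. -/
def splitIndex (ord : Fin (n + 1) ⊕ Fin m ≃ Fin (m + 1 + n)) :
    (Fin (n + 1) ⊕ (Fin (n + 1) ⊕ Fin 1)) ⊕ (Fin m ⊕ Fin m) →
      Fin (m + 1 + n) ⊕ (Fin (m + 1 + n) ⊕ Fin 1) :=
  Sum.elim
    (Sum.elim (fun i => Sum.inl (ord (Sum.inl i)))
      (Sum.elim (fun i => Sum.inr (Sum.inl (ord (Sum.inl i)))) (fun i => Sum.inr (Sum.inr i))))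
    (Sum.elim (fun j => Sum.inl (ord (Sum.inr j))) (fun j => Sum.inr (Sum.inl (ord (Sum.inr j)))))

theorem splitIndex_bijective (ord : Fin (n + 1) ⊕ Fin m ≃ Fin (m + 1 + n)) :
    Function.Bijective (splitIndex ord) := by
  refine (Fintype.bijective_iff_injective_and_card _).2 ⟨?_, by simp; ring⟩
  rintro ((a | a | a) | (a | a)) ((b | b | b) | (b | b)) h <;> simp_all [splitIndex]

/-- The determinant of the splitting is a square, since the sphere contributes its tangent space
once to the `x`-coordinates and once to the `y`-coordinates. -/
theorem productBasis_det_spinSplit_pos (ord : Fin (n + 1) ⊕ Fin m ≃ Fin (m + 1 + n))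
    (e : Module.Basis (Fin m) ℝ (EuclideanSpace ℝ (Fin m))) (σ : UnitSphere m) :
    0 < ((productBasis (m + 1 + n)).reindex
        (Equiv.ofBijective _ (splitIndex_bijective ord)).symm).det
      (fun s => spinSplit σ (((productBasis (n + 1)).prod (e.prod e)) s)) := by
  set Ξ := Equiv.ofBijective _ (splitIndex_bijective ord) with hΞ
  set b := (productBasis (n + 1)).prod (e.prod e) with hb
  have hne : ((productBasis (m + 1 + n)).reindex Ξ.symm).det (fun s => spinSplit σ (b s)) ≠ 0 := by
    let T := LinearEquiv.ofInjectiveOfFinrankEq (spinSplit σ) (spinSplit_injective (n := n) σ)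
      (by simp; ring)
    exact (((productBasis (m + 1 + n)).reindex Ξ.symm).isUnit_det (b.map T)).ne_zero
  let τ : Fin (n + 1) ⊕ Fin m → (Fin (m + 1 + n) → ℝ) :=
    Sum.elim
      (fun k => Fin.append (fun i => (Pi.single k 1 : Fin (n + 1) → ℝ) 0 * σ.1 i)
        (fun j => (Pi.single k 1 : Fin (n + 1) → ℝ) j.succ))
      (fun j => Fin.append (fun i => sphereDeriv σ (e j) i) (fun _ => 0))
  let t : Fin (m + 1 + n) → (Fin (m + 1 + n) → ℝ) := τ ∘ ord.symm
  have happ : ∀ a b : ℕ, Fin.append (fun _ : Fin a => (0 : ℝ)) (fun _ : Fin b => 0) = 0 :=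
    fun a b => funext fun i => by refine Fin.addCases (fun i => ?_) (fun i => ?_) i <;> simp
  -- the `x`- and the `y`-coordinates of the columns are both given by the square matrix `t`
  have hcols : (fun s => spinSplit σ (b s)) = (Sum.elim (fun i => (t i, 0))
      (fun j => (0, Sum.elim (fun i => (t i, (0 : ℝ)))
        (fun i => (0, Module.Basis.singleton (Fin 1) ℝ i)) j)) :
      Fin (m + 1 + n) ⊕ (Fin (m + 1 + n) ⊕ Fin 1) → ContactSpace (m + 1 + n)) ∘ Ξ := by
    funext s
    rcases s with (k | k | k) | (j | j)
    all_goals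
      simp [hb, hΞ, splitIndex, productBasis, spinSplit_apply, t, τ, happ]
  have hdet : ((productBasis (m + 1 + n)).reindex Ξ.symm).det (fun s => spinSplit σ (b s)) =
      (Pi.basisFun ℝ (Fin (m + 1 + n))).det t * (Pi.basisFun ℝ (Fin (m + 1 + n))).det t := by
    rw [Module.Basis.det_reindex, hcols, Function.comp_assoc, Equiv.self_comp_symm,
      Function.comp_id, productBasis, Module.Basis.det_prod_sumElim,
      Module.Basis.det_prod_sumElim, Module.Basis.det_self, mul_one]
  rw [hdet] at hne ⊢
  exact lt_of_le_of_ne (mul_self_nonneg _) hne.symm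

end SpinSplit

section SpinDet

variable {n m : ℕ}

/-- The columns of the linking determinant of a spinning, at two points over `σ`, are images under
`spinSplit σ` of columns of a block matrix. One block is the linking determinant of the original,
the other one the `m`-th power of a determinant of size two. -/
theorem productBasis_det_spin (ord : Fin (n + 1) ⊕ Fin m ≃ Fin (m + 1 + n))
    (e : Module.Basis (Fin m) ℝ (EuclideanSpace ℝ (Fin m))) (σ : UnitSphere m)
    (A B : Fin (n + 1) → ContactSpace (n + 1)) (w : ContactSpace (n + 1))
    {a : ℝ} (b a' b' : ℝ) (ha : a ≠ 0) (A' B' : Fin (m + 1 + n) → ContactSpace (m + 1 + n))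
    (hA : ∀ i, A' (ord (Sum.inl i)) = spinSplit σ (A i, 0, 0))
    (hA' : ∀ j, A' (ord (Sum.inr j)) = spinSplit σ (0, a • e j, b • e j))
    (hB : ∀ i, B' (ord (Sum.inl i)) = spinSplit σ (B i, 0, 0))
    (hB' : ∀ j, B' (ord (Sum.inr j)) = spinSplit σ (0, a' • e j, b' • e j)) :
    SignType.sign ((productBasis (m + 1 + n)).det
        (Sum.elim A' (Sum.elim B' fun _ => spinSplit σ (w, 0, 0)))) =
      SignType.sign ((productBasis (n + 1)).det (Sum.elim A (Sum.elim B fun _ => w))) *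
        SignType.sign (a * b' - a' * b) ^ m := by
  set Ξ := Equiv.ofBijective _ (splitIndex_bijective ord) with hΞ
  have hcols : Sum.elim A' (Sum.elim B' fun _ => spinSplit σ (w, 0, 0)) = (fun s => spinSplit σ
      (Sum.elim (fun s => (Sum.elim A (Sum.elim B fun _ => w) s, 0))
        (fun s => (0, Sum.elim (fun j => (a • e j, b • e j)) (fun j => (a' • e j, b' • e j)) s))
        s)) ∘ Ξ.symm := by
    refine (Equiv.eq_comp_symm Ξ _ _).2 ?_
    funext s
    rcases s with (k | k | k) | (j | j) <;>
      simp [hΞ, splitIndex, hA, hA', hB, hB'] <;> rfl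
  rw [hcols, ← Module.Basis.det_reindex, Module.Basis.det_comp_eq_mul _ (spinSplit σ)
    ((productBasis (n + 1)).prod (e.prod e)), sign_mul,
    sign_pos (productBasis_det_spinSplit_pos ord e σ), one_mul, Module.Basis.det_prod_sumElim,
    det_prod_smul_smul e b a' b' ha, sign_mul, sign_pow, Fintype.card_fin]

variable {E H : Type*} [NormedAddCommGroup E] [NormedSpace ℝ E] [TopologicalSpace H]
  {I : ModelWithCorners ℝ E H} {M : Type*} [TopologicalSpace M] [ChartedSpace H M]
  [IsManifold I 1 M]

/-- The sign by which the coordinate order `(x₁, y₁, …, x_N, y_N, z)` differs from `(x, y, z)`. -/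
def shuffleSign (N : ℕ) : ℤ := (-1) ^ (N * (N - 1) / 2)

/-- The linking determinant in the coordinate order `x`, `y`, `z` and with the columns of `f`, those
of `g`, and `v`, in which it splits into blocks for a spinning. -/
theorem sign_linkingDet_eq {N : ℕ} (o : ManifoldOrientation I M N) (f g : M → ContactSpace N)
    (v : ContactSpace N) (pq : M × M) :
    (SignType.sign (linkingDet I o f g v pq) : ℤ) = shuffleSign N *
      SignType.sign ((productBasis N).det (Sum.elim (fun i => vectorDeriv I f pq.1 (o.basis pq.1 i))
        (Sum.elim (fun i => vectorDeriv I g pq.2 (o.basis pq.2 i)) fun _ => v))) := by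
  rw [linkingDet_eq_det, contactBasis_det_cons_append, sign_mul, sign_pow,
    sign_neg (by norm_num : (-1 : ℝ) < 0), SignType.coe_mul, shuffleSign]
  simp

variable [I.Boundaryless]

/-- At a pair of points of a spinning over the same point of the sphere, the linking determinant is
the product of the one of the original and the determinants, in the plane of `x₁` and `y₁`, of
the two points for each direction tangent to the sphere. -/
theorem sign_linkingDet_frontSpin (o : ManifoldOrientation I M (n + 1))
    (o' : ManifoldOrientation (𝓡 m) (UnitSphere m) m)
    (ord : Fin (n + 1) ⊕ Fin m ≃ Fin (m + 1 + n)) {f g : M → ContactSpace (n + 1)}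
    (hf : ContMDiff I 𝓘(ℝ, ContactSpace (n + 1)) ∞ f)
    (hg : ContMDiff I 𝓘(ℝ, ContactSpace (n + 1)) ∞ g) {c : ℝ} {p : M} (hp : (f p).1 0 + c ≠ 0)
    (q : M) (σ : UnitSphere m) (w : ContactSpace (n + 1)) :
    (SignType.sign (linkingDet (I.prod (𝓡 m)) (o.prod o' ord) (frontSpin m c f) (frontSpin m c g)
        (spinSplit σ (w, 0, 0)) ((p, σ), (q, σ))) : ℤ) =
      shuffleSign (m + 1 + n) * shuffleSign (n + 1) *
        SignType.sign (linkingDet I o f g w (p, q)) *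
        (SignType.sign (((f p).1 0 + c) * (g q).2.1 0 -
          ((g q).1 0 + c) * (f p).2.1 0) : ℤ) ^ m := by
  have hbasis : ∀ (r : M) (k : Fin (n + 1) ⊕ Fin m), (o.prod o' ord).basis (r, σ) (ord k) =
      (o.basis r).prod (o'.basis σ) k := fun r k => by
    change (((o.basis r).prod (o'.basis σ)).reindex ord) (ord k) = _
    simp
  have hcol : ∀ {h : M → ContactSpace (n + 1)}
      (_ : ContMDiff I 𝓘(ℝ, ContactSpace (n + 1)) ∞ h) (r : M) (i : Fin (n + 1)),
      vectorDeriv (I.prod (𝓡 m)) (frontSpin m c h) (r, σ)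
          ((o.prod o' ord).basis (r, σ) (ord (Sum.inl i))) =
        spinSplit σ (vectorDeriv I h r (o.basis r i), 0, 0) := fun hh r i => by
    rw [hbasis, Module.Basis.prod_apply]
    refine (vectorDeriv_frontSpin hh c r σ (o.basis r i) 0).trans ?_
    rw [spinDeriv_eq_spinSplit, smul_zero, smul_zero]
  have hcol' : ∀ {h : M → ContactSpace (n + 1)}
      (_ : ContMDiff I 𝓘(ℝ, ContactSpace (n + 1)) ∞ h) (r : M) (j : Fin m),
      vectorDeriv (I.prod (𝓡 m)) (frontSpin m c h) (r, σ)
          ((o.prod o' ord).basis (r, σ) (ord (Sum.inr j))) =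
        spinSplit σ (0, ((h r).1 0 + c) • o'.basis σ j, (h r).2.1 0 • o'.basis σ j) :=
      fun hh r j => by
    rw [hbasis, Module.Basis.prod_apply]
    refine (vectorDeriv_frontSpin hh c r σ 0 (o'.basis σ j)).trans ?_
    rw [spinDeriv_eq_spinSplit, map_zero]
  rw [sign_linkingDet_eq, productBasis_det_spin ord (o'.basis σ) σ
    (fun i => vectorDeriv I f p (o.basis p i)) (fun i => vectorDeriv I g q (o.basis q i)) w
    ((f p).2.1 0) ((g q).1 0 + c) ((g q).2.1 0) hp _ _ (hcol hf p) (hcol' hf p) (hcol hg q)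
    (hcol' hg q), sign_linkingDet_eq o f g w (p, q), SignType.coe_mul]
  have hs : shuffleSign (n + 1) * shuffleSign (n + 1) = 1 := neg_one_pow_mul_neg_one_pow _
  have hpow : ∀ (s : SignType) (k : ℕ), ((s ^ k : SignType) : ℤ) = (s : ℤ) ^ k := fun s k =>
    map_pow SignType.castHom s k
  rw [hpow]
  linear_combination (-shuffleSign (m + 1 + n) * (SignType.sign ((productBasis (n + 1)).det
    (Sum.elim (fun i => vectorDeriv I f p (o.basis p i))
      (Sum.elim (fun i => vectorDeriv I g q (o.basis q i)) fun _ => w))) : ℤ) *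
    (SignType.sign (((f p).1 0 + c) * (g q).2.1 0 - ((g q).1 0 + c) * (f p).2.1 0) : ℤ) ^ m) * hs

end SpinDet

/-! ### The linking number of a spinning -/

section SpinCount

variable {n m : ℕ}

/-- The points `±(1, 0, …, 0)` of the sphere. -/
def pole (m : ℕ) (η : ℤˣ) : UnitSphere m :=
  ⟨EuclideanSpace.single 0 ((η : ℤ) : ℝ), by
    rcases Int.units_eq_one_or η with rfl | rfl <;> simp⟩

theorem pole_apply_zero (η : ℤˣ) : (pole m η).1 0 = ((η : ℤ) : ℝ) := by
  simp [pole]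

theorem pole_apply_of_ne (η : ℤˣ) {i : Fin (m + 1)} (hi : i ≠ 0) : (pole m η).1 i = 0 := by
  simp [pole, hi]

theorem cast_mul_self (η : ℤˣ) : ((η : ℤ) : ℝ) * ((η : ℤ) : ℝ) = 1 := by
  rcases Int.units_eq_one_or η with rfl | rfl <;> simp

/-- Multiplication of the coordinates `x₁` and `y₁` by the sign `η`. -/
def signFlip (η : ℤˣ) : ContactSpace (n + 1) ≃L[ℝ] ContactSpace (n + 1) :=
  LinearEquiv.toContinuousLinearEquiv
    { toFun := fun w => (Fin.cons (((η : ℤ) : ℝ) * w.1 0) fun j => w.1 j.succ,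
        Fin.cons (((η : ℤ) : ℝ) * w.2.1 0) fun j => w.2.1 j.succ, w.2.2)
      invFun := fun w => (Fin.cons (((η : ℤ) : ℝ) * w.1 0) fun j => w.1 j.succ,
        Fin.cons (((η : ℤ) : ℝ) * w.2.1 0) fun j => w.2.1 j.succ, w.2.2)
      map_add' := fun u v => by
        refine Prod.ext (funext fun i => ?_) (Prod.ext (funext fun i => ?_) rfl) <;>
          refine Fin.cases ?_ (fun j => ?_) i <;> simp <;> ring
      map_smul' := fun r u => by
        refine Prod.ext (funext fun i => ?_) (Prod.ext (funext fun i => ?_) rfl) <;>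
          refine Fin.cases ?_ (fun j => ?_) i <;> simp <;> ring
      left_inv := fun w => by
        refine Prod.ext (funext fun i => ?_) (Prod.ext (funext fun i => ?_) rfl) <;>
          refine Fin.cases ?_ (fun j => ?_) i <;> simp [← mul_assoc, cast_mul_self]
      right_inv := fun w => by
        refine Prod.ext (funext fun i => ?_) (Prod.ext (funext fun i => ?_) rfl) <;>
          refine Fin.cases ?_ (fun j => ?_) i <;> simp [← mul_assoc, cast_mul_self] }

theorem signFlip_apply (η : ℤˣ) (w : ContactSpace (n + 1)) :
    signFlip η w = (Fin.cons (((η : ℤ) : ℝ) * w.1 0) fun j => w.1 j.succ,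
        Fin.cons (((η : ℤ) : ℝ) * w.2.1 0) fun j => w.2.1 j.succ, w.2.2) := rfl

/-- Changing the sign of `x₁` and `y₁` undoes the change of sign of the radial direction at the pole
`-1`. -/
theorem spinSplit_pole_signFlip (η : ℤˣ) (w : ContactSpace (n + 1)) :
    spinSplit (pole m η) (signFlip η w, 0, 0) = spinSplit (pole m 1) (w, 0, 0) := by
  have hη := cast_mul_self η
  have h : ∀ (r : ℝ) (i : Fin (m + 1)),
      ((η : ℤ) : ℝ) * r * (pole m η).1 i = r * (pole m 1).1 i := fun r i => by
    by_cases hi : i = 0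
    · subst hi
      rw [pole_apply_zero, pole_apply_zero]
      push_cast
      linear_combination r * hη
    · rw [pole_apply_of_ne η hi, pole_apply_of_ne 1 hi]
      ring
  rw [spinSplit_apply, spinSplit_apply, signFlip_apply]
  simp only [Fin.cons_zero, Fin.cons_succ, map_zero, PiLp.zero_apply, add_zero, h]

variable {M : Type*}

theorem frontSpin_sub_frontSpin (c : ℝ) (f g : M → ContactSpace (n + 1)) (p q : M)
    (σ : UnitSphere m) :
    frontSpin m c g (q, σ) - frontSpin m c f (p, σ) = spinSplit σ (g q - f p, 0, 0) := by
  refine Prod.ext (funext fun i => ?_) (Prod.ext (funext fun i => ?_) rfl) <;>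
    refine Fin.addCases (fun i => ?_) (fun i => ?_) i <;>
    simp [frontSpin, spinSplit_apply] <;> ring

/-- The preimages, under the Gauss map of a pair of spinnings, of a direction in the plane of the
first coordinates lie over the two points `±(1, 0, …, 0)` of the sphere, provided the direction is
steep enough. -/
theorem mem_gaussPreimage_frontSpin_iff {c : ℝ} {f g : M → ContactSpace (n + 1)}
    {w : ContactSpace (n + 1)} (hw : w.2.1 0 ≠ 0)
    (hf : ∀ p, 0 < w.2.1 0 * ((f p).1 0 + c) - w.1 0 * (f p).2.1 0)
    (hg : ∀ p, 0 < w.2.1 0 * ((g p).1 0 + c) - w.1 0 * (g p).2.1 0)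
    (p q : M) (σ τ : UnitSphere m) :
    ((p, σ), (q, τ)) ∈ gaussPreimage (frontSpin m c f) (frontSpin m c g)
        (spinSplit (pole m 1) (w, 0, 0)) ↔
      ∃ η : ℤˣ, σ = pole m η ∧ τ = pole m η ∧ (p, q) ∈ gaussPreimage f g (signFlip η w) := by
  constructor
  · rintro ⟨k, hk, h⟩
    have hx : ∀ i, ((g q).1 0 + c) * τ.1 i - ((f p).1 0 + c) * σ.1 i =
        k * (w.1 0 * (pole m 1).1 i) := fun i => by
      simpa [frontSpin, spinSplit_apply] using congrFun (congrArg Prod.fst h) (Fin.castAdd n i)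
    have hx' : ∀ j : Fin n, (g q).1 j.succ - (f p).1 j.succ = k * w.1 j.succ := fun j => by
      simpa [frontSpin, spinSplit_apply] using
        congrFun (congrArg Prod.fst h) (Fin.natAdd (m + 1) j)
    have hy : ∀ i, (g q).2.1 0 * τ.1 i - (f p).2.1 0 * σ.1 i =
        k * (w.2.1 0 * (pole m 1).1 i) := fun i => by
      simpa [frontSpin, spinSplit_apply] using
        congrFun (congrArg (fun w => w.2.1) h) (Fin.castAdd n i)
    have hy' : ∀ j : Fin n, (g q).2.1 j.succ - (f p).2.1 j.succ = k * w.2.1 j.succ := fun j => by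
      simpa [frontSpin, spinSplit_apply] using
        congrFun (congrArg (fun w => w.2.1) h) (Fin.natAdd (m + 1) j)
    have hz : (g q).2.2 - (f p).2.2 = k * w.2.2 := congrArg (fun w => w.2.2) h
    -- eliminating the direction shows that `σ` and `τ` are positive multiples of each other
    obtain ⟨rfl, -⟩ := UnitSphere.eq_of_pos_mul_eq (σ := τ) (σ' := σ) (hg q) (hf p) fun i => by
      linear_combination w.2.1 0 * hx i - w.1 0 * hy i
    have hy0 : ((g q).2.1 0 - (f p).2.1 0) * τ.1 0 = k * w.2.1 0 := by
      have := hy 0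
      rw [pole_apply_zero] at this
      push_cast at this
      linear_combination this
    have hne : (g q).2.1 0 - (f p).2.1 0 ≠ 0 := fun h0 => by
      rw [h0, zero_mul] at hy0
      exact mul_ne_zero hk.ne' hw hy0.symm
    -- the other `y`-equations show that `τ` is proportional to the first coordinate vector
    have hτ : ∀ i, i ≠ 0 → τ.1 i = 0 := fun i hi => by
      have := hy i
      rw [pole_apply_of_ne 1 hi] at this
      refine (mul_eq_zero.1 ?_ : (g q).2.1 0 - (f p).2.1 0 = 0 ∨ _).resolve_left hne
      linear_combination this
    have hsq : τ.1 0 ^ 2 = 1 := by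
      have hsum : ∑ i, τ.1 i ^ 2 = τ.1 0 ^ 2 :=
        Finset.sum_eq_single 0 (fun i _ hi => by simp [hτ i hi])
          (fun h => absurd (Finset.mem_univ _) h)
      exact hsum.symm.trans (UnitSphere.sum_sq τ)
    obtain ⟨η, hη⟩ : ∃ η : ℤˣ, τ.1 0 = ((η : ℤ) : ℝ) := by
      rcases sq_eq_one_iff.1 hsq with h | h
      · exact ⟨1, by simpa using h⟩
      · exact ⟨-1, by simpa using h⟩
    have hpole : τ = pole m η := Subtype.ext (PiLp.ext fun i => by
      by_cases hi : i = 0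
      · rw [hi, pole_apply_zero, hη]
      · rw [hτ i hi, pole_apply_of_ne η hi])
    have hx0 := hx 0
    rw [pole_apply_zero, hη] at hx0
    push_cast at hx0
    rw [hη] at hy0
    have hηη := cast_mul_self η
    refine ⟨η, hpole, hpole, k, hk, ?_⟩
    rw [signFlip_apply]
    refine Prod.ext (funext fun i => Fin.cases ?_ (fun j => ?_) i)
      (Prod.ext (funext fun i => Fin.cases ?_ (fun j => ?_) i) hz)
    · simp only [Prod.fst_sub, Pi.sub_apply, Prod.smul_fst, Pi.smul_apply, Fin.cons_zero,
        smul_eq_mul]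
      linear_combination ((η : ℤ) : ℝ) * hx0 - ((g q).1 0 - (f p).1 0) * hηη
    · simpa using hx' j
    · simp only [Prod.fst_sub, Prod.snd_sub, Pi.sub_apply, Prod.smul_fst, Prod.smul_snd,
        Pi.smul_apply, Fin.cons_zero, smul_eq_mul]
      linear_combination ((η : ℤ) : ℝ) * hy0 - ((g q).2.1 0 - (f p).2.1 0) * hηη
    · simpa using hy' j
  · rintro ⟨η, rfl, rfl, k, hk, h⟩
    refine ⟨k, hk, ?_⟩
    rw [← spinSplit_pole_signFlip η, ← map_smul, frontSpin_sub_frontSpin]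
    dsimp only at h
    rw [h]
    simp only [Prod.smul_mk, smul_zero]

/-- The pairs over one of the two points of the sphere. -/
def poleMap (m : ℕ) (η : ℤˣ) (pq : M × M) : (M × UnitSphere m) × (M × UnitSphere m) :=
  ((pq.1, pole m η), (pq.2, pole m η))

theorem poleMap_injective (η : ℤˣ) : Function.Injective (poleMap m η : M × M → _) :=
  fun _ _ h => Prod.ext (congrArg (fun x => x.1.1) h) (congrArg (fun x => x.2.1) h)

theorem pole_injective : Function.Injective (pole m) := fun η η' h => by
  have := congrArg (fun σ : UnitSphere m => σ.1 0) h
  simp only [pole_apply_zero] at this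
  exact Units.ext (by exact_mod_cast this)

/-- The preimages of a steep direction consist of one copy of the preimages of `f` and `g` over each
pole, with the direction reflected over the pole `-1`. -/
theorem gaussPreimage_frontSpin {c : ℝ} {f g : M → ContactSpace (n + 1)}
    {w : ContactSpace (n + 1)} (hw : w.2.1 0 ≠ 0)
    (hf : ∀ p, 0 < w.2.1 0 * ((f p).1 0 + c) - w.1 0 * (f p).2.1 0)
    (hg : ∀ p, 0 < w.2.1 0 * ((g p).1 0 + c) - w.1 0 * (g p).2.1 0) :
    gaussPreimage (frontSpin m c f) (frontSpin m c g) (spinSplit (pole m 1) (w, 0, 0)) =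
      poleMap m 1 '' gaussPreimage f g (signFlip 1 w) ∪
        poleMap m (-1) '' gaussPreimage f g (signFlip (-1) w) := by
  ext ⟨⟨p, σ⟩, ⟨q, τ⟩⟩
  rw [mem_gaussPreimage_frontSpin_iff hw hf hg]
  constructor
  · rintro ⟨η, rfl, rfl, h⟩
    rcases Int.units_eq_one_or η with rfl | rfl
    · exact Or.inl ⟨(p, q), h, rfl⟩
    · exact Or.inr ⟨(p, q), h, rfl⟩
  · rintro (⟨⟨p', q'⟩, h, heq⟩ | ⟨⟨p', q'⟩, h, heq⟩) <;>
      simp only [poleMap, Prod.mk.injEq] at heq <;>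
      obtain ⟨⟨rfl, rfl⟩, rfl, rfl⟩ := heq
    · exact ⟨1, rfl, rfl, h⟩
    · exact ⟨-1, rfl, rfl, h⟩

variable {E H : Type*} [NormedAddCommGroup E] [NormedSpace ℝ E] [TopologicalSpace H]
  {I : ModelWithCorners ℝ E H} [I.Boundaryless] [TopologicalSpace M] [ChartedSpace H M]
  [IsManifold I ∞ M]

/-- Since `(p, q)` lies over a steep direction, the determinant of the points `(x₁ + c, y₁)` of `p`
and `q` in the plane has the sign of the pole. -/
theorem sign_linkingDet_poleMap (o : ManifoldOrientation I M (n + 1))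
    (o' : ManifoldOrientation (𝓡 m) (UnitSphere m) m)
    (ord : Fin (n + 1) ⊕ Fin m ≃ Fin (m + 1 + n)) {f g : M → ContactSpace (n + 1)}
    (hf : ContMDiff I 𝓘(ℝ, ContactSpace (n + 1)) ∞ f)
    (hg : ContMDiff I 𝓘(ℝ, ContactSpace (n + 1)) ∞ g) {c : ℝ} (hc : ∀ p, 0 < (f p).1 0 + c)
    {w : ContactSpace (n + 1)}
    (hw : ∀ p, 0 < w.2.1 0 * ((f p).1 0 + c) - w.1 0 * (f p).2.1 0)
    (η : ℤˣ) {pq : M × M} (hpq : pq ∈ gaussPreimage f g (signFlip η w)) :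
    (SignType.sign (linkingDet (I.prod (𝓡 m)) (o.prod o' ord) (frontSpin m c f) (frontSpin m c g)
        (spinSplit (pole m 1) (w, 0, 0)) (poleMap m η pq)) : ℤ) =
      shuffleSign (m + 1 + n) * shuffleSign (n + 1) * (η : ℤ) ^ m *
        SignType.sign (linkingDet I o f g (signFlip η w) pq) := by
  obtain ⟨p, q⟩ := pq
  rw [← spinSplit_pole_signFlip η, poleMap, sign_linkingDet_frontSpin o o' ord hf hg (hc p).ne']
  obtain ⟨k, hk, h⟩ := hpq
  have hx : (g q).1 0 - (f p).1 0 = k * (((η : ℤ) : ℝ) * w.1 0) := by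
    simpa [signFlip_apply] using congrFun (congrArg Prod.fst h) 0
  have hy : (g q).2.1 0 - (f p).2.1 0 = k * (((η : ℤ) : ℝ) * w.2.1 0) := by
    simpa [signFlip_apply] using congrFun (congrArg (fun w => w.2.1) h) 0
  have hval : ((f p).1 0 + c) * (g q).2.1 0 - ((g q).1 0 + c) * (f p).2.1 0 =
      k * (w.2.1 0 * ((f p).1 0 + c) - w.1 0 * (f p).2.1 0) * ((η : ℤ) : ℝ) := by
    linear_combination ((f p).1 0 + c) * hy - (f p).2.1 0 * hx
  have hsign : (SignType.sign (((f p).1 0 + c) * (g q).2.1 0 -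
      ((g q).1 0 + c) * (f p).2.1 0) : ℤ) = (η : ℤ) := by
    rw [hval, sign_mul, sign_pos (mul_pos hk (hw p)), one_mul]
    rcases Int.units_eq_one_or η with rfl | rfl <;> simp
  rw [hsign]
  ring

theorem isRegularDirection_frontSpin (o : ManifoldOrientation I M (n + 1))
    (o' : ManifoldOrientation (𝓡 m) (UnitSphere m) m)
    (ord : Fin (n + 1) ⊕ Fin m ≃ Fin (m + 1 + n)) {f g : M → ContactSpace (n + 1)}
    (hf : ContMDiff I 𝓘(ℝ, ContactSpace (n + 1)) ∞ f)
    (hg : ContMDiff I 𝓘(ℝ, ContactSpace (n + 1)) ∞ g) {c : ℝ} (hc : ∀ p, 0 < (f p).1 0 + c)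
    {w : ContactSpace (n + 1)} (hw0 : w.2.1 0 ≠ 0)
    (hwf : ∀ p, 0 < w.2.1 0 * ((f p).1 0 + c) - w.1 0 * (f p).2.1 0)
    (hwg : ∀ p, 0 < w.2.1 0 * ((g p).1 0 + c) - w.1 0 * (g p).2.1 0)
    (hreg : ∀ η : ℤˣ, IsRegularDirection o f g (signFlip η w)) :
    IsRegularDirection (o.prod o' ord) (frontSpin m c f) (frontSpin m c g)
      (spinSplit (pole m 1) (w, 0, 0)) := by
  constructor
  · intro h
    rw [← map_zero (spinSplit (pole m 1))] at h
    have := congrArg (fun u => u.1.2.1 0) (spinSplit_injective (pole m 1) h)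
    exact hw0 this
  · have key : ∀ (η : ℤˣ), ∀ pq ∈ gaussPreimage f g (signFlip η w),
        linkingDet (I.prod (𝓡 m)) (o.prod o' ord) (frontSpin m c f) (frontSpin m c g)
          (spinSplit (pole m 1) (w, 0, 0)) (poleMap m η pq) ≠ 0 := by
      intro η pq hpq h0
      have h := sign_linkingDet_poleMap o o' ord hf hg hc hwf η hpq
      rw [h0, sign_zero, SignType.coe_zero] at h
      have h1 : shuffleSign (m + 1 + n) * shuffleSign (n + 1) * (η : ℤ) ^ m ≠ 0 :=
        mul_ne_zero (mul_ne_zero (pow_ne_zero _ (by norm_num)) (pow_ne_zero _ (by norm_num)))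
          (pow_ne_zero _ η.ne_zero)
      exact (hreg η).2 pq hpq
        (intCast_sign_eq_zero_iff.1 ((mul_eq_zero.1 h.symm).resolve_left h1))
    intro x hx
    rw [gaussPreimage_frontSpin hw0 hwf hwg] at hx
    rcases hx with ⟨pq, hpq, rfl⟩ | ⟨pq, hpq, rfl⟩
    · exact key 1 pq hpq
    · exact key (-1) pq hpq

/-- The preimages over the two points of the sphere contribute the signed counts of `f` in the
directions `signFlip (±1) w`, with signs that differ by `(-1)^m`. -/
theorem gaussCount_frontSpin (o : ManifoldOrientation I M (n + 1))
    (o' : ManifoldOrientation (𝓡 m) (UnitSphere m) m)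
    (ord : Fin (n + 1) ⊕ Fin m ≃ Fin (m + 1 + n)) {f g : M → ContactSpace (n + 1)}
    (hf : ContMDiff I 𝓘(ℝ, ContactSpace (n + 1)) ∞ f)
    (hg : ContMDiff I 𝓘(ℝ, ContactSpace (n + 1)) ∞ g) {c : ℝ} (hc : ∀ p, 0 < (f p).1 0 + c)
    {w : ContactSpace (n + 1)} (hw0 : w.2.1 0 ≠ 0)
    (hwf : ∀ p, 0 < w.2.1 0 * ((f p).1 0 + c) - w.1 0 * (f p).2.1 0)
    (hwg : ∀ p, 0 < w.2.1 0 * ((g p).1 0 + c) - w.1 0 * (g p).2.1 0)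
    (hfin : ∀ η : ℤˣ, (gaussPreimage f g (signFlip η w)).Finite) :
    gaussCount (o.prod o' ord) (frontSpin m c f) (frontSpin m c g)
        (spinSplit (pole m 1) (w, 0, 0)) =
      shuffleSign (m + 1 + n) * shuffleSign (n + 1) *
        (gaussCount o f g (signFlip 1 w) + (-1) ^ m * gaussCount o f g (signFlip (-1) w)) := by
  have key : ∀ η : ℤˣ, ∑ᶠ x ∈ poleMap m η '' gaussPreimage f g (signFlip η w),
      (SignType.sign (linkingDet (I.prod (𝓡 m)) (o.prod o' ord) (frontSpin m c f)
        (frontSpin m c g) (spinSplit (pole m 1) (w, 0, 0)) x) : ℤ) =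
      shuffleSign (m + 1 + n) * shuffleSign (n + 1) * (η : ℤ) ^ m *
        gaussCount o f g (signFlip η w) := by
    intro η
    rw [finsum_mem_image (poleMap_injective η).injOn, gaussCount, mul_finsum_mem]
    exact finsum_mem_congr rfl fun pq hpq => sign_linkingDet_poleMap o o' ord hf hg hc hwf η hpq
  rw [gaussCount, gaussPreimage_frontSpin hw0 hwf hwg, finsum_mem_union ?_ ((hfin 1).image _)
    ((hfin (-1)).image _), key, key]
  · push_cast
    ring
  · refine disjoint_left.2 ?_
    rintro _ ⟨pq, -, rfl⟩ ⟨pq', -, h⟩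
    have := pole_injective (congrArg (fun x => x.1.2) h)
    exact absurd this (by decide)

end SpinCount

/-! ### The Thurston–Bennequin number of a spinning -/

section SpinThurstonBennequin

variable {n m : ℕ} {E H : Type*} [NormedAddCommGroup E] [NormedSpace ℝ E] [FiniteDimensional ℝ E]
  [TopologicalSpace H] {I : ModelWithCorners ℝ E H} [I.Boundaryless]
  {M : Type*} [TopologicalSpace M] [ChartedSpace H M] [IsManifold I ∞ M]

/-- For even `m` the reordering of the coordinates contributes `(-1)^(m/2)`. -/
theorem shuffleSign_mul_shuffleSign (hm : Even m) :
    shuffleSign (m + 1 + n) * shuffleSign (n + 1) = (-1) ^ (m / 2) := by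
  obtain ⟨r, rfl⟩ := hm
  have h1 : (r + r) / 2 = r := by omega
  have h2 : (r + r + 1 + n) * (r + r + 1 + n - 1) / 2 + (n + 1) * (n + 1 - 1) / 2 =
      r + 2 * (r * r + r * n) + 2 * ((n + 1) * n / 2) := by
    have e1 : (r + r + 1 + n) * (r + r + 1 + n - 1) =
        (n + 1) * n + (r + 2 * (r * r + r * n)) * 2 := by
      have : r + r + 1 + n - 1 = r + r + n := by omega
      rw [this]
      ring
    rw [e1, Nat.add_mul_div_right _ _ two_pos]
    have : n + 1 - 1 = n := by omega
    rw [this]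
    omega
  rw [shuffleSign, shuffleSign, ← pow_add, h2, h1, pow_add, pow_add, pow_mul, pow_mul]
  simp

/-- Directions close to `∂_{y₁}` are steep, that is, the points `(x₁ + c, y₁)` lie on one side of
the line through the origin in such a direction. -/
theorem eventually_steep [CompactSpace M] {f : M → ContactSpace (n + 1)} (hf : Continuous f) {c : ℝ}
    (hc : ∀ p, 0 < (f p).1 0 + c) :
    ∀ᶠ w in 𝓝 ((0, Pi.single 0 1, 0) : ContactSpace (n + 1)),
      w.2.1 0 ≠ 0 ∧ ∀ p, 0 < w.2.1 0 * ((f p).1 0 + c) - w.1 0 * (f p).2.1 0 := by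
  have h1 : ∀ᶠ w in 𝓝 ((0, Pi.single 0 1, 0) : ContactSpace (n + 1)), w.2.1 0 ≠ 0 := by
    have : Continuous fun w : ContactSpace (n + 1) => w.2.1 0 := by fun_prop
    exact this.continuousAt.eventually_ne (by simp)
  have h2 : ∀ᶠ w in 𝓝 ((0, Pi.single 0 1, 0) : ContactSpace (n + 1)), ∀ p ∈ (univ : Set M),
      0 < w.2.1 0 * ((f p).1 0 + c) - w.1 0 * (f p).2.1 0 := by
    refine isCompact_univ.eventually_forall_of_forall_eventually fun p _ => ?_
    have : Continuous fun z : ContactSpace (n + 1) × M =>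
        z.1.2.1 0 * ((f z.2).1 0 + c) - z.1.1 0 * (f z.2).2.1 0 := by fun_prop
    refine continuousAt_const.eventually_lt this.continuousAt ?_
    simpa using hc p
  filter_upwards [h1, h2] with w hw1 hw2
  exact ⟨hw1, fun p => hw2 p (mem_univ p)⟩

/-- The Thurston–Bennequin numbers of `f` and of its spinning, computed with the same small
translation and with directions that correspond to each other. -/
theorem exists_thurstonBennequinNumber_frontSpin [T2Space M] [CompactSpace M] [ConnectedSpace M]
    (hm : 1 ≤ m) (o : ManifoldOrientation I M (n + 1)) {f : M → ContactSpace (n + 1)}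
    (hf : ContMDiff I 𝓘(ℝ, ContactSpace (n + 1)) ∞ f) (hchords : (reebChords f).Finite) {c : ℝ}
    (hc : ∀ p, 0 < (f p).1 0 + c) :
    ∃ t : ℤ, (∀ k : ℤ, IsThurstonBennequinNumber I f k ↔ k = t) ∧
      (∀ k : ℤ, IsThurstonBennequinNumber (I.prod (𝓡 m)) (frontSpin m c f) k ↔
        k = if Even m then 2 * (-1) ^ (m / 2) * t else 0) := by
  obtain ⟨o'⟩ := nonempty_sphere_orientation hm
  have : ConnectedSpace (UnitSphere m) := by
    refine isConnected_iff_connectedSpace.1 (isConnected_sphere ?_ 0 zero_le_one)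
    rw [← Module.finrank_eq_rank, finrank_euclideanSpace_fin]
    exact_mod_cast (by omega : 1 < m + 1)
  let ord : Fin (n + 1) ⊕ Fin m ≃ Fin (m + 1 + n) :=
    finSumFinEquiv.trans (finCongr (by ring))
  obtain ⟨δ, hδ, hdisj⟩ := exists_forall_disjoint_reebShift hchords
  obtain ⟨ε, hε⟩ := exists_between hδ
  have hε' : ε ∈ Ioo 0 δ := hε
  set g : M → ContactSpace (n + 1) := fun p => reebShift ε (f p) with hg_def
  have hg : ContMDiff I 𝓘(ℝ, ContactSpace (n + 1)) ∞ g := by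
    have : g = fun p => f p + (0, 0, ε) := funext fun p => reebShift_eq_add ε (f p)
    rw [this]
    exact hf.add contMDiff_const
  have h1 : (1 : WithTop ℕ∞) ≤ ∞ := by simp
  -- a direction close to `∂_{y₁}` that is regular for `f` together with its reflection
  obtain ⟨w, ⟨hw0, hwf⟩, hreg⟩ := exists_isRegularDirection o (ι := ℤˣ) (f := fun _ => f)
    (g := fun _ => g) (fun _ => hf.of_le h1) (fun _ => hg.of_le h1) (fun _ => hdisj ε hε')
    signFlip (v := (0, Pi.single 0 1, 0)) (fun h => by
      have := congrFun (congrArg (fun w : ContactSpace (n + 1) => w.2.1) h) 0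
      simp at this) (eventually_steep hf.continuous hc)
  have hwg : ∀ p, 0 < w.2.1 0 * ((g p).1 0 + c) - w.1 0 * (g p).2.1 0 := hwf
  have hreg' := isRegularDirection_frontSpin o o' ord hf hg hc hw0 hwf hwg hreg
  have hcount := gaussCount_frontSpin o o' ord hf hg hc hw0 hwf hwg fun η =>
    finite_gaussPreimage o (hf.of_le h1) (hg.of_le h1) (hdisj ε hε') (hreg η)
  have hspin : frontSpin m c g = fun x => reebShift ε (frontSpin m c f x) := rfl
  rw [gaussCount_eq o n.succ_ne_zero (hf.of_le h1) (hg.of_le h1) (hdisj ε hε') (hreg (-1))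
    (hreg 1)] at hcount
  rw [hspin] at hcount hreg'
  refine ⟨-gaussCount o f g (signFlip 1 w), fun k =>
    isThurstonBennequinNumber_iff o n.succ_ne_zero (hf.of_le h1) hdisj hε' (hreg 1) k,
    fun k => ?_⟩
  rw [isThurstonBennequinNumber_iff (o.prod o' ord) (by omega)
    ((contMDiff_frontSpin hf c).of_le h1)
    (fun ε hε => disjoint_frontSpin_reebShift hc (hdisj ε hε)) hε' hreg' k, hcount]
  split_ifs with heven
  · rw [shuffleSign_mul_shuffleSign heven, heven.neg_one_pow]
    constructor <;> rintro rfl <;> ring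
  · rw [(Nat.not_even_iff_odd.1 heven).neg_one_pow]
    constructor <;> rintro rfl <;> ring

end SpinThurstonBennequin

end

theorem mainTheorem4 (n m : ℕ) (hm : 1 ≤ m)
    {M : Type*} [TopologicalSpace M] [T2Space M] [CompactSpace M] [ConnectedSpace M]
    [ChartedSpace (EuclideanSpace ℝ (Fin (n + 1))) M] [IsManifold (𝓡 (n + 1)) ∞ M]
    (hM : Nonempty (ManifoldOrientation (𝓡 (n + 1)) M (n + 1)))
    (f : M → ContactSpace (n + 1)) (hf : IsLegendrianEmbedding (𝓡 (n + 1)) f)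
    (hchords : (reebChords f).Finite)
    {L : Type*} [TopologicalSpace L] [T2Space L] [SecondCountableTopology L]
    [ChartedSpace (EuclideanSpace ℝ (Fin (n + 2))) L] [IsManifold (𝓡 (n + 2)) ∞ L]
    (F : L → ℝ × ContactSpace (n + 1))
    (hF : IsExactLagrangianFilling (𝓡 (n + 2)) F (range f))
    (c : ℝ) (hc : ∀ p, 0 < (f p).1 0 + c) :
    IsLegendrianEmbedding ((𝓡 (n + 1)).prod (𝓡 m)) (frontSpin m c f) ∧
    Nonempty (range (frontSpin m c f) ≃ₜ range f × UnitSphere m) ∧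
    (∀ (g : M → ContactSpace (n + 1)) (c' : ℝ), IsLegendrianEmbedding (𝓡 (n + 1)) g →
      (∀ p, 0 < (g p).1 0 + c') →
      rotationClass (𝓡 (n + 1)) g = rotationClass (𝓡 (n + 1)) f →
      rotationClass ((𝓡 (n + 1)).prod (𝓡 m)) (frontSpin m c' g) =
        rotationClass ((𝓡 (n + 1)).prod (𝓡 m)) (frontSpin m c f)) ∧
    ∃ t : ℤ,
      (∀ k : ℤ, IsThurstonBennequinNumber (𝓡 (n + 1)) f k ↔ k = t) ∧
      (∀ k : ℤ, IsThurstonBennequinNumber ((𝓡 (n + 1)).prod (𝓡 m)) (frontSpin m c f) k ↔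
        k = if Even m then 2 * (-1) ^ (m / 2) * t else 0) := by
  obtain ⟨o⟩ := hM
  have : IsManifold (𝓡 (n + 1)) 2 M := IsManifold.of_le two_le_infty
  exact ⟨hf.frontSpin hc, nonempty_homeomorph_range_frontSpin hf.embedding hc,
    fun g c' hg hc' h => rotationClass_frontSpin_eq hf hg hc hc' h,
    exists_thurstonBennequinNumber_frontSpin hm o hf.smooth hchords hc⟩
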